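/- Let $k_x>0$, $k_y\neq 0$ with $k_x^2+k_y^2=1$, let $\epsilon>0$ and $\nu>0$, and let $g\in\mathcal S'(\mathbb R)$ be a tempered distribution. Let $u\in\mathcal C^\infty_x([0,\infty),\mathcal S'_y(\mathbb R))$ be a solution of the half-plane problem $$i(k_x\partial_x+k_y\partial_y)u+\frac{\epsilon}{2}\bigl(k_x^2\partial_y^2-2k_xk_y\partial_x\partial_y+k_y^2\partial_x^2\bigr)u+i\nu u=0\quad\text{for }x>0,\ y\in\mathbb R,$$ $$i\epsilon k_y(k_x\partial_y-k_y\partial_x)u|_{x=0}+2k_xu|_{x=0}=2k_xg,$$ which is a tempered distribution, i.e. the distribution $\Phi\mapsto\int_0^\infty\langle u(x),\Phi(x,\cdot)\rangle\,dx$ on the open half-plane $(0,\infty)\times\mathbb R$ is the restriction of a tempered distribution on $\mathbb R^2$. Let $\mathcal F_y$ be the Fourier transform $\mathcal F_y(\varphi;\eta)=\int e^{-i\eta y}\varphi(y)\,dy$, extended to $\mathcal S'(\mathbb R)$, and let, with the principal square root, $$R_-(i\eta)=i\frac{k_x\eta}{k_y}-i\frac{k_x}{\epsilon k_y^2}\Bigl(1-\sqrt{1-2\frac{\epsilon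 k_y\eta}{k_x^2}+2i\nu\frac{\epsilon k_y^2}{k_x^2}}\Bigr).$$ In each condition below, "$w\,\mathcal F_y(g)\in L^2_\eta(\mathbb R)$" means that $\mathcal F_y(g)$ is a function and that its product with the weight $w$ is square integrable. 1. If $\dfrac{\mathcal F_y(g;\eta)}{(1+|\eta|^2)^{1/4}\sqrt{|\mathrm{Re}\,R_-(i\eta)|}}\in L^2_\eta(\mathbb R)$, then $u\in L^2((0,\infty)\times\mathbb R)$. 2. If $\dfrac{\mathcal F_y(g;\eta)(1+|\eta|^2)^{s/2}}{\sqrt{|\mathrm{Re}\,R_-(i\eta)|}}\in L^2_\eta(\mathbb R)$ for some $s>0$, then $u\in L^\infty_y(\mathbb R,L^2_x(0,\infty))$. More generally, for every integer $m\ge 0$, if $\dfrac{\mathcal F_y(g;\eta)(1+|\eta|^2)^{s/2}|R_-(i\eta)|^m}{\sqrt{|\mathrm{Re}\,R_-(i\eta)|}}\in L^2_\eta(\mathbb R)$ for some $s>0$, then $u\in L^\infty_y(\mathbb R,H^m_x(0,\infty))$. -/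

import Mathlib

open MeasureTheory Set
open scoped SchwartzMap ContDiff ENNReal NNReal

noncomputable section

namespace ObliqueParaxial

/-! ### Fourier transform and tempered distributions in the variable `y` -/

/-- The Fourier transform with angular frequency on Schwartz functions,
`φ ↦ (η ↦ ∫ exp (-i η y) φ(y) dy)`, obtained from Mathlib's transform (which has `exp (-2 π i η y)`)
by the rescaling `η ↦ η / (2 π)`. -/
def fourierSchwartz : 𝓢(ℝ, ℂ) →L[ℂ] 𝓢(ℝ, ℂ) :=
  (SchwartzMap.compCLMOfContinuousLinearEquiv ℂ
    (ContinuousLinearEquiv.unitsEquivAut ℝ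
      (Units.mk0 ((2 * Real.pi)⁻¹ : ℝ) (inv_ne_zero Real.two_pi_pos.ne')))) ∘L
    (SchwartzMap.fourierTransformCLM ℂ : 𝓢(ℝ, ℂ) →L[ℂ] 𝓢(ℝ, ℂ))

theorem fourierSchwartz_apply (φ : 𝓢(ℝ, ℂ)) (η : ℝ) :
    fourierSchwartz φ η = ∫ y : ℝ, Complex.exp (-(Complex.I * η * y)) * φ y := by
  have h : fourierSchwartz φ η
      = FourierTransform.fourier (φ : ℝ → ℂ) (η * (2 * Real.pi)⁻¹) := rfl
  rw [h, Real.fourier_eq']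
  refine integral_congr_ae (Filter.Eventually.of_forall fun y => ?_)
  have hpi : (Real.pi : ℂ) ≠ 0 := Complex.ofReal_ne_zero.mpr Real.pi_ne_zero
  simp only [RCLike.inner_apply, conj_trivial, smul_eq_mul]
  congr 2
  push_cast
  field_simp

/-- The Fourier transform `𝓕_y` (angular frequency) of a tempered distribution,
`⟨𝓕_y T, φ⟩ = ⟨T, 𝓕_y φ⟩`. -/
def fourierY (T : 𝓢'(ℝ, ℂ)) : 𝓢'(ℝ, ℂ) :=
  PointwiseConvergenceCLM.precomp ℂ fourierSchwartz T

/-- The tempered distribution `T` is given by the function `f`. -/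
def IsGivenBy (T : 𝓢'(ℝ, ℂ)) (f : ℝ → ℂ) : Prop :=
  ∀ φ : 𝓢(ℝ, ℂ), Integrable (fun y => f y * φ y) ∧ T φ = ∫ y, f y * φ y

/-- `w(η) 𝓕_y(g; η) ∈ L²_η(ℝ)`: the distribution `𝓕_y g` is a function `f`, and `w f` is square
integrable. -/
def WeightedFourierL2 (w : ℝ → ℝ) (g : 𝓢'(ℝ, ℂ)) : Prop :=
  ∃ f : ℝ → ℂ, IsGivenBy (fourierY g) f ∧ MemLp (fun η => (w η : ℂ) * f η) 2 volume

/-! ### The half-plane problem -/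

/-- The symbol `R_-(iη)`; the square root is the principal one. -/
def Rminus (kx ky ε ν : ℝ) (η : ℝ) : ℂ :=
  Complex.I * (kx * η / ky) -
    Complex.I * (kx / (ε * ky ^ 2)) *
      (1 - Complex.sqrt (1 - 2 * (ε * ky * η / kx ^ 2) + 2 * Complex.I * ν * (ε * ky ^ 2 / kx ^ 2)))

/-- The restriction `Φ(x, ·)` of a Schwartz function of two variables to a vertical line. -/
def slice (x : ℝ) : 𝓢(ℝ × ℝ, ℂ) →L[ℂ] 𝓢(ℝ, ℂ) :=
  SchwartzMap.compCLM ℂ (g := fun y : ℝ => (x, y))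
    (by
      have h := (Function.HasTemperateGrowth.const ((x, 0) : ℝ × ℝ)).add
        (ContinuousLinearMap.inr ℝ ℝ ℝ).hasTemperateGrowth
      convert h using 1
      ext y <;> simp)
    ⟨1, 1, fun y => by
      have : ‖y‖ ≤ ‖(x, y)‖ := norm_snd_le (x, y)
      simp only [pow_one, one_mul]
      linarith⟩

theorem slice_apply (x : ℝ) (Φ : 𝓢(ℝ × ℝ, ℂ)) (y : ℝ) : slice x Φ y = Φ (x, y) := rfl

/-- `u ∈ C^∞_x([0,∞), 𝓢'_y(ℝ))`, smooth up to `x = 0`. A map into `𝓢'` with its topology of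
pointwise convergence is smooth when all its pairings with Schwartz functions are. -/
def SmoothInX (u : ℝ → 𝓢'(ℝ, ℂ)) : Prop :=
  ∀ φ : 𝓢(ℝ, ℂ), ContDiffOn ℝ ∞ (fun x => u x φ) (Ici 0)

/-- The distribution `Φ ↦ ∫_0^∞ ⟨u(x), Φ(x, ·)⟩ dx` on the open half-plane `x > 0` is tempered: it is
the restriction of a tempered distribution on the plane. -/
def TemperedOnHalfPlane (u : ℝ → 𝓢'(ℝ, ℂ)) : Prop :=
  ∃ T : 𝓢'(ℝ × ℝ, ℂ), ∀ Φ : 𝓢(ℝ × ℝ, ℂ), HasCompactSupport Φ →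
    tsupport Φ ⊆ Ioi (0 : ℝ) ×ˢ (univ : Set ℝ) →
      T Φ = ∫ x in Ioi (0 : ℝ), u x (slice x Φ)

/-- The distributional derivative `∂_y`. -/
abbrev dy (T : 𝓢'(ℝ, ℂ)) : 𝓢'(ℝ, ℂ) := TemperedDistribution.derivCLM ℂ T

/-- `⟨∂_x u(x), φ⟩` (one-sided derivative at `x = 0`). -/
def dxPair (u : ℝ → 𝓢'(ℝ, ℂ)) (x : ℝ) (φ : 𝓢(ℝ, ℂ)) : ℂ :=
  derivWithin (fun t => u t φ) (Ici 0) x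

/-- `⟨∂_x² u(x), φ⟩`. -/
def dxxPair (u : ℝ → 𝓢'(ℝ, ℂ)) (x : ℝ) (φ : 𝓢(ℝ, ℂ)) : ℂ :=
  iteratedDerivWithin 2 (fun t => u t φ) (Ici 0) x

/-- `u` is a solution of the half-plane problem with entrance data `g`, in the class of tempered
distributions in `C^∞_x([0,∞), 𝓢'_y(ℝ))`. Only the values `u x` with `0 ≤ x` are relevant. -/
structure IsHalfPlaneSolution (kx ky ε ν : ℝ) (g : 𝓢'(ℝ, ℂ)) (u : ℝ → 𝓢'(ℝ, ℂ)) : Prop where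
  smooth : SmoothInX u
  tempered : TemperedOnHalfPlane u
  /-- `i(k_x ∂_x + k_y ∂_y)u + (ε/2)(k_x² ∂_y² - 2 k_x k_y ∂_x∂_y + k_y² ∂_x²)u + iνu = 0`. -/
  equation : ∀ x : ℝ, 0 < x → ∀ φ : 𝓢(ℝ, ℂ),
    Complex.I * (kx * dxPair u x φ + ky * dy (u x) φ)
      + (ε / 2) * (kx ^ 2 * dy (dy (u x)) φ - 2 * kx * ky * dxPair (fun t => dy (u t)) x φ
          + ky ^ 2 * dxxPair u x φ)
      + Complex.I * ν * u x φ = 0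
  /-- `iε k_y (k_x ∂_y - k_y ∂_x)u + 2 k_x u = 2 k_x g` at `x = 0`. -/
  boundary : ∀ φ : 𝓢(ℝ, ℂ),
    Complex.I * ε * ky * (kx * dy (u 0) φ - ky * dxPair u 0 φ) + 2 * kx * u 0 φ = 2 * kx * g φ

/-! ### Function spaces on the half-plane -/

/-- Lebesgue measure on `(0,∞)`. -/
abbrev halfLine : Measure ℝ := volume.restrict (Ioi 0)

/-- Lebesgue measure on `(0,∞) × ℝ`. -/
abbrev halfPlane : Measure (ℝ × ℝ) := volume.restrict (Ioi (0 : ℝ) ×ˢ (univ : Set ℝ))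

/-- On the open half-plane, `u` is the function `U`. -/
def IsFunctionOnHalfPlane (u : ℝ → 𝓢'(ℝ, ℂ)) (U : ℝ × ℝ → ℂ) : Prop :=
  AEStronglyMeasurable U halfPlane ∧ ∀ᵐ x ∂halfLine, IsGivenBy (u x) (fun y => U (x, y))

/-- `u ∈ L²((0,∞) × ℝ)`. -/
def MemL2HalfPlane (u : ℝ → 𝓢'(ℝ, ℂ)) : Prop :=
  ∃ U : ℝ × ℝ → ℂ, IsFunctionOnHalfPlane u U ∧ MemLp U 2 halfPlane

/-- `u ∈ L^∞_y(ℝ, L²_x(0,∞))`. -/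
def MemLinftyL2 (u : ℝ → 𝓢'(ℝ, ℂ)) : Prop :=
  ∃ U : ℝ × ℝ → ℂ, IsFunctionOnHalfPlane u U ∧
    ∃ C : ℝ≥0, ∀ᵐ y : ℝ, MemLp (fun x => U (x, y)) 2 halfLine ∧
      eLpNorm (fun x => U (x, y)) 2 halfLine ≤ C

/-- `h` is the weak derivative of order `j` of `f` on `(0,∞)`. -/
def IsWeakDeriv (j : ℕ) (f h : ℝ → ℂ) : Prop :=
  ∀ χ : ℝ → ℂ, ContDiff ℝ ∞ χ → HasCompactSupport χ → tsupport χ ⊆ Ioi 0 →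
    ∫ x in Ioi (0 : ℝ), f x * iteratedDeriv j χ x = (-1) ^ j * ∫ x in Ioi (0 : ℝ), h x * χ x

/-- `f` belongs to the Sobolev space `H^m(0,∞)` with `∑_{j ≤ m} ‖f^{(j)}‖_{L²}² ≤ C²`. -/
def MemHmLe (m : ℕ) (f : ℝ → ℂ) (C : ℝ≥0) : Prop :=
  ∃ F : ℕ → ℝ → ℂ, F 0 = f ∧
    (∀ j ≤ m, MemLp (F j) 2 halfLine ∧ IsWeakDeriv j f (F j)) ∧
    ∑ j ∈ Finset.range (m + 1), eLpNorm (F j) 2 halfLine ^ 2 ≤ (C : ℝ≥0∞) ^ 2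

/-- `u ∈ L^∞_y(ℝ, H^m_x(0,∞))`. -/
def MemLinftyHm (m : ℕ) (u : ℝ → 𝓢'(ℝ, ℂ)) : Prop :=
  ∃ U : ℝ × ℝ → ℂ, IsFunctionOnHalfPlane u U ∧
    ∃ C : ℝ≥0, ∀ᵐ y : ℝ, MemHmLe m (fun x => U (x, y)) C

end ObliqueParaxial

end

noncomputable section

namespace ObliqueParaxial

open Filter Topology

/-! ### Completeness of the Schwartz space of the line and uniform boundedness -/

/-! After the Fourier transform in `y` the equation is an ordinary differential equation in `x` with
parameter `η`. Because `kx² + ky² = 1`, it factors as `(∂_x - R_+)(∂_x - R_-) û = 0`, where `Re R_-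
< 0 < Re R_+` (`Admissible.Rplus_mul_Rminus`, `Admissible.sqrt_im_pos`). The function `v = (∂_x -
R_-) û` solves `∂_x v = R_+ v`, so it grows exponentially unless it vanishes, and temperedness on
the half-plane excludes the growth (`integral_factorPair_eq_zero`). Hence `û(x) = exp (x R_-) û(0)`,
and the boundary condition turns into `(1 + √D) û(0) = 2 ĝ`, with `D` the argument of the square
root (`discr`). This gives the explicit formula of `solution_eq_integral`.

The multipliers `exp (x R_±)` are smooth, but `exp (x R_+)` is not of temperate growth. The
differential equation is therefore solved in duality with compactly supported functions of `η`
(`Test`), where every smooth function acts. Differentiating `s ↦ ⟨û(s), φ_s⟩` with both arguments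
moving needs bounds on `û(s)` and `∂_x û(s)` that are uniform for `s` in compact sets. They come
from the uniform boundedness principle on the Schwartz space (`exists_uniform_bound`), and
`eq_expS_of_hasDerivWithinAt` then integrates the equation.

For the regularity, write `û = h exp (x R_-)` with `h = 2 ĝ / (1 + √D)`. Since `|1 + √D|² ≥ 1 + |D|`
and `D` is affine in `η` with nonzero slope, the boundary condition gains the weight `(1 +
|η|²)^(-1/4)` (`exists_norm_amplitude_le`). The square-integral of `exp (x R_-)` over `x > 0` is `1
/ (2 |Re R_-|)`. With Plancherel in `y` this gives the `L²` statement
(`eLpNorm_superposition_halfPlane_le`). For fixed `y`, a weighted Cauchy–Schwarz inequality bounds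
the `L²_x` norm by the integral of `|h| / √|Re R_-|` (`eLpNorm_superposition_sq_le`). That integral
is finite because `(1 + |η|²)^(-1/4 - s/2)` is square integrable. Each `x`-derivative multiplies `h`
by `R_-`, and `|R_-|` is bounded below, so the weight of order `m` controls all lower orders. -/

theorem iteratedDeriv_sub_schwartz (l : ℕ) (f g : 𝓢(ℝ, ℂ)) (x : ℝ) :
    iteratedDeriv l (f - g : 𝓢(ℝ, ℂ)) x = iteratedDeriv l f x - iteratedDeriv l g x := by
  have := iteratedDeriv_sub (x := x) ((f.smooth l).contDiffAt) ((g.smooth l).contDiffAt)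
  simpa using this

/-- A sequence of Schwartz functions that is Cauchy for all seminorms converges. -/
theorem exists_tendsto_of_cauchy_seminorm (f : ℕ → 𝓢(ℝ, ℂ))
    (hf : ∀ k l : ℕ, ∀ ε > 0, ∃ n₀, ∀ m ≥ n₀, ∀ n ≥ n₀,
      SchwartzMap.seminorm ℝ k l (f m - f n) < ε) :
    ∃ g : 𝓢(ℝ, ℂ), Tendsto f atTop (𝓝 g) := by
  have key : ∀ l : ℕ, ∀ x : ℝ, ∃ z : ℂ, Tendsto (fun n => iteratedDeriv l (f n) x) atTop (𝓝 z) := by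
    intro l x
    apply cauchySeq_tendsto_of_complete
    rw [Metric.cauchySeq_iff]
    intro ε hε
    obtain ⟨n₀, hn₀⟩ := hf 0 l ε hε
    refine ⟨n₀, fun m hm n hn => ?_⟩
    rw [dist_eq_norm, ← iteratedDeriv_sub_schwartz]
    have := SchwartzMap.le_seminorm' ℝ 0 l (f m - f n) x
    rw [pow_zero, one_mul] at this
    exact this.trans_lt (hn₀ m hm n hn)
  choose g hg using key
  have bound : ∀ k l : ℕ, ∀ ε > 0, ∃ n₀, ∀ n ≥ n₀, ∀ x : ℝ,
      |x| ^ k * ‖iteratedDeriv l (f n) x - g l x‖ ≤ ε := by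
    intro k l ε hε
    obtain ⟨n₀, hn₀⟩ := hf k l ε hε
    refine ⟨n₀, fun n hn x => ?_⟩
    have ht : Tendsto (fun m => |x| ^ k * ‖iteratedDeriv l (f n) x - iteratedDeriv l (f m) x‖) atTop
        (𝓝 (|x| ^ k * ‖iteratedDeriv l (f n) x - g l x‖)) :=
      (tendsto_const_nhds.sub (hg l x)).norm.const_mul _
    refine le_of_tendsto ht ?_
    filter_upwards [eventually_ge_atTop n₀] with m hm
    rw [← iteratedDeriv_sub_schwartz]
    exact (SchwartzMap.le_seminorm' ℝ k l (f n - f m) x).trans (hn₀ n hn m hm).le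
  -- The derivatives of order `l + 1` converge uniformly, so the limit of the derivatives is the
  -- derivative of the limit.
  have hderiv : ∀ l x, HasDerivAt (g l) (g (l + 1) x) x := by
    intro l x
    refine hasDerivAt_of_tendstoUniformly (l := atTop) (f := fun n => iteratedDeriv l (f n))
      (f' := fun n => iteratedDeriv (l + 1) (f n)) ?_ ?_ (hg l) x
    · rw [Metric.tendstoUniformly_iff]
      intro ε hε
      obtain ⟨n₀, hn₀⟩ := bound 0 (l + 1) (ε / 2) (by positivity)
      filter_upwards [eventually_ge_atTop n₀] with n hn y
      have := hn₀ n hn y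
      rw [pow_zero, one_mul] at this
      rw [dist_comm, dist_eq_norm]
      linarith
    · refine Eventually.of_forall fun n y => ?_
      rw [iteratedDeriv_succ]
      refine (DifferentiableAt.hasDerivAt ?_)
      exact ((f n).smooth ⊤).differentiable_iteratedDeriv l (by exact_mod_cast WithTop.coe_lt_top l) y
  have hiter : ∀ l, iteratedDeriv l (g 0) = g l := by
    intro l
    induction l with
    | zero => simp
    | succ l ih =>
      rw [iteratedDeriv_succ, ih]
      exact funext fun x => (hderiv l x).deriv
  have hsmooth : ContDiff ℝ ∞ (g 0) := by
    refine contDiff_of_differentiable_iteratedDeriv fun l _ => ?_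
    rw [hiter]
    exact fun x => (hderiv l x).differentiableAt
  let G : 𝓢(ℝ, ℂ) := 
    { toFun := g 0
      smooth' := hsmooth
      decay' := by
        intro k l
        obtain ⟨n₀, hn₀⟩ := bound k l 1 one_pos
        refine ⟨SchwartzMap.seminorm ℝ k l (f n₀) + 1, fun x => ?_⟩
        rw [norm_iteratedFDeriv_eq_norm_iteratedDeriv, hiter, Real.norm_eq_abs]
        have h1 := hn₀ n₀ le_rfl x
        have h2 := SchwartzMap.le_seminorm' ℝ k l (f n₀) x
        have h3 : ‖g l x‖ ≤ ‖iteratedDeriv l (f n₀) x‖ + ‖iteratedDeriv l (f n₀) x - g l x‖ := by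
          have := norm_sub_le (iteratedDeriv l (f n₀) x) (iteratedDeriv l (f n₀) x - g l x)
          simpa using this
        calc |x| ^ k * ‖g l x‖ ≤ |x| ^ k * (‖iteratedDeriv l (f n₀) x‖ +
              ‖iteratedDeriv l (f n₀) x - g l x‖) := by gcongr
          _ ≤ _ := by rw [mul_add]; gcongr }
  refine ⟨G, ?_⟩
  rw [(schwartz_withSeminorms ℝ ℝ ℂ).tendsto_nhds]
  rintro ⟨k, l⟩ ε hε
  obtain ⟨n₀, hn₀⟩ := bound k l (ε / 2) (by positivity)
  filter_upwards [eventually_ge_atTop n₀] with n hn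
  refine lt_of_le_of_lt (SchwartzMap.seminorm_le_bound' ℝ k l (f n - G) (by positivity) fun x => ?_)
    (half_lt_self hε)
  rw [iteratedDeriv_sub_schwartz]
  have : iteratedDeriv l G x = g l x := congrFun (hiter l) x
  rw [this]
  exact hn₀ n hn x

instance : (uniformity 𝓢(ℝ, ℂ)).IsCountablyGenerated :=
  IsUniformAddGroup.uniformity_countably_generated

/-- Completeness and a countably generated uniformity make the Schwartz space a Baire space, hence
barrelled. This is what the uniform boundedness principle requires. -/
instance : CompleteSpace 𝓢(ℝ, ℂ) := by
  refine UniformSpace.complete_of_cauchySeq_tendsto fun f hf => ?_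
  refine exists_tendsto_of_cauchy_seminorm f fun k l ε hε => ?_
  have hc : Continuous (SchwartzMap.seminorm ℝ k l : 𝓢(ℝ, ℂ) → ℝ) :=
    (schwartz_withSeminorms ℝ ℝ ℂ).continuous_seminorm (k, l)
  have hU : {φ : 𝓢(ℝ, ℂ) | SchwartzMap.seminorm ℝ k l φ < ε} ∈ 𝓝 (0 : 𝓢(ℝ, ℂ)) :=
    (isOpen_lt hc continuous_const).mem_nhds (by simpa using hε)
  have hent : {p : 𝓢(ℝ, ℂ) × 𝓢(ℝ, ℂ) | SchwartzMap.seminorm ℝ k l (p.1 - p.2) < ε} ∈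
      uniformity 𝓢(ℝ, ℂ) := by
    rw [uniformity_eq_comap_nhds_zero]
    refine ⟨_, hU, fun p hp => ?_⟩
    have hp' : SchwartzMap.seminorm ℝ k l (p.2 - p.1) < ε := hp
    rw [mem_ofPred_eq, map_sub_rev]
    exact hp'
  have h := hf.tendsto_uniformity
  obtain ⟨n₀, hn₀⟩ := mem_atTop_sets.1 (h hent) |>.imp fun _ h => h
  refine ⟨max n₀.1 n₀.2, fun m hm n hn => ?_⟩
  exact hn₀ (m, n) ⟨(le_max_left _ _).trans hm, (le_max_right _ _).trans hn⟩

instance : BarrelledSpace ℂ 𝓢(ℝ, ℂ) := by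
  let := UniformSpace.pseudoMetricSpace 𝓢(ℝ, ℂ)
  exact BaireSpace.instBarrelledSpace

/-- The sum of the Schwartz seminorms of orders up to `N`. -/
def snorm (N : ℕ) (φ : 𝓢(ℝ, ℂ)) : ℝ :=
  ∑ i ∈ Finset.Iic (N, N), SchwartzMap.seminorm ℂ i.1 i.2 φ

theorem snorm_nonneg (N : ℕ) (φ : 𝓢(ℝ, ℂ)) : 0 ≤ snorm N φ :=
  Finset.sum_nonneg fun _ _ => apply_nonneg _ _

theorem continuous_snorm (N : ℕ) : Continuous (snorm N) :=
  continuous_finsetSum _ fun i _ => (schwartz_withSeminorms ℂ ℝ ℂ).continuous_seminorm i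

theorem exists_le_snorm_of_continuous (p : Seminorm ℂ 𝓢(ℝ, ℂ)) (hp : Continuous p) :
    ∃ N : ℕ, ∃ C : ℝ, 0 ≤ C ∧ ∀ φ, p φ ≤ C * snorm N φ := by
  obtain ⟨s, C, -, h⟩ := Seminorm.bound_of_continuous (schwartz_withSeminorms ℂ ℝ ℂ) p hp
  obtain ⟨M, hM⟩ := s.bddAbove
  refine ⟨max M.1 M.2, C, C.2, fun φ => (h φ).trans ?_⟩
  rw [smul_apply, NNReal.smul_def, smul_eq_mul]
  refine mul_le_mul_of_nonneg_left ?_ C.2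
  have h1 := Seminorm.finset_sup_le_sum (schwartzSeminormFamily ℂ ℝ ℂ) s φ
  refine h1.trans ?_
  rw [sum_apply]
  refine Finset.sum_le_sum_of_subset_of_nonneg (fun i hi => ?_) fun i _ _ => apply_nonneg _ _
  have := hM hi
  exact Finset.mem_Iic.2 ⟨this.1.trans (le_max_left _ _), this.2.trans (le_max_right _ _)⟩

/-- The uniform boundedness principle for tempered distributions on the line. -/
theorem exists_uniform_bound {ι : Type*} (f : ι → 𝓢(ℝ, ℂ) →L[ℂ] ℂ)
    (h : ∀ φ, ∃ C : ℝ, ∀ i, ‖f i φ‖ ≤ C) :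
    ∃ N : ℕ, ∃ C : ℝ, 0 ≤ C ∧ ∀ i φ, ‖f i φ‖ ≤ C * snorm N φ := by
  let p : ι → Seminorm ℂ 𝓢(ℝ, ℂ) := fun i => (normSeminorm ℂ ℂ).comp (f i).toLinearMap
  have hb : BddAbove (range p) := by
    rw [Seminorm.bddAbove_range_iff]
    intro φ
    obtain ⟨C, hC⟩ := h φ
    exact ⟨C, by rintro _ ⟨i, rfl⟩; exact hC i⟩
  have hc : Continuous (⨆ i, p i : 𝓢(ℝ, ℂ) → ℝ) :=
    Seminorm.continuous_iSup p (fun i => (f i).continuous.norm) hb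
  rw [← Seminorm.coe_iSup_eq hb] at hc
  obtain ⟨N, C, hC, hle⟩ := exists_le_snorm_of_continuous _ hc
  exact ⟨N, C, hC, fun i φ => (Seminorm.le_def.1 (le_ciSup hb i) φ).trans (hle φ)⟩

/-! ### Test functions and smooth multipliers -/

/-- The algebra of smooth complex functions on the line. -/
def smoothSubalgebra : Subalgebra ℂ (ℝ → ℂ) where
  carrier := {f | ContDiff ℝ ∞ f}
  mul_mem' := fun {_ _} (hf : ContDiff ℝ ∞ _) (hg : ContDiff ℝ ∞ _) => hf.mul hg
  add_mem' := fun {_ _} (hf : ContDiff ℝ ∞ _) (hg : ContDiff ℝ ∞ _) => hf.add hg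
  algebraMap_mem' := fun c => (contDiff_const : ContDiff ℝ ∞ fun _ : ℝ => c)

/-- The type of smooth complex functions on the line. -/
def Smooth : Type := smoothSubalgebra

namespace Smooth

instance : CommRing Smooth := inferInstanceAs (CommRing smoothSubalgebra)
instance : Algebra ℂ Smooth := inferInstanceAs (Algebra ℂ smoothSubalgebra)
instance : Module Smooth (ℝ → ℂ) := inferInstanceAs (Module smoothSubalgebra (ℝ → ℂ))
instance : IsScalarTower ℂ Smooth (ℝ → ℂ) :=
  inferInstanceAs (IsScalarTower ℂ smoothSubalgebra (ℝ → ℂ))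
instance : CoeFun Smooth (fun _ => ℝ → ℂ) := ⟨Subtype.val⟩

theorem contDiff (R : Smooth) : ContDiff ℝ ∞ R := R.2

theorem continuous (R : Smooth) : Continuous R := R.contDiff.continuous

theorem differentiable (R : Smooth) : Differentiable ℝ R := R.contDiff.differentiable (by simp)

theorem ext {R S : Smooth} (h : ∀ x, R x = S x) : R = S := Subtype.ext (funext h)

@[simp] theorem mul_apply (R S : Smooth) (x : ℝ) : (R * S) x = R x * S x := rfl
@[simp] theorem add_apply (R S : Smooth) (x : ℝ) : (R + S) x = R x + S x := rfl
@[simp] theorem sub_apply (R S : Smooth) (x : ℝ) : (R - S) x = R x - S x := rfl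
@[simp] theorem one_apply (x : ℝ) : (1 : Smooth) x = 1 := rfl
@[simp] theorem smul_apply (c : ℂ) (R : Smooth) (x : ℝ) : (c • R) x = c * R x := rfl

end Smooth

/-- The smooth compactly supported functions, as a submodule over the smooth functions. -/
def testSubmodule : Submodule Smooth (ℝ → ℂ) where
  carrier := {f | ContDiff ℝ ∞ f ∧ HasCompactSupport f}
  add_mem' := fun hf hg => ⟨hf.1.add hg.1, hf.2.add hg.2⟩
  zero_mem' := ⟨contDiff_const, HasCompactSupport.zero⟩
  smul_mem' := fun R f hf => ⟨R.contDiff.mul hf.1, (hf.2.mul_left : HasCompactSupport (R.1 * f))⟩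

/-- The space of smooth compactly supported functions. -/
def Test : Type := testSubmodule

namespace Test

instance : AddCommGroup Test := inferInstanceAs (AddCommGroup testSubmodule)
instance : Module Smooth Test := inferInstanceAs (Module Smooth testSubmodule)
instance : Module ℂ Test := inferInstanceAs (Module ℂ testSubmodule)
instance : IsScalarTower ℂ Smooth Test := inferInstanceAs (IsScalarTower ℂ Smooth testSubmodule)
instance : CoeFun Test (fun _ => ℝ → ℂ) := ⟨Subtype.val⟩

theorem contDiff (φ : Test) : ContDiff ℝ ∞ φ := φ.2.1

theorem hasCompactSupport (φ : Test) : HasCompactSupport φ := φ.2.2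

theorem differentiable (φ : Test) : Differentiable ℝ φ := φ.contDiff.differentiable (by simp)

theorem ext {φ ψ : Test} (h : ∀ x, φ x = ψ x) : φ = ψ := Subtype.ext (funext h)

@[simp] theorem add_apply (φ ψ : Test) (x : ℝ) : (φ + ψ) x = φ x + ψ x := rfl
@[simp] theorem sub_apply (φ ψ : Test) (x : ℝ) : (φ - ψ) x = φ x - ψ x := rfl
@[simp] theorem smul_apply (R : Smooth) (φ : Test) (x : ℝ) : (R • φ) x = R x * φ x := rfl
@[simp] theorem const_smul_apply (c : ℂ) (φ : Test) (x : ℝ) : (c • φ) x = c * φ x := rfl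

end Test

/-- A test function as a Schwartz function. -/
def toS : Test →ₗ[ℂ] 𝓢(ℝ, ℂ) where
  toFun φ := φ.hasCompactSupport.toSchwartzMap φ.contDiff
  map_add' _ _ := rfl
  map_smul' _ _ := rfl

@[simp] theorem toS_apply (φ : Test) (x : ℝ) : toS φ x = φ x := rfl

theorem coe_toS (φ : Test) : (toS φ : ℝ → ℂ) = φ := rfl

/-- Differentiation of test functions. -/
def derivT : Test →ₗ[ℂ] Test where
  toFun φ := ⟨deriv φ, (contDiff_infty_iff_deriv.1 φ.contDiff).2, φ.hasCompactSupport.deriv⟩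
  map_add' φ ψ := Test.ext fun x => deriv_add (φ.differentiable x) (ψ.differentiable x)
  map_smul' c φ := Test.ext fun x => deriv_const_mul c (φ.differentiable x)

/-- Differentiation of smooth functions. -/
def derivS (R : Smooth) : Smooth := ⟨deriv R, (contDiff_infty_iff_deriv.1 R.contDiff).2⟩

theorem derivS_apply (R : Smooth) (x : ℝ) : (derivS R) x = deriv R x := rfl

theorem derivT_smul (R : Smooth) (φ : Test) : derivT (R • φ) = R • derivT φ + derivS R • φ := by
  refine Test.ext fun x => ?_
  have : deriv (fun y => R y * φ y) x =
      deriv R x * φ x + R x * deriv φ x :=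
    deriv_fun_mul (R.differentiable x) (φ.differentiable x)
  exact this.trans (add_comm _ _)

theorem tsupport_derivT_subset (φ : Test) :
    tsupport (derivT φ) ⊆ tsupport φ :=
  closure_minimal support_deriv_subset (isClosed_tsupport _)

theorem tsupport_smul_subset (R : Smooth) (φ : Test) :
    tsupport (R • φ : Test) ⊆ tsupport φ :=
  closure_mono (Function.support_mul_subset_right R φ)

theorem iteratedDeriv_eq_derivT_pow (l : ℕ) (φ : Test) :
    iteratedDeriv l φ = ((derivT ^ l) φ : Test) := by
  induction l generalizing φ with
  | zero => simp
  | succ l ih => rw [iteratedDeriv_succ', pow_succ, Module.End.mul_apply, ← ih]; rfl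

theorem Test.exists_bound_pow_mul (φ : Test) (k : ℕ) :
    ∃ C : ℝ, 0 ≤ C ∧ ∀ x : ℝ, |x| ^ k * ‖φ x‖ ≤ C := by
  obtain ⟨C, hC⟩ := (toS φ).decay k 0
  refine ⟨C, hC.1.le, fun x => ?_⟩
  simpa [norm_iteratedFDeriv_zero] using hC.2 x

/-- Reduces a bound on `snorm N` along a family to weighted sup bounds on derivatives. Only `l ≤ N`
is requested, since the exponential estimates lose a power of the parameter with each derivative. -/
theorem exists_snorm_toS_le {ι : Type*} (s : Set ι) (N : ℕ) (f : ι → Test) (w : ι → ℝ)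
    (hw : ∀ p ∈ s, 0 ≤ w p)
    (h : ∀ k l : ℕ, l ≤ N → ∃ C : ℝ, 0 ≤ C ∧ ∀ p ∈ s, ∀ x : ℝ,
      |x| ^ k * ‖((derivT ^ l) (f p)) x‖ ≤ C * w p) :
    ∃ C : ℝ, 0 ≤ C ∧ ∀ p ∈ s, snorm N (toS (f p)) ≤ C * w p := by
  choose! C hC0 hC using h
  refine ⟨∑ i ∈ Finset.Iic (N, N), C i.1 i.2,
    Finset.sum_nonneg fun i hi => hC0 _ _ (Finset.mem_Iic.1 hi).2, fun p hp => ?_⟩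
  rw [snorm, Finset.sum_mul]
  refine Finset.sum_le_sum fun i hi => ?_
  have hi2 := (Finset.mem_Iic.1 hi).2
  refine SchwartzMap.seminorm_le_bound' ℂ _ _ _ (mul_nonneg (hC0 _ _ hi2) (hw p hp)) fun x => ?_
  rw [coe_toS, iteratedDeriv_eq_derivT_pow]
  exact hC i.1 i.2 hi2 p hp x

/-! ### Exponentials of smooth symbols -/

/-- The remainder of order `n` of the exponential series. -/
def expRem (n : ℕ) (z : ℂ) : ℂ := Complex.exp z - ∑ m ∈ Finset.range n, z ^ m / m.factorial

/-- Truncated subtraction is intended at `n = 0`: the remainder of order `0` is the exponential,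
which is its own derivative. -/
theorem hasDerivAt_expRem (n : ℕ) (z : ℂ) : HasDerivAt (expRem n) (expRem (n - 1) z) z := by
  rcases n with _ | n
  · have : expRem 0 = Complex.exp := by
      funext w
      simp [expRem]
    rw [this]
    exact Complex.hasDerivAt_exp z
  rw [Nat.add_sub_cancel]
  induction n with
  | zero =>
    have h0 : expRem 0 z = Complex.exp z := by simp [expRem]
    have h1 : expRem 1 = fun w => Complex.exp w - 1 := by
      funext w
      simp [expRem]
    rw [h0, h1]
    exact (Complex.hasDerivAt_exp z).sub_const 1
  | succ n ih =>
    have h1 : expRem (n + 2) = fun w => expRem (n + 1) w - w ^ (n + 1) / (n + 1).factorial := by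
      funext w
      rw [expRem, expRem, Finset.sum_range_succ _ (n + 1)]
      ring
    have h2 : expRem (n + 1) z = expRem n z - z ^ n / n.factorial := by
      rw [expRem, expRem, Finset.sum_range_succ]
      ring
    rw [h1, h2]
    convert! ih.fun_sub ((hasDerivAt_pow (n + 1) z).div_const ((n + 1).factorial : ℂ)) using 2
    rw [Nat.add_sub_cancel, Nat.factorial_succ]
    have : ((n : ℂ) + 1) ≠ 0 := by exact_mod_cast n.succ_ne_zero
    have : (n.factorial : ℂ) ≠ 0 := by exact_mod_cast n.factorial_ne_zero
    push_cast
    field_simp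

theorem contDiff_expRem (n : ℕ) : ContDiff ℝ ∞ (expRem n) := by
  have h : ContDiff ℂ ∞ (expRem n) := by
    unfold expRem
    fun_prop
  exact h.restrict_scalars ℝ

/-- The smooth function `η ↦ r_n (h R(η))`, where `r_n` is the remainder of the exponential. -/
def expRemS (n : ℕ) (R : Smooth) (h : ℝ) : Smooth :=
  ⟨fun x => expRem n (h * R x), (contDiff_expRem n).comp (contDiff_const.mul R.contDiff)⟩

/-- The smooth function `η ↦ exp (h R(η))`. -/
def expS (R : Smooth) (h : ℝ) : Smooth :=
  ⟨fun x => Complex.exp (h * R x), (contDiff_const.mul R.contDiff).cexp⟩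

theorem expS_apply (R : Smooth) (h x : ℝ) :
    (expS R h) x = Complex.exp (h * R x) := rfl

theorem expS_add (R : Smooth) (s t : ℝ) : expS R (s + t) = expS R s * expS R t := by
  refine Smooth.ext fun x => ?_
  change Complex.exp _ = Complex.exp _ * Complex.exp _
  rw [← Complex.exp_add]
  push_cast
  ring_nf

theorem expS_zero (R : Smooth) : expS R 0 = 1 := by
  refine Smooth.ext fun x => ?_
  simp [expS]

theorem derivS_expRemS (n : ℕ) (R : Smooth) (h : ℝ) :
    derivS (expRemS n R h) = (h : ℂ) • (expRemS (n - 1) R h * derivS R) := by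
  refine Smooth.ext fun x => ?_
  have h1 : HasDerivAt (fun x : ℝ => (h : ℂ) * R x) (h * deriv R x) x :=
    (R.differentiable x).hasDerivAt.const_mul _
  have h2 := (hasDerivAt_expRem n (h * R x)).comp x h1
  have h3 : deriv (expRemS n R h) x = _ := h2.deriv
  rw [derivS_apply, h3]
  change _ = (h : ℂ) * (expRem (n - 1) (h * R x) * deriv R x)
  ring

/-- Induction on the number of derivatives, with `n` and `φ` free. A derivative falls either on `φ`
or on the remainder; in the second case the order drops by one, and the chain rule supplies the
missing factor `h`. -/
theorem expRemS_bound (R : Smooth) (k l : ℕ) : ∀ (n : ℕ) (φ : Test), ∃ C : ℝ, 0 ≤ C ∧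
    ∀ h ∈ Icc (-1 : ℝ) 1, ∀ x : ℝ,
      |x| ^ k * ‖((derivT ^ l) (expRemS n R h • φ)) x‖ ≤ C * |h| ^ n := by
  induction l with
  | zero =>
    intro n φ
    have hc : Continuous fun x : ℝ => |x| ^ k * (‖R x‖ ^ n *
        Real.exp ‖R x‖ * ‖φ x‖) := by
      have := R.continuous
      have := φ.contDiff.continuous
      fun_prop
    have hs : HasCompactSupport fun x : ℝ => |x| ^ k * (‖R x‖ ^ n *
        Real.exp ‖R x‖ * ‖φ x‖) := (φ.hasCompactSupport.norm.mul_left).mul_left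
    obtain ⟨x₀, hx₀⟩ := hc.exists_forall_ge_of_hasCompactSupport hs
    refine ⟨_, by positivity, fun h hh x => (le_trans ?_
      (mul_le_mul_of_nonneg_right (hx₀ x) (by positivity : 0 ≤ |h| ^ n)))⟩
    rw [pow_zero, Module.End.one_apply, Test.smul_apply, norm_mul]
    have hn : ‖expRem n (h * R x)‖ ≤
        |h| ^ n * (‖R x‖ ^ n * Real.exp ‖R x‖) := by
      refine (Complex.norm_exp_sub_sum_le_norm_mul_exp _ n).trans ?_
      rw [norm_mul, Complex.norm_real, Real.norm_eq_abs, mul_pow, mul_assoc]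
      gcongr
      exact mul_le_of_le_one_left (norm_nonneg _) (abs_le.2 hh)
    calc |x| ^ k * (‖(expRemS n R h) x‖ * ‖φ x‖)
        ≤ |x| ^ k * ((|h| ^ n * (‖R x‖ ^ n * Real.exp ‖R x‖)) *
          ‖φ x‖) := by gcongr; exact hn
      _ = _ := by ring
  | succ l ih =>
    intro n φ
    obtain ⟨C₁, hC₁, h₁⟩ := ih n (derivT φ)
    obtain ⟨C₂, hC₂, h₂⟩ := ih (n - 1) (derivS R • φ)
    refine ⟨C₁ + C₂, by positivity, fun h hh x => ?_⟩
    have e : derivT (expRemS n R h • φ) =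
        expRemS n R h • derivT φ + (h : ℂ) • (expRemS (n - 1) R h • (derivS R • φ)) := by
      rw [derivT_smul, derivS_expRemS, smul_assoc, mul_smul]
    rw [pow_succ, Module.End.mul_apply, e, map_add, LinearMap.map_smul]
    -- Equality when `n` is positive. For `n = 0`, where `n - 1 = 0`, this is `|h| ≤ 1`.
    have hle : |h| * |h| ^ (n - 1) ≤ |h| ^ n := by
      rcases n with _ | n
      · simpa using abs_le.2 hh
      · rw [Nat.add_sub_cancel, pow_succ, mul_comm]
    calc |x| ^ k * ‖((derivT ^ l) (expRemS n R h • derivT φ)) x +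
          h * ((derivT ^ l) (expRemS (n - 1) R h • (derivS R • φ))) x‖
        ≤ |x| ^ k * (‖((derivT ^ l) (expRemS n R h • derivT φ)) x‖ +
          |h| * ‖((derivT ^ l) (expRemS (n - 1) R h • (derivS R • φ))) x‖) := by
          gcongr
          refine (norm_add_le _ _).trans ?_
          rw [norm_mul, Complex.norm_real, Real.norm_eq_abs]
      _ = |x| ^ k * ‖((derivT ^ l) (expRemS n R h • derivT φ)) x‖ +
          |h| * (|x| ^ k *
            ‖((derivT ^ l) (expRemS (n - 1) R h • (derivS R • φ))) x‖) := by ring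
      _ ≤ C₁ * |h| ^ n + |h| * (C₂ * |h| ^ (n - 1)) :=
          add_le_add (h₁ h hh x) (mul_le_mul_of_nonneg_left (h₂ h hh x) (abs_nonneg h))
      _ = C₁ * |h| ^ n + C₂ * (|h| * |h| ^ (n - 1)) := by ring
      _ ≤ (C₁ + C₂) * |h| ^ n := by rw [add_mul]; gcongr

theorem snorm_expRemS_le (R : Smooth) (N n : ℕ) (φ : Test) : ∃ C : ℝ, 0 ≤ C ∧
    ∀ h ∈ Icc (-1 : ℝ) 1, snorm N (toS (expRemS n R h • φ)) ≤ C * |h| ^ n :=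
  exists_snorm_toS_le _ N _ (fun h => |h| ^ n) (fun _ _ => by positivity)
    fun k l _ => expRemS_bound R k l n φ

theorem derivS_expS (R : Smooth) (h : ℝ) :
    derivS (expS R h) = (h : ℂ) • (expS R h * derivS R) := by
  have e : expS R h = expRemS 0 R h := by
    refine Smooth.ext fun x => ?_
    change _ = expRem 0 _
    rw [expRem, Finset.sum_range_zero, sub_zero]
    rfl
  rw [e, derivS_expRemS]

/-- On the support of `φ` the exponential has modulus at most `exp (-δ a)`. Each derivative that
falls on it costs a factor `a`, whence the power of `1 + a`. -/
theorem expS_bound (R : Smooth) (δ : ℝ) (k l : ℕ) : ∀ φ : Test,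
    (∀ x ∈ tsupport φ, δ ≤ (R x).re) → ∃ C : ℝ, 0 ≤ C ∧
    ∀ a ∈ Ici (0 : ℝ), ∀ x : ℝ,
      |x| ^ k * ‖((derivT ^ l) (expS R (-a) • φ)) x‖ ≤
        C * ((1 + a) ^ l * Real.exp (-(δ * a))) := by
  induction l with
  | zero =>
    intro φ hR
    obtain ⟨C, hC0, hC⟩ := φ.exists_bound_pow_mul k
    refine ⟨C, hC0, fun a ha x => ?_⟩
    rw [pow_zero, Module.End.one_apply, Test.smul_apply, norm_mul, expS_apply, Complex.norm_exp,
      pow_zero, one_mul]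
    by_cases hx : x ∈ tsupport φ
    · have : ((-a : ℝ) * R x : ℂ).re ≤ -(δ * a) := by
        rw [Complex.re_ofReal_mul]
        have := mul_le_mul_of_nonneg_right (hR x hx) ha
        linarith
      calc |x| ^ k * (Real.exp ((-a : ℝ) * R x : ℂ).re * ‖φ x‖)
          ≤ |x| ^ k * (Real.exp (-(δ * a)) * ‖φ x‖) := by gcongr
        _ = |x| ^ k * ‖φ x‖ * Real.exp (-(δ * a)) := by ring
        _ ≤ _ := by gcongr; exact hC x
    · rw [image_eq_zero_of_notMem_tsupport hx, norm_zero, mul_zero, mul_zero]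
      positivity
  | succ l ih =>
    intro φ hR
    obtain ⟨C₁, hC₁, h₁⟩ := ih (derivT φ) fun x hx => hR x (tsupport_derivT_subset φ hx)
    obtain ⟨C₂, hC₂, h₂⟩ := ih (derivS R • φ) fun x hx => hR x (tsupport_smul_subset _ φ hx)
    refine ⟨C₁ + C₂, by positivity, fun a ha x => ?_⟩
    have ha' : (0 : ℝ) ≤ a := ha
    have e : derivT (expS R (-a) • φ) =
        expS R (-a) • derivT φ + ((-a : ℝ) : ℂ) • (expS R (-a) • (derivS R • φ)) := by
      rw [derivT_smul, derivS_expS, smul_assoc, mul_smul]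
    rw [pow_succ, Module.End.mul_apply, e, map_add, LinearMap.map_smul]
    set w := Real.exp (-(δ * a)) with hw
    have hw0 : 0 < w := Real.exp_pos _
    calc |x| ^ k * ‖((derivT ^ l) (expS R (-a) • derivT φ)) x +
          ((-a : ℝ) : ℂ) * ((derivT ^ l) (expS R (-a) • (derivS R • φ))) x‖
        ≤ |x| ^ k * (‖((derivT ^ l) (expS R (-a) • derivT φ)) x‖ +
          a * ‖((derivT ^ l) (expS R (-a) • (derivS R • φ))) x‖) := by
          gcongr
          refine (norm_add_le _ _).trans ?_
          rw [norm_mul, Complex.norm_real, Real.norm_eq_abs, abs_neg, abs_of_nonneg ha']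
      _ = |x| ^ k * ‖((derivT ^ l) (expS R (-a) • derivT φ)) x‖ +
          a * (|x| ^ k *
            ‖((derivT ^ l) (expS R (-a) • (derivS R • φ))) x‖) := by ring
      _ ≤ C₁ * ((1 + a) ^ l * w) + a * (C₂ * ((1 + a) ^ l * w)) :=
          add_le_add (h₁ a ha x) (mul_le_mul_of_nonneg_left (h₂ a ha x) ha')
      _ = (C₁ + C₂ * a) * ((1 + a) ^ l * w) := by ring
      _ ≤ ((C₁ + C₂) * (1 + a)) * ((1 + a) ^ l * w) := by gcongr; nlinarith
      _ = (C₁ + C₂) * ((1 + a) ^ (l + 1) * w) := by ring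

theorem snorm_expS_le (R : Smooth) (δ : ℝ) (N : ℕ) (φ : Test)
    (hR : ∀ x ∈ tsupport φ, δ ≤ (R x).re) : ∃ C : ℝ, 0 ≤ C ∧
    ∀ a ∈ Ici (0 : ℝ), snorm N (toS (expS R (-a) • φ)) ≤
      C * ((1 + a) ^ N * Real.exp (-(δ * a))) := by
  refine exists_snorm_toS_le _ N _ (fun a => (1 + a) ^ N * Real.exp (-(δ * a)))
    (fun a ha => ?_) fun k l hl => ?_
  · have : (0 : ℝ) ≤ a := ha
    positivity
  · obtain ⟨C, hC0, hC⟩ := expS_bound R δ k l φ hR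
    refine ⟨C, hC0, fun a ha x => (hC a ha x).trans ?_⟩
    have : (0 : ℝ) ≤ a := ha
    gcongr
    linarith

/-! ### Density of the test functions -/

/-- For `σ = 1 - ρ` this is the error of the cutoff at scale `n`. Where `σ (x / n)` is nonzero one
has `n ≤ |x|`, so one extra power of decay of `φ` buys the factor `1 / n`. The class of `σ` is
stable under differentiation, which lets the induction on `l` close. -/
theorem cutoff_bound (k l : ℕ) : ∀ (σ : ℝ → ℂ) (φ : 𝓢(ℝ, ℂ)), ContDiff ℝ ∞ σ →
    (∀ j, ∃ C : ℝ, ∀ x, ‖iteratedDeriv j σ x‖ ≤ C) → (∀ x, |x| < 1 → σ x = 0) →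
    ∃ C : ℝ, 0 ≤ C ∧ ∀ n : ℕ, 0 < n → ∀ x : ℝ,
      |x| ^ k * ‖iteratedDeriv l (fun y => σ (y / n) * φ y) x‖ ≤ C / n := by
  induction l with
  | zero =>
    intro σ φ hσ hb h0
    obtain ⟨C₁, h₁⟩ := hb 0
    obtain ⟨C₂, h₂⟩ := φ.decay (k + 1) 0
    have hC₁ : 0 ≤ C₁ := (norm_nonneg _).trans (h₁ 0)
    have hC₂ : 0 ≤ C₂ := h₂.1.le
    refine ⟨C₁ * C₂, by positivity, fun n hn x => ?_⟩
    have hn' : (0 : ℝ) < n := by exact_mod_cast hn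
    rw [iteratedDeriv_zero, norm_mul]
    by_cases hx : |x / n| < 1
    · rw [h0 _ hx, norm_zero, zero_mul, mul_zero]
      positivity
    · rw [abs_div, abs_of_pos hn', not_lt, le_div_iff₀ hn', one_mul] at hx
      have h1 : ‖σ (x / n)‖ ≤ C₁ := by simpa using h₁ (x / n)
      have h2 : |x| ^ (k + 1) * ‖φ x‖ ≤ C₂ := by
        simpa [norm_iteratedFDeriv_zero] using h₂.2 x
      rw [le_div_iff₀ hn']
      calc |x| ^ k * (‖σ (x / n)‖ * ‖φ x‖) * n ≤ |x| ^ k * (C₁ * ‖φ x‖) * |x| := by gcongr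
        _ = C₁ * (|x| ^ (k + 1) * ‖φ x‖) := by ring
        _ ≤ C₁ * C₂ := by gcongr
  | succ l ih =>
    intro σ φ hσ hb h0
    have hσ' := (contDiff_infty_iff_deriv.1 hσ).2
    have hd : Differentiable ℝ σ := hσ.differentiable (by simp)
    obtain ⟨C₁, hC₁, h₁⟩ := ih σ (SchwartzMap.derivCLM ℂ ℂ φ) hσ hb h0
    obtain ⟨C₂, hC₂, h₂⟩ := ih (deriv σ) φ hσ'
      (fun j => by simpa only [iteratedDeriv_succ'] using hb (j + 1))
      (fun x hx => by
        have : σ =ᶠ[𝓝 x] fun _ => 0 := by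
          filter_upwards [(isOpen_lt continuous_abs continuous_const).mem_nhds hx] with y hy
          exact h0 y hy
        rw [this.deriv_eq, deriv_const])
    refine ⟨C₁ + C₂, by positivity, fun n hn x => ?_⟩
    have hn' : (0 : ℝ) < n := by exact_mod_cast hn
    have e : deriv (fun y => σ (y / n) * φ y) = fun y =>
        σ (y / n) * SchwartzMap.derivCLM ℂ ℂ φ y + ((n : ℂ))⁻¹ * (deriv σ (y / n) * φ y) := by
      funext y
      have h1 : HasDerivAt (fun y : ℝ => σ (y / n)) ((1 / n : ℝ) • deriv σ (y / n)) y :=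
        (hd (y / n)).hasDerivAt.scomp y ((hasDerivAt_id y).div_const (n : ℝ))
      have h2 := (h1.fun_mul (φ.hasDerivAt y)).deriv
      rw [h2, SchwartzMap.derivCLM_apply, Complex.real_smul]
      push_cast
      ring
    have c1 : ContDiffAt ℝ l (fun y => σ (y / n) * SchwartzMap.derivCLM ℂ ℂ φ y) x := by
      have := hσ.comp (contDiff_id.div_const (n : ℝ))
      exact ((this.mul (SchwartzMap.smooth _ ⊤)).of_le (by exact_mod_cast le_top)).contDiffAt
    have c2 : ContDiffAt ℝ l (fun y => deriv σ (y / n) * φ y) x := by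
      have := hσ'.comp (contDiff_id.div_const (n : ℝ))
      exact ((this.mul (SchwartzMap.smooth _ ⊤)).of_le (by exact_mod_cast le_top)).contDiffAt
    rw [iteratedDeriv_succ', e, iteratedDeriv_fun_add c1 (contDiffAt_const.mul c2),
      iteratedDeriv_const_mul_field]
    have hinv : ‖((n : ℂ))⁻¹‖ ≤ 1 := by
      rw [norm_inv, Complex.norm_natCast]
      exact inv_le_one_of_one_le₀ (by exact_mod_cast hn)
    refine (mul_le_mul_of_nonneg_left (norm_add_le _ _) (by positivity)).trans ?_
    rw [norm_mul, mul_add, add_div]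
    refine add_le_add (h₁ n hn x) (le_trans ?_ (h₂ n hn x))
    gcongr
    exact mul_le_of_le_one_left (norm_nonneg _) hinv

/-- Every Schwartz function is the limit of test functions which it dominates. -/
theorem exists_test_tendsto (φ : 𝓢(ℝ, ℂ)) : ∃ f : ℕ → Test,
    Tendsto (fun n => toS (f n)) atTop (𝓝 φ) ∧ ∀ n x, ‖(f n) x‖ ≤ ‖φ x‖ := by
  let ρ : ContDiffBump (0 : ℝ) := ⟨1, 2, by norm_num, by norm_num⟩
  have hρ : ContDiff ℝ ∞ fun x => (ρ x : ℂ) := Complex.ofRealCLM.contDiff.comp ρ.contDiff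
  have hρs : HasCompactSupport fun x => (ρ x : ℂ) :=
    ρ.hasCompactSupport.comp_left Complex.ofReal_zero
  have hf : ∀ n : ℕ, ContDiff ℝ ∞ (fun x : ℝ => (ρ (x / (n + 1 : ℕ)) : ℂ) * φ x) ∧
      HasCompactSupport (fun x : ℝ => (ρ (x / (n + 1 : ℕ)) : ℂ) * φ x) := by
    intro n
    constructor
    · exact (hρ.comp (contDiff_id.div_const ((n + 1 : ℕ) : ℝ))).mul (φ.smooth ⊤)
    · have hn : ((n + 1 : ℕ) : ℝ)⁻¹ ≠ 0 := inv_ne_zero (by exact_mod_cast n.succ_ne_zero)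
      have : HasCompactSupport fun x : ℝ => (ρ (((n + 1 : ℕ) : ℝ)⁻¹ • x) : ℂ) := hρs.comp_smul hn
      simp only [smul_eq_mul, ← div_eq_inv_mul] at this
      exact this.mul_right
  let f : ℕ → Test := fun n => ⟨_, hf n⟩
  refine ⟨f, ?_, fun n x => ?_⟩
  · rw [(schwartz_withSeminorms ℂ ℝ ℂ).tendsto_nhds]
    rintro ⟨k, l⟩ ε hε
    have hb : ∀ j, ∃ C : ℝ, ∀ x, ‖iteratedDeriv j (fun x => 1 - (ρ x : ℂ)) x‖ ≤ C := by
      intro j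
      obtain ⟨C, hC⟩ := (hρs.toSchwartzMap hρ).decay 0 j
      have hC' : ∀ x, ‖iteratedDeriv j (fun x => (ρ x : ℂ)) x‖ ≤ C := fun x => by
        have := hC.2 x
        rw [pow_zero, one_mul, norm_iteratedFDeriv_eq_norm_iteratedDeriv] at this
        exact this
      refine ⟨1 + C, fun x => ?_⟩
      rw [iteratedDeriv_fun_sub contDiffAt_const
        ((hρ.of_le (by exact_mod_cast le_top)).contDiffAt), iteratedDeriv_const]
      refine (norm_sub_le _ _).trans (add_le_add ?_ (hC' x))
      split_ifs <;> simp
    obtain ⟨C, hC0, hC⟩ := cutoff_bound k l (fun x => 1 - (ρ x : ℂ)) φ (contDiff_const.sub hρ) hb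
      fun x hx => by
        have : ρ x = 1 := ρ.one_of_mem_closedBall (by
          rw [mem_closedBall_zero_iff, Real.norm_eq_abs]
          exact hx.le)
        rw [this]
        simp
    have ht : Tendsto (fun n : ℕ => C / ((n + 1 : ℕ) : ℝ)) atTop (𝓝 0) :=
      (tendsto_add_atTop_iff_nat 1).2 (tendsto_const_div_atTop_nhds_zero_nat C)
    filter_upwards [ht.eventually (gt_mem_nhds hε)] with n hn
    refine lt_of_le_of_lt ?_ hn
    rw [SchwartzMap.schwartzSeminormFamily_apply, map_sub_rev]
    refine SchwartzMap.seminorm_le_bound' ℂ k l _ (by positivity) fun x => ?_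
    have e : ((φ - toS (f n) : 𝓢(ℝ, ℂ)) : ℝ → ℂ) =
        fun y => (1 - (ρ (y / (n + 1 : ℕ)) : ℂ)) * φ y := by
      funext y
      change φ y - (ρ (y / (n + 1 : ℕ)) : ℂ) * φ y = _
      ring
    rw [e]
    exact hC (n + 1) n.succ_pos x
  · change ‖(ρ (x / (n + 1 : ℕ)) : ℂ) * φ x‖ ≤ ‖φ x‖
    rw [norm_mul, Complex.norm_real, Real.norm_of_nonneg ρ.nonneg]
    exact mul_le_of_le_one_left (norm_nonneg _) ρ.le_one

/-! ### Uniform bounds for smooth families of tempered distributions -/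

theorem exists_bound_Icc (u : ℝ → 𝓢'(ℝ, ℂ)) (hu : SmoothInX u) (X : ℝ) :
    ∃ N : ℕ, ∃ C : ℝ, 0 ≤ C ∧ ∀ x ∈ Icc 0 X, ∀ φ, ‖u x φ‖ ≤ C * snorm N φ := by
  obtain ⟨N, C, hC, h⟩ := exists_uniform_bound
    (fun x : Icc 0 X => (u x : 𝓢(ℝ, ℂ) →L[ℂ] ℂ)) fun φ => by
      obtain ⟨C, hC⟩ := isCompact_Icc.exists_bound_of_continuousOn
        ((hu φ).continuousOn.mono (Icc_subset_Ici_self : Icc 0 X ⊆ Ici 0))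
      exact ⟨C, fun x => hC x x.2⟩
  exact ⟨N, C, hC, fun x hx φ => h ⟨x, hx⟩ φ⟩

theorem SmoothInX.hasDerivWithinAt {u : ℝ → 𝓢'(ℝ, ℂ)} (hu : SmoothInX u) (φ : 𝓢(ℝ, ℂ)) {x : ℝ}
    (hx : 0 ≤ x) : HasDerivWithinAt (fun t => u t φ) (dxPair u x φ) (Ici 0) x :=
  ((hu φ).differentiableOn (by simp) x hx).hasDerivWithinAt

theorem SmoothInX.contDiffOn_dxPair {u : ℝ → 𝓢'(ℝ, ℂ)} (hu : SmoothInX u) (φ : 𝓢(ℝ, ℂ)) :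
    ContDiffOn ℝ ∞ (fun x => dxPair u x φ) (Ici 0) :=
  (hu φ).derivWithin (uniqueDiffOn_Ici 0) (by simp)

/-- The uniform boundedness principle is applied to difference quotients, which are continuous
functionals and are pointwise bounded by the mean value inequality. The bound passes to the
one-sided derivative in the limit. Quotients are taken over `[0, X + 1]` so that each point of `[0,
X]` has room on its right. -/
theorem exists_bound_dxPair_Icc (u : ℝ → 𝓢'(ℝ, ℂ)) (hu : SmoothInX u) (X : ℝ) :
    ∃ N : ℕ, ∃ C : ℝ, 0 ≤ C ∧ ∀ x ∈ Icc 0 X, ∀ φ, ‖dxPair u x φ‖ ≤ C * snorm N φ := by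
  obtain ⟨N, C, hC, h⟩ := exists_uniform_bound
    (fun p : Icc 0 (X + 1) × Icc 0 (X + 1) =>
      (((p.1 - p.2 : ℝ) : ℂ)⁻¹ • (u p.1 - u p.2) : 𝓢(ℝ, ℂ) →L[ℂ] ℂ)) fun φ => by
      obtain ⟨C, hC⟩ := isCompact_Icc.exists_bound_of_continuousOn
        ((hu.contDiffOn_dxPair φ).continuousOn.mono
          (Icc_subset_Ici_self : Icc 0 (X + 1) ⊆ Ici 0))
      refine ⟨max C 0, fun p => ?_⟩
      have hle : ‖u p.1 φ - u p.2 φ‖ ≤ C * ‖(p.1 - p.2 : ℝ)‖ :=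
        (convex_Icc 0 (X + 1)).norm_image_sub_le_of_norm_hasDerivWithin_le
          (fun x hx => (hu.hasDerivWithinAt φ hx.1).mono Icc_subset_Ici_self) hC p.2.2 p.1.2
      change ‖((p.1 - p.2 : ℝ) : ℂ)⁻¹ * (u p.1 φ - u p.2 φ)‖ ≤ _
      rw [norm_mul, norm_inv, Complex.norm_real]
      rcases eq_or_ne (p.1 - p.2 : ℝ) 0 with h0 | h0
      · rw [h0]
        simp
      · have hpos : 0 < ‖(p.1 - p.2 : ℝ)‖ := norm_pos_iff.2 h0
        rw [inv_mul_le_iff₀ hpos, mul_comm]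
        exact hle.trans (by gcongr; exact le_max_left _ _)
  refine ⟨N, C, hC, fun x hx φ => ?_⟩
  have hd := ((hu.hasDerivWithinAt φ hx.1).mono
    (fun y hy => le_trans hx.1 (mem_Ici.1 hy)) : HasDerivWithinAt _ _ (Ici x) x)
  have ht := (hasDerivWithinAt_iff_tendsto_slope.1 hd).norm
  rw [Ici_sdiff_left] at ht
  refine le_of_tendsto ht ?_
  have : Ioc x (x + 1) ∈ 𝓝[>] x := Ioc_mem_nhdsGT (by linarith)
  filter_upwards [this] with y hy
  have := h (⟨y, hx.1.trans hy.1.le, hy.2.trans (by linarith [hx.2])⟩,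
    ⟨x, hx.1, by linarith [hx.2]⟩) φ
  rw [slope_def_module]
  change ‖((y - x : ℝ) : ℂ)⁻¹ * (u y φ - u x φ)‖ ≤ _ at this
  rwa [← Complex.ofReal_inv, ← Complex.real_smul] at this

/-! ### Propagation along the half line -/

theorem expS_neg_eq (R : Smooth) (h : ℝ) :
    expS R (-h) = 1 - (h : ℂ) • R + expRemS 2 R (-h) := by
  refine Smooth.ext fun x => ?_
  change Complex.exp _ = 1 - (h : ℂ) * R x + expRem 2 (((-h : ℝ) : ℂ) * R x)
  rw [expRem, Finset.sum_range_succ, Finset.sum_range_one]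
  push_cast
  simp
  ring

/-- A family of functionals with `∂_x B_x(φ) = B_x(R φ)` is given by the exponential. -/
theorem eq_expS_of_hasDerivWithinAt (B : ℝ → Test →ₗ[ℂ] ℂ) (R : Smooth)
    (hB : ∀ φ, ∀ x, 0 ≤ x → HasDerivWithinAt (fun t => B t φ) (B x (R • φ)) (Ici 0) x)
    (hb : ∀ X, ∃ N : ℕ, ∃ C : ℝ, ∃ Q : Smooth, 0 ≤ C ∧ ∀ x ∈ Icc 0 X, ∀ φ,
      ‖B x φ‖ ≤ C * (snorm N (toS φ) + snorm N (toS (Q • φ))))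
    {x : ℝ} (hx : 0 ≤ x) (φ : Test) : B x φ = B 0 (expS R x • φ) := by
  rcases hx.eq_or_lt with h0 | h0
  · rw [← h0, expS_zero, one_smul]
  obtain ⟨N, C, Q, hC, hbound⟩ := hb x
  -- The function `s ↦ B_s (exp ((x - s) R) φ)` is shown to be constant. Expanding the exponential
  -- to first order around `s = t`, the motion of `B_s` and that of the test function cancel. The
  -- remainder is `O(|s - t|²)` by the uniform bound on `B_s`, whose multiplier `Q` accommodates
  -- functionals such as `(∂_x - R) û`.
  have hd : ∀ t ∈ Icc 0 x,
      HasDerivWithinAt (fun s => B s (expS R (x - s) • φ)) 0 (Icc 0 x) t := by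
    intro t ht
    set ψ := expS R (x - t) • φ with hψ
    obtain ⟨C₁, hC₁, hrem₁⟩ := snorm_expRemS_le R N 2 ψ
    obtain ⟨C₂, hC₂, hrem₂⟩ := snorm_expRemS_le R N 2 (Q • ψ)
    have e : ∀ s, B s (expS R (x - s) • φ) =
        (B s ψ - ((s - t : ℝ) : ℂ) * B s (R • ψ)) + B s (expRemS 2 R (-(s - t)) • ψ) := by
      intro s
      have : expS R (x - s) • φ = expS R (-(s - t)) • ψ := by
        rw [hψ, smul_smul, ← expS_add]
        ring_nf
      rw [this, expS_neg_eq, add_smul, sub_smul, one_smul, smul_assoc, map_add, map_sub,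
        LinearMap.map_smul, smul_eq_mul, hψ]
    have h1 : HasDerivWithinAt (fun s => B s ψ - ((s - t : ℝ) : ℂ) * B s (R • ψ)) 0 (Icc 0 x) t := by
      have d1 := (hB ψ t ht.1).mono (Icc_subset_Ici_self : Icc 0 x ⊆ Ici 0)
      have d2 := (hB (R • ψ) t ht.1).mono (Icc_subset_Ici_self : Icc 0 x ⊆ Ici 0)
      have d3 : HasDerivWithinAt (fun s : ℝ => ((s - t : ℝ) : ℂ)) ((1 : ℝ) : ℂ) (Icc 0 x) t :=
        ((hasDerivAt_id t).sub_const t).ofReal_comp.hasDerivWithinAt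
      refine (d1.fun_sub (d3.fun_mul d2)).congr_deriv ?_
      simp
    have h2 : HasDerivWithinAt (fun s => B s (expRemS 2 R (-(s - t)) • ψ)) 0 (Icc 0 x) t := by
      have : (fun s => B s (expRemS 2 R (-(s - t)) • ψ)) =O[𝓝[Icc 0 x] t]
          fun s => ‖s - t‖ ^ 2 := by
        refine Asymptotics.IsBigO.of_bound (C * (C₁ + C₂)) ?_
        have hnear : Icc (t - 1) (t + 1) ∈ 𝓝 t := Icc_mem_nhds (by linarith) (by linarith)
        filter_upwards [self_mem_nhdsWithin, mem_nhdsWithin_of_mem_nhds hnear] with s hs hst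
        refine (hbound s hs _).trans ?_
        have hm : -(s - t) ∈ Icc (-1 : ℝ) 1 := ⟨by linarith [hst.2], by linarith [hst.1]⟩
        have e₁ := hrem₁ _ hm
        have e₂ := hrem₂ _ hm
        rw [smul_comm] at e₂
        rw [abs_neg] at e₁ e₂
        rw [norm_pow, norm_norm, Real.norm_eq_abs, mul_assoc, add_mul]
        gcongr
      have := Asymptotics.IsBigO.hasFDerivWithinAt (𝕜 := ℝ) this ht one_lt_two
      rw [hasDerivWithinAt_iff_hasFDerivWithinAt]
      convert! this using 1
      ext
      simp
    rw [funext e]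
    exact (h1.fun_add h2).congr_deriv (add_zero 0)
  have hconst := (convex_Icc 0 x).is_const_of_fderivWithin_eq_zero (𝕜 := ℝ)
    (f := fun s => B s (expS R (x - s) • φ))
    (fun t ht => (hd t ht).differentiableWithinAt) (fun t ht => by
      rw [(hd t ht).hasFDerivWithinAt.fderivWithin (uniqueDiffOn_Icc h0 t ht)]
      ext
      simp) ⟨hx, le_rfl⟩ ⟨le_rfl, hx⟩
  simpa [expS_zero] using hconst

/-! ### Tensor products and temperedness on the half plane -/

theorem seminorm_le_snorm {k l N : ℕ} (hk : k ≤ N) (hl : l ≤ N) (φ : 𝓢(ℝ, ℂ)) :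
    SchwartzMap.seminorm ℂ k l φ ≤ snorm N φ :=
  Finset.single_le_sum (f := fun i : ℕ × ℕ => SchwartzMap.seminorm ℂ i.1 i.2 φ)
    (fun i _ => apply_nonneg _ _) (Finset.mem_Iic.2 (⟨hk, hl⟩ : ((k, l) : ℕ × ℕ) ≤ (N, N)))

/-- Leibniz rule on a product of functions of separate variables. The binomial coefficients sum to
`2 ^ l`; the remaining factor `2` comes from bounding the power of the maximum norm by the sum over
the two coordinates. -/
theorem tensor_bound (θ φ : 𝓢(ℝ, ℂ)) {k l N : ℕ} (hk : k ≤ N) (hl : l ≤ N) (p : ℝ × ℝ) :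
    ‖p‖ ^ k * ‖iteratedFDeriv ℝ l (fun q : ℝ × ℝ => θ q.1 * φ q.2) p‖ ≤
      2 ^ (l + 1) * (snorm N θ * snorm N φ) := by
  have hθ : ContDiff ℝ ∞ fun q : ℝ × ℝ => θ q.1 := (θ.smooth ⊤).comp contDiff_fst
  have hφ : ContDiff ℝ ∞ fun q : ℝ × ℝ => φ q.2 := (φ.smooth ⊤).comp contDiff_snd
  have h1 : ∀ i, ‖iteratedFDeriv ℝ i (fun q : ℝ × ℝ => θ q.1) p‖ ≤ ‖iteratedFDeriv ℝ i θ p.1‖ := by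
    intro i
    have e := (ContinuousLinearMap.fst ℝ ℝ ℝ).iteratedFDeriv_comp_right (θ.smooth ⊤) p
      (i := i) (by exact_mod_cast le_top)
    change ‖iteratedFDeriv ℝ i (θ ∘ ContinuousLinearMap.fst ℝ ℝ ℝ) p‖ ≤ _
    rw [e]
    refine (ContinuousMultilinearMap.norm_compContinuousLinearMap_le _ _).trans ?_
    refine mul_le_of_le_one_right (norm_nonneg _) (Finset.prod_le_one (fun _ _ => norm_nonneg _)
      fun _ _ => ContinuousLinearMap.norm_fst_le ℝ ℝ ℝ)
  have h2 : ∀ i, ‖iteratedFDeriv ℝ i (fun q : ℝ × ℝ => φ q.2) p‖ ≤ ‖iteratedFDeriv ℝ i φ p.2‖ := by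
    intro i
    have e := (ContinuousLinearMap.snd ℝ ℝ ℝ).iteratedFDeriv_comp_right (φ.smooth ⊤) p
      (i := i) (by exact_mod_cast le_top)
    change ‖iteratedFDeriv ℝ i (φ ∘ ContinuousLinearMap.snd ℝ ℝ ℝ) p‖ ≤ _
    rw [e]
    refine (ContinuousMultilinearMap.norm_compContinuousLinearMap_le _ _).trans ?_
    refine mul_le_of_le_one_right (norm_nonneg _) (Finset.prod_le_one (fun _ _ => norm_nonneg _)
      fun _ _ => ContinuousLinearMap.norm_snd_le ℝ ℝ ℝ)
  have h3 := norm_iteratedFDeriv_mul_le (n := l) hθ hφ p (by exact_mod_cast le_top)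
  have hp : ‖p‖ ^ k ≤ ‖p.1‖ ^ k + ‖p.2‖ ^ k := by
    rcases le_total ‖p.1‖ ‖p.2‖ with h | h
    · rw [Prod.norm_def, max_eq_right h]
      have := pow_nonneg (norm_nonneg p.1) k
      linarith
    · rw [Prod.norm_def, max_eq_left h]
      have := pow_nonneg (norm_nonneg p.2) k
      linarith
  have hterm : ∀ i ∈ Finset.range (l + 1), (‖p.1‖ ^ k + ‖p.2‖ ^ k) *
      ((l.choose i : ℝ) * ‖iteratedFDeriv ℝ i (fun q : ℝ × ℝ => θ q.1) p‖ *
        ‖iteratedFDeriv ℝ (l - i) (fun q : ℝ × ℝ => φ q.2) p‖) ≤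
      (l.choose i : ℝ) * (2 * (snorm N θ * snorm N φ)) := by
    intro i hi
    have hi' : i ≤ l := Nat.lt_succ_iff.1 (Finset.mem_range.1 hi)
    have a1 : ‖p.1‖ ^ k * ‖iteratedFDeriv ℝ i θ p.1‖ ≤ snorm N θ :=
      (θ.le_seminorm ℂ k i p.1).trans (seminorm_le_snorm hk (hi'.trans hl) θ)
    have a2 : ‖iteratedFDeriv ℝ i θ p.1‖ ≤ snorm N θ :=
      (θ.norm_iteratedFDeriv_le_seminorm ℂ i p.1).trans
        (seminorm_le_snorm (Nat.zero_le N) (hi'.trans hl) θ)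
    have b1 : ‖p.2‖ ^ k * ‖iteratedFDeriv ℝ (l - i) φ p.2‖ ≤ snorm N φ :=
      (φ.le_seminorm ℂ k (l - i) p.2).trans (seminorm_le_snorm hk ((Nat.sub_le l i).trans hl) φ)
    have b2 : ‖iteratedFDeriv ℝ (l - i) φ p.2‖ ≤ snorm N φ :=
      (φ.norm_iteratedFDeriv_le_seminorm ℂ (l - i) p.2).trans
        (seminorm_le_snorm (Nat.zero_le N) ((Nat.sub_le l i).trans hl) φ)
    calc (‖p.1‖ ^ k + ‖p.2‖ ^ k) *
          ((l.choose i : ℝ) * ‖iteratedFDeriv ℝ i (fun q : ℝ × ℝ => θ q.1) p‖ *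
            ‖iteratedFDeriv ℝ (l - i) (fun q : ℝ × ℝ => φ q.2) p‖)
        ≤ (‖p.1‖ ^ k + ‖p.2‖ ^ k) * ((l.choose i : ℝ) * ‖iteratedFDeriv ℝ i θ p.1‖ *
            ‖iteratedFDeriv ℝ (l - i) φ p.2‖) := by gcongr; exacts [h1 i, h2 (l - i)]
      _ = (l.choose i : ℝ) * ((‖p.1‖ ^ k * ‖iteratedFDeriv ℝ i θ p.1‖) *
            ‖iteratedFDeriv ℝ (l - i) φ p.2‖ + ‖iteratedFDeriv ℝ i θ p.1‖ *
            (‖p.2‖ ^ k * ‖iteratedFDeriv ℝ (l - i) φ p.2‖)) := by ring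
      _ ≤ (l.choose i : ℝ) * (snorm N θ * snorm N φ + snorm N θ * snorm N φ) := by
          have := snorm_nonneg N θ
          have := snorm_nonneg N φ
          gcongr
      _ = _ := by ring
  calc ‖p‖ ^ k * ‖iteratedFDeriv ℝ l (fun q : ℝ × ℝ => θ q.1 * φ q.2) p‖
      ≤ (‖p.1‖ ^ k + ‖p.2‖ ^ k) * ∑ i ∈ Finset.range (l + 1),
        ((l.choose i : ℝ) * ‖iteratedFDeriv ℝ i (fun q : ℝ × ℝ => θ q.1) p‖ *
          ‖iteratedFDeriv ℝ (l - i) (fun q : ℝ × ℝ => φ q.2) p‖) := by gcongr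
    _ ≤ ∑ i ∈ Finset.range (l + 1), (l.choose i : ℝ) * (2 * (snorm N θ * snorm N φ)) := by
        rw [Finset.mul_sum]
        exact Finset.sum_le_sum hterm
    _ = 2 ^ (l + 1) * (snorm N θ * snorm N φ) := by
        rw [← Finset.sum_mul]
        have : ∑ i ∈ Finset.range (l + 1), (l.choose i : ℝ) = 2 ^ l := by
          exact_mod_cast Nat.sum_range_choose l
        rw [this]
        ring

/-- The tensor product of two Schwartz functions of one variable. -/
def tensor (θ φ : 𝓢(ℝ, ℂ)) : 𝓢(ℝ × ℝ, ℂ) where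
  toFun q := θ q.1 * φ q.2
  smooth' := ((θ.smooth ⊤).comp contDiff_fst).mul ((φ.smooth ⊤).comp contDiff_snd)
  decay' k l := ⟨_, tensor_bound θ φ (le_max_left k l) (le_max_right k l)⟩

theorem exists_tensor_le (T : 𝓢'(ℝ × ℝ, ℂ)) : ∃ N : ℕ, ∃ C : ℝ, 0 ≤ C ∧
    ∀ θ φ, ‖T (tensor θ φ)‖ ≤ C * (snorm N θ * snorm N φ) := by
  let T' : 𝓢(ℝ × ℝ, ℂ) →L[ℂ] ℂ := T
  obtain ⟨s, C, -, h⟩ := Seminorm.bound_of_continuous (schwartz_withSeminorms ℂ (ℝ × ℝ) ℂ)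
    ((normSeminorm ℂ ℂ).comp T'.toLinearMap) T'.continuous.norm
  obtain ⟨M, hM⟩ := s.bddAbove
  set N := max M.1 M.2 with hN
  refine ⟨N, C * ∑ i ∈ s, 2 ^ (i.2 + 1), by positivity, fun θ φ => (h (tensor θ φ)).trans ?_⟩
  rw [smul_apply, NNReal.smul_def, smul_eq_mul, mul_assoc]
  refine mul_le_mul_of_nonneg_left ?_ C.2
  refine (Seminorm.finset_sup_le_sum (schwartzSeminormFamily ℂ (ℝ × ℝ) ℂ) s _).trans ?_
  rw [sum_apply, Finset.sum_mul]
  refine Finset.sum_le_sum fun i hi => ?_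
  have := hM hi
  refine SchwartzMap.seminorm_le_bound ℂ _ _ _ ?_ fun p => tensor_bound θ φ
    (this.1.trans (le_max_left _ _)) (this.2.trans (le_max_right _ _)) p
  have := snorm_nonneg N θ
  have := snorm_nonneg N φ
  positivity

/-- Temperedness made quantitative on tensor products. It is given only for compactly supported
functions, whereas the function of `y` used later is the Fourier transform of a test function;
density and dominated convergence in `x` allow any Schwartz `φ`. -/
theorem exists_bound_of_tempered {u : ℝ → 𝓢'(ℝ, ℂ)} (hu : SmoothInX u)
    (ht : TemperedOnHalfPlane u) : ∃ N : ℕ, ∃ C : ℝ, 0 ≤ C ∧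
    ∀ θ : Test, tsupport θ ⊆ Ioi 0 → ∀ φ : 𝓢(ℝ, ℂ),
      ‖∫ x in Ioi (0 : ℝ), θ x * u x φ‖ ≤ C * (snorm N (toS θ) * snorm N φ) := by
  obtain ⟨T, hT⟩ := ht
  obtain ⟨N, C, hC, hbound⟩ := exists_tensor_le T
  refine ⟨N, C, hC, fun θ hθ φ => ?_⟩
  have htest : ∀ ψ : Test, ‖∫ x in Ioi (0 : ℝ), θ x * u x (toS ψ)‖ ≤
      C * (snorm N (toS θ) * snorm N (toS ψ)) := by
    intro ψ
    have hsub : Function.support (tensor (toS θ) (toS ψ)) ⊆ tsupport θ ×ˢ tsupport ψ := by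
      intro p hp
      have hp' : θ p.1 * ψ p.2 ≠ 0 := hp
      exact ⟨subset_tsupport _ (left_ne_zero_of_mul hp'),
        subset_tsupport _ (right_ne_zero_of_mul hp')⟩
    have hclosed : tsupport (tensor (toS θ) (toS ψ)) ⊆ tsupport θ ×ˢ tsupport ψ :=
      closure_minimal hsub ((isClosed_tsupport _).prod (isClosed_tsupport _))
    have hcs : HasCompactSupport (tensor (toS θ) (toS ψ)) :=
      (IsCompact.prod θ.hasCompactSupport ψ.hasCompactSupport).of_isClosed_subset
        (isClosed_tsupport _) hclosed
    have := hT _ hcs fun p hp => ⟨hθ (hclosed hp).1, mem_univ _⟩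
    have e : ∀ x, u x (slice x (tensor (toS θ) (toS ψ))) = θ x * u x (toS ψ) := by
      intro x
      have : slice x (tensor (toS θ) (toS ψ)) = θ x • toS ψ := by
        ext y
        rfl
      rw [this, map_smul, smul_eq_mul]
    simp only [e] at this
    rw [← this]
    exact hbound _ _
  obtain ⟨f, hf, -⟩ := exists_test_tendsto φ
  obtain ⟨X, hX⟩ : ∃ X : ℝ, ∀ x, X < x → θ x = 0 := by
    obtain ⟨X, hX⟩ := θ.hasCompactSupport.isBounded.subset_closedBall 0
    refine ⟨X, fun x hx => image_eq_zero_of_notMem_tsupport fun h => ?_⟩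
    have := hX h
    rw [mem_closedBall_zero_iff, Real.norm_eq_abs] at this
    exact (hx.trans_le ((le_abs_self x).trans this)).false
  obtain ⟨N', C', hC', hb⟩ := exists_bound_Icc u hu X
  have hsn : ∀ M, Tendsto (fun n => snorm M (toS (f n))) atTop (𝓝 (snorm M φ)) := fun M =>
    ((continuous_snorm M).tendsto φ).comp hf
  obtain ⟨K, hK⟩ := (hsn N').bddAbove_range
  have hlim : Tendsto (fun n => ∫ x in Ioi (0 : ℝ), θ x * u x (toS (f n))) atTop
      (𝓝 (∫ x in Ioi (0 : ℝ), θ x * u x φ)) := by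
    refine tendsto_integral_of_dominated_convergence (fun x => ‖θ x‖ * (C' * K)) (fun n => ?_) ?_
      (fun n => ?_) ?_
    · refine ContinuousOn.aestronglyMeasurable ?_ measurableSet_Ioi
      exact θ.contDiff.continuous.continuousOn.mul
        ((hu _).continuousOn.mono Ioi_subset_Ici_self)
    · exact ((θ.contDiff.continuous.integrable_of_hasCompactSupport
        θ.hasCompactSupport).norm.mul_const _).integrableOn
    · filter_upwards [self_mem_ae_restrict measurableSet_Ioi] with x hx
      rw [norm_mul]
      by_cases h : X < x
      · rw [hX x h, norm_zero, zero_mul, zero_mul]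
      · refine mul_le_mul_of_nonneg_left ?_ (norm_nonneg _)
        refine (hb x ⟨le_of_lt hx, not_lt.1 h⟩ _).trans ?_
        gcongr
        exact hK ⟨n, rfl⟩
    · refine Eventually.of_forall fun x => Tendsto.const_mul _ ?_
      exact ((u x : 𝓢(ℝ, ℂ) →L[ℂ] ℂ).continuous.tendsto φ).comp hf
  exact le_of_tendsto_of_tendsto hlim.norm (((hsn N).const_mul _).const_mul _)
    (Eventually.of_forall fun n => htest (f n))

/-! ### Translations of test functions -/

/-- The translate `x ↦ θ (x - a)`. -/
def translate (a : ℝ) (θ : Test) : Test :=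
  ⟨fun x => θ (x - a), θ.contDiff.comp (contDiff_id.sub contDiff_const),
    θ.hasCompactSupport.comp_homeomorph (Homeomorph.subRight a)⟩

theorem translate_apply (a : ℝ) (θ : Test) (x : ℝ) : translate a θ x = θ (x - a) := rfl

theorem derivT_pow_translate (l : ℕ) (a : ℝ) (θ : Test) (x : ℝ) :
    ((derivT ^ l) (translate a θ)) x = ((derivT ^ l) θ) (x - a) := by
  rw [← iteratedDeriv_eq_derivT_pow, ← iteratedDeriv_eq_derivT_pow]
  exact congrFun (iteratedDeriv_comp_sub_const l (f := θ) a) x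

/-- Translation costs only a polynomial factor, since `|x| ≤ (1 + a) (1 + |x - a|)`. This is the
polynomial side of the competition with exponential growth. -/
theorem snorm_translate_le (N : ℕ) (θ : Test) : ∃ C : ℝ, 0 ≤ C ∧
    ∀ a ∈ Ici (0 : ℝ), snorm N (toS (translate a θ)) ≤ C * (1 + a) ^ N := by
  refine ⟨∑ i ∈ Finset.Iic (N, N), 2 ^ N * (Finset.Iic (N, N)).sup
    (fun m => SchwartzMap.seminorm ℂ m.1 m.2) (toS θ), by positivity, fun a ha => ?_⟩
  have ha' : (0 : ℝ) ≤ a := ha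
  rw [snorm, Finset.sum_mul]
  refine Finset.sum_le_sum fun i hi => ?_
  have hi' := Finset.mem_Iic.1 hi
  refine SchwartzMap.seminorm_le_bound' ℂ _ _ _ (by positivity) fun x => ?_
  rw [coe_toS, iteratedDeriv_eq_derivT_pow, derivT_pow_translate, ← iteratedDeriv_eq_derivT_pow]
  have h := SchwartzMap.one_add_le_sup_seminorm_apply (𝕜 := ℂ) hi'.1 hi'.2 (toS θ) (x - a)
  rw [norm_iteratedFDeriv_eq_norm_iteratedDeriv, Real.norm_eq_abs] at h
  have hx : |x| ≤ (1 + a) * (1 + |x - a|) := by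
    have h1 : |x| ≤ |x - a| + |a| := by simpa using abs_add_le (x - a) a
    rw [abs_of_nonneg ha'] at h1
    nlinarith [mul_nonneg ha' (abs_nonneg (x - a))]
  calc |x| ^ i.1 * ‖iteratedDeriv i.2 θ (x - a)‖
      ≤ ((1 + a) * (1 + |x - a|)) ^ i.1 * ‖iteratedDeriv i.2 θ (x - a)‖ := by gcongr
    _ = (1 + |x - a|) ^ i.1 * ‖iteratedDeriv i.2 θ (x - a)‖ * (1 + a) ^ i.1 := by
        rw [mul_pow]; ring
    _ ≤ _ := by
        refine mul_le_mul h ?_ (by positivity) (by positivity)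
        exact pow_le_pow_right₀ (by linarith) hi'.1

theorem tendsto_pow_mul_exp_neg (N : ℕ) {δ : ℝ} (hδ : 0 < δ) :
    Tendsto (fun a : ℝ => (1 + a) ^ N * Real.exp (-(δ * a))) atTop (𝓝 0) := by
  have h := (isLittleO_pow_exp_pos_mul_atTop N hδ).tendsto_div_nhds_zero
  have h2 := ((h.comp (tendsto_atTop_add_const_left atTop (1 : ℝ) tendsto_id)).mul_const
    (Real.exp δ))
  rw [zero_mul] at h2
  refine h2.congr fun a => ?_
  simp only [Function.comp_apply, id_eq]
  rw [div_mul_eq_mul_div, mul_div_assoc, ← Real.exp_sub]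
  ring_nf

/-! ### The symbols -/

/-- The conditions on the parameters of the half-plane problem. -/
structure Admissible (kx ky ε ν : ℝ) : Prop where
  kx_pos : 0 < kx
  ky_ne : ky ≠ 0
  unit : kx ^ 2 + ky ^ 2 = 1
  ε_pos : 0 < ε
  ν_pos : 0 < ν

/-- The argument of the square root in `R_±(iη)`. -/
def discr (kx ky ε ν η : ℝ) : ℂ :=
  1 - 2 * (ε * ky * η / kx ^ 2) + 2 * Complex.I * ν * (ε * ky ^ 2 / kx ^ 2)

/-- The symbol `R_+(iη)`. -/
def Rplus (kx ky ε ν η : ℝ) : ℂ :=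
  Complex.I * (kx * η / ky) -
    Complex.I * (kx / (ε * ky ^ 2)) * (1 + Complex.sqrt (discr kx ky ε ν η))

theorem Rminus_eq (kx ky ε ν η : ℝ) : Rminus kx ky ε ν η = Complex.I * (kx * η / ky) -
    Complex.I * (kx / (ε * ky ^ 2)) * (1 - Complex.sqrt (discr kx ky ε ν η)) := rfl

theorem discr_re (kx ky ε ν η : ℝ) :
    (discr kx ky ε ν η).re = 1 - 2 * ε * ky / kx ^ 2 * η := by
  have : discr kx ky ε ν η = ((1 - 2 * ε * ky / kx ^ 2 * η : ℝ) : ℂ) +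
      ((2 * ν * (ε * ky ^ 2 / kx ^ 2) : ℝ) : ℂ) * Complex.I := by
    rw [discr]; push_cast; ring
  rw [this]
  simp only [Complex.add_re, Complex.mul_re, Complex.ofReal_re, Complex.ofReal_im, Complex.I_re,
    Complex.I_im]
  ring

theorem discr_im (kx ky ε ν η : ℝ) :
    (discr kx ky ε ν η).im = 2 * ν * (ε * ky ^ 2 / kx ^ 2) := by
  have : discr kx ky ε ν η = ((1 - 2 * ε * ky / kx ^ 2 * η : ℝ) : ℂ) +
      ((2 * ν * (ε * ky ^ 2 / kx ^ 2) : ℝ) : ℂ) * Complex.I := by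
    rw [discr]; push_cast; ring
  rw [this]
  simp only [Complex.add_im, Complex.mul_im, Complex.ofReal_re, Complex.ofReal_im, Complex.I_re,
    Complex.I_im]
  ring

theorem complexSqrt_sq (z : ℂ) : Complex.sqrt z ^ 2 = z := by
  rw [Complex.sqrt, ← Complex.cpow_nat_mul]
  simp

theorem complexSqrt_re_nonneg (z : ℂ) : 0 ≤ (Complex.sqrt z).re := by
  rw [Complex.sqrt, Complex.cpow_inv_two_re]
  exact Real.sqrt_nonneg _

namespace Admissible

variable {kx ky ε ν : ℝ}

theorem discr_im_pos (h : Admissible kx ky ε ν) (η : ℝ) : 0 < (discr kx ky ε ν η).im := by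
  have := h.kx_pos
  have := sq_pos_of_ne_zero h.ky_ne
  have := h.ε_pos
  have := h.ν_pos
  rw [discr_im]
  positivity

theorem discr_mem_slitPlane (h : Admissible kx ky ε ν) (η : ℝ) :
    discr kx ky ε ν η ∈ Complex.slitPlane :=
  Or.inr (h.discr_im_pos η).ne'

/-- The principal root has nonnegative real part, and twice the product of its real and imaginary
parts is the imaginary part of `discr`, positive by absorption. This fixes the signs of the real
parts of `R_±`. -/
theorem sqrt_im_pos (h : Admissible kx ky ε ν) (η : ℝ) :
    0 < (Complex.sqrt (discr kx ky ε ν η)).im := by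
  have him := h.discr_im_pos η
  have h2 := congrArg Complex.im (complexSqrt_sq (discr kx ky ε ν η))
  rw [sq, Complex.mul_im] at h2
  by_contra hle
  nlinarith [complexSqrt_re_nonneg (discr kx ky ε ν η)]

theorem contDiff_sqrt (h : Admissible kx ky ε ν) :
    ContDiff ℝ ∞ fun η => Complex.sqrt (discr kx ky ε ν η) := by
  rw [contDiff_iff_contDiffAt]
  intro η
  have h1 : ContDiffAt ℝ ∞ Complex.sqrt (discr kx ky ε ν η) := by
    have : AnalyticAt ℂ Complex.sqrt (discr kx ky ε ν η) :=
      Complex.differentiableOn_sqrt.analyticAt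
        (Complex.isOpen_slitPlane.mem_nhds (h.discr_mem_slitPlane η))
    exact this.contDiffAt.restrict_scalars ℝ
  have h2 : ContDiff ℝ ∞ fun η : ℝ => discr kx ky ε ν η := by
    have := Complex.ofRealCLM.contDiff (n := ∞)
    unfold discr
    exact (contDiff_const.sub (contDiff_const.mul
      ((contDiff_const.mul this).div_const _))).add contDiff_const
  exact h1.comp η h2.contDiffAt

/-- The square root as a smooth function. -/
def sqrtS (h : Admissible kx ky ε ν) : Smooth := ⟨_, h.contDiff_sqrt⟩

theorem contDiff_Rminus (h : Admissible kx ky ε ν) : ContDiff ℝ ∞ (Rminus kx ky ε ν) := by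
  have := Complex.ofRealCLM.contDiff (n := ∞)
  exact (contDiff_const.mul ((contDiff_const.mul this).div_const _)).sub
    (contDiff_const.mul (contDiff_const.sub h.contDiff_sqrt))

theorem contDiff_Rplus (h : Admissible kx ky ε ν) : ContDiff ℝ ∞ (Rplus kx ky ε ν) := by
  have := Complex.ofRealCLM.contDiff (n := ∞)
  exact (contDiff_const.mul ((contDiff_const.mul this).div_const _)).sub
    (contDiff_const.mul (contDiff_const.add h.contDiff_sqrt))

/-- `R_-` as a smooth function. -/
def Rm (h : Admissible kx ky ε ν) : Smooth := ⟨_, h.contDiff_Rminus⟩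

/-- `R_+` as a smooth function. -/
def Rp (h : Admissible kx ky ε ν) : Smooth := ⟨_, h.contDiff_Rplus⟩

theorem Rm_apply (h : Admissible kx ky ε ν) (η : ℝ) : h.Rm η = Rminus kx ky ε ν η := rfl

theorem Rp_apply (h : Admissible kx ky ε ν) (η : ℝ) : h.Rp η = Rplus kx ky ε ν η := rfl

theorem sqrtS_apply (h : Admissible kx ky ε ν) (η : ℝ) :
    h.sqrtS η = Complex.sqrt (discr kx ky ε ν η) := rfl

theorem coef_pos (h : Admissible kx ky ε ν) : 0 < kx / (ε * ky ^ 2) := by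
  have := h.kx_pos
  have := sq_pos_of_ne_zero h.ky_ne
  have := h.ε_pos
  positivity

theorem Rminus_re (η : ℝ) : (Rminus kx ky ε ν η).re =
    -(kx / (ε * ky ^ 2) * (Complex.sqrt (discr kx ky ε ν η)).im) := by
  have : Rminus kx ky ε ν η = Complex.I * ((kx * η / ky : ℝ) : ℂ) -
      Complex.I * ((kx / (ε * ky ^ 2) : ℝ) : ℂ) * (1 - Complex.sqrt (discr kx ky ε ν η)) := by
    rw [Rminus_eq]; push_cast; rfl
  rw [this]
  simp only [Complex.sub_re, Complex.sub_im, Complex.mul_re, Complex.mul_im, Complex.ofReal_re,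
    Complex.ofReal_im, Complex.I_re, Complex.I_im, Complex.one_re, Complex.one_im]
  ring

theorem Rplus_re (η : ℝ) : (Rplus kx ky ε ν η).re =
    kx / (ε * ky ^ 2) * (Complex.sqrt (discr kx ky ε ν η)).im := by
  have : Rplus kx ky ε ν η = Complex.I * ((kx * η / ky : ℝ) : ℂ) -
      Complex.I * ((kx / (ε * ky ^ 2) : ℝ) : ℂ) * (1 + Complex.sqrt (discr kx ky ε ν η)) := by
    rw [Rplus]; push_cast; rfl
  rw [this]
  simp only [Complex.add_re, Complex.add_im, Complex.sub_re, Complex.mul_re, Complex.mul_im,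
    Complex.ofReal_re, Complex.ofReal_im, Complex.I_re, Complex.I_im, Complex.one_re,
    Complex.one_im]
  ring

theorem Rminus_re_neg (h : Admissible kx ky ε ν) (η : ℝ) : (Rminus kx ky ε ν η).re < 0 := by
  rw [Rminus_re]
  exact neg_neg_of_pos (mul_pos h.coef_pos (h.sqrt_im_pos η))

theorem Rplus_re_pos (h : Admissible kx ky ε ν) (η : ℝ) : 0 < (Rplus kx ky ε ν η).re := by
  rw [Rplus_re]
  exact mul_pos h.coef_pos (h.sqrt_im_pos η)

theorem Rplus_add_Rminus (h : Admissible kx ky ε ν) (η : ℝ) :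
    (ε / 2 * ky ^ 2 : ℂ) * (Rplus kx ky ε ν η + Rminus kx ky ε ν η) =
    -(Complex.I * kx) + ε * kx * ky * (Complex.I * η) := by
  have h1 : (ky : ℂ) ≠ 0 := Complex.ofReal_ne_zero.2 h.ky_ne
  have h2 : (ε : ℂ) ≠ 0 := Complex.ofReal_ne_zero.2 h.ε_pos.ne'
  rw [Rminus_eq, Rplus]
  field_simp
  ring

/-- With `Rplus_add_Rminus` this says that `R_±` are the roots of the characteristic polynomial in
`∂_x`. The normalization of the direction enters through the term linear in `η`, where `1 - kx ^ 2`
becomes `ky ^ 2`. -/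
theorem Rplus_mul_Rminus (h : Admissible kx ky ε ν) (η : ℝ) :
    (ε / 2 * ky ^ 2 : ℂ) * (Rplus kx ky ε ν η * Rminus kx ky ε ν η) =
    Complex.I * ky * (Complex.I * η) + ε / 2 * kx ^ 2 * (Complex.I * η) ^ 2 + Complex.I * ν := by
  have h1 : (ky : ℂ) ≠ 0 := Complex.ofReal_ne_zero.2 h.ky_ne
  have h2 : (ε : ℂ) ≠ 0 := Complex.ofReal_ne_zero.2 h.ε_pos.ne'
  have h3 : (kx : ℂ) ≠ 0 := Complex.ofReal_ne_zero.2 h.kx_pos.ne'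
  have hu : (kx : ℂ) ^ 2 + ky ^ 2 = 1 := by exact_mod_cast h.unit
  have hs := complexSqrt_sq (discr kx ky ε ν η)
  have hI := Complex.I_sq
  have hd : (kx : ℂ) ^ 2 * discr kx ky ε ν η =
      kx ^ 2 - 2 * ε * ky * η + 2 * Complex.I * ν * ε * ky ^ 2 := by
    rw [discr]
    field_simp
  rw [← hs] at hd
  rw [Rminus_eq, Rplus]
  set q := Complex.sqrt (discr kx ky ε ν η)
  have e : (ε / 2 * ky ^ 2 : ℂ) * ((Complex.I * (kx * η / ky) -
        Complex.I * (kx / (ε * ky ^ 2)) * (1 + q)) *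
      (Complex.I * (kx * η / ky) - Complex.I * (kx / (ε * ky ^ 2)) * (1 - q))) =
      Complex.I ^ 2 / (2 * ε * ky ^ 2) * ((ε * ky * kx * η - kx) ^ 2 - kx ^ 2 * q ^ 2) := by
    field_simp
    ring
  rw [e, hd, mul_pow, hI]
  field_simp
  linear_combination (2 * (ε : ℂ) * ky * η) * hu - (2 * (ε : ℂ) * ky ^ 3 * η) * hI

/-- The symbol of the boundary operator on the decaying mode, that is, with `∂_x` replaced by `R_-`.
-/
theorem boundary_symbol (h : Admissible kx ky ε ν) (η : ℝ) :
    Complex.I * ε * ky * (kx * (Complex.I * η) -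
    ky * Rminus kx ky ε ν η) + 2 * kx = kx * (1 + Complex.sqrt (discr kx ky ε ν η)) := by
  have h1 : (ky : ℂ) ≠ 0 := Complex.ofReal_ne_zero.2 h.ky_ne
  have h2 : (ε : ℂ) ≠ 0 := Complex.ofReal_ne_zero.2 h.ε_pos.ne'
  have hI := Complex.I_sq
  rw [Rminus_eq]
  field_simp
  ring_nf
  rw [hI]
  ring

theorem one_add_sqrt_ne_zero (h : Admissible kx ky ε ν) (η : ℝ) :
    1 + Complex.sqrt (discr kx ky ε ν η) ≠ 0 := by
  intro h0
  have := congrArg Complex.im h0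
  rw [Complex.add_im, Complex.one_im, zero_add, Complex.zero_im] at this
  exact (h.sqrt_im_pos η).ne' this

theorem contDiff_inv_one_add_sqrt (h : Admissible kx ky ε ν) :
    ContDiff ℝ ∞ fun η => (1 + Complex.sqrt (discr kx ky ε ν η))⁻¹ :=
  (contDiff_const.add h.contDiff_sqrt).inv h.one_add_sqrt_ne_zero

end Admissible

/-! ### The problem on the Fourier side -/

/-- The smooth function `η ↦ iη`. -/
def etaS : Smooth :=
  ⟨fun η => Complex.I * η, contDiff_const.mul (Complex.ofRealCLM.contDiff (n := ∞))⟩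

theorem etaS_apply (η : ℝ) : etaS η = Complex.I * η := rfl

theorem derivCLM_fourierSchwartz (φ : Test) :
    SchwartzMap.derivCLM ℂ ℂ (fourierSchwartz (toS φ)) = -fourierSchwartz (toS (etaS • φ)) := by
  ext η
  have h1 : Integrable (φ : ℝ → ℂ) := (toS φ).integrable
  have e2 : (fun y : ℝ => (-2 * Real.pi * Complex.I * y) • φ y) =
      fun y => (-(2 * Real.pi : ℝ) : ℂ) * (etaS • φ) y := by
    funext y
    rw [Test.smul_apply, etaS_apply, smul_eq_mul]
    push_cast
    ring
  have h2 : Integrable (fun y : ℝ => y • φ y) := by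
    have := ((toS (etaS • φ)).integrable (μ := volume)).const_mul (-Complex.I)
    refine this.congr (Eventually.of_forall fun y => ?_)
    change -Complex.I * ((Complex.I * y) * φ y) = y • φ y
    rw [Complex.real_smul]
    linear_combination (-(y : ℂ) * φ y) * Complex.I_sq
  have hd := Real.hasDerivAt_fourier h1 h2 (η * (2 * Real.pi)⁻¹)
  have hd2 := hd.scomp η ((hasDerivAt_id η).mul_const ((2 * Real.pi)⁻¹))
  have hd3 : HasDerivAt (fourierSchwartz (toS φ)) _ η := hd2
  rw [SchwartzMap.derivCLM_apply, hd3.deriv, e2]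
  have e3 : FourierTransform.fourier (fun y => (-(2 * Real.pi : ℝ) : ℂ) * (etaS • φ) y)
      (η * (2 * Real.pi)⁻¹) = (-(2 * Real.pi : ℝ) : ℂ) * fourierSchwartz (toS (etaS • φ)) η := by
    have : fourierSchwartz (toS (etaS • φ)) η =
      FourierTransform.fourier (etaS • φ : ℝ → ℂ) (η * (2 * Real.pi)⁻¹) := rfl
    rw [this, Real.fourier_eq, Real.fourier_eq, ← integral_const_mul]
    congr 1
    funext y
    rw [mul_smul_comm]
    rfl
  rw [e3, Complex.real_smul]
  have hpi : (Real.pi : ℂ) ≠ 0 := Complex.ofReal_ne_zero.2 Real.pi_ne_zero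
  change _ = -(fourierSchwartz (toS (etaS • φ)) η)
  push_cast
  field_simp

theorem dy_fourierSchwartz (T : 𝓢'(ℝ, ℂ)) (φ : Test) :
    dy T (fourierSchwartz (toS φ)) = T (fourierSchwartz (toS (etaS • φ))) := by
  rw [dy, TemperedDistribution.derivCLM_apply_apply, derivCLM_fourierSchwartz, neg_neg]

/-- Multiplication of test functions by a smooth function. -/
def mulS (R : Smooth) : Test →ₗ[ℂ] Test where
  toFun φ := R • φ
  map_add' := smul_add R
  map_smul' c φ := (smul_comm c R φ).symm

/-- `φ ↦ ⟨𝓕_y T, φ⟩` on test functions. -/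
def fourierPair (T : 𝓢'(ℝ, ℂ)) : Test →ₗ[ℂ] ℂ :=
  (T : 𝓢(ℝ, ℂ) →L[ℂ] ℂ).toLinearMap ∘ₗ fourierSchwartz.toLinearMap ∘ₗ toS

theorem fourierPair_apply (T : 𝓢'(ℝ, ℂ)) (φ : Test) :
    fourierPair T φ = T (fourierSchwartz (toS φ)) := rfl

open Classical in
/-- `φ ↦ ∂_x ⟨𝓕_y u(x), φ⟩` on test functions, for `x ≥ 0`. -/
def dxFourierPair {u : ℝ → 𝓢'(ℝ, ℂ)} (hu : SmoothInX u) (x : ℝ) : Test →ₗ[ℂ] ℂ :=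
  if hx : 0 ≤ x then
    { toFun := fun φ => dxPair u x (fourierSchwartz (toS φ))
      map_add' := fun φ ψ => by
        have h1 := (hu.hasDerivWithinAt (fourierSchwartz (toS φ)) hx).fun_add
          (hu.hasDerivWithinAt (fourierSchwartz (toS ψ)) hx)
        have h2 := hu.hasDerivWithinAt (fourierSchwartz (toS (φ + ψ))) hx
        refine (uniqueDiffOn_Ici 0 x hx).eq_deriv _ h2 (h1.congr (fun y _ => ?_) ?_) <;>
          simp only [map_add]
      map_smul' := fun c φ => by
        have h1 := (hu.hasDerivWithinAt (fourierSchwartz (toS φ)) hx).const_mul c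
        have h2 := hu.hasDerivWithinAt (fourierSchwartz (toS (c • φ))) hx
        refine (uniqueDiffOn_Ici 0 x hx).eq_deriv _ h2 (h1.congr (fun y _ => ?_) ?_) <;>
          simp only [map_smul, smul_eq_mul] }
  else 0

theorem dxFourierPair_apply {u : ℝ → 𝓢'(ℝ, ℂ)} (hu : SmoothInX u) {x : ℝ} (hx : 0 ≤ x) (φ : Test) :
    dxFourierPair hu x φ = dxPair u x (fourierSchwartz (toS φ)) := by
  rw [dxFourierPair, dif_pos hx]
  rfl

theorem hasDerivWithinAt_fourierPair {u : ℝ → 𝓢'(ℝ, ℂ)} (hu : SmoothInX u) {x : ℝ} (hx : 0 ≤ x)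
    (φ : Test) :
    HasDerivWithinAt (fun t => fourierPair (u t) φ) (dxFourierPair hu x φ) (Ici 0) x := by
  rw [dxFourierPair_apply hu hx]
  exact hu.hasDerivWithinAt _ hx

theorem snorm_mono {M N : ℕ} (h : M ≤ N) (φ : 𝓢(ℝ, ℂ)) : snorm M φ ≤ snorm N φ :=
  Finset.sum_le_sum_of_subset_of_nonneg
    (Finset.Iic_subset_Iic.2 (⟨h, h⟩ : ((M, M) : ℕ × ℕ) ≤ (N, N))) fun _ _ _ => apply_nonneg _ _

theorem exists_snorm_fourierSchwartz_le (N : ℕ) : ∃ M : ℕ, ∃ C : ℝ, 0 ≤ C ∧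
    ∀ φ, snorm N (fourierSchwartz φ) ≤ C * snorm M φ := by
  let p : Seminorm ℂ 𝓢(ℝ, ℂ) := (∑ i ∈ Finset.Iic (N, N),
    SchwartzMap.seminorm ℂ i.1 i.2).comp fourierSchwartz.toLinearMap
  have hp : ∀ φ, p φ = snorm N (fourierSchwartz φ) := by
    intro φ
    change (∑ i ∈ Finset.Iic (N, N), SchwartzMap.seminorm ℂ i.1 i.2) (fourierSchwartz φ) = _
    rw [sum_apply, snorm]
  have hc : Continuous p := by
    have : (p : 𝓢(ℝ, ℂ) → ℝ) = fun φ => snorm N (fourierSchwartz φ) := funext hp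
    rw [this]
    exact (continuous_snorm N).comp fourierSchwartz.continuous
  obtain ⟨M, C, hC, hle⟩ := exists_le_snorm_of_continuous p hc
  exact ⟨M, C, hC, fun φ => hp φ ▸ hle φ⟩

theorem exists_bound_fourierPair {u : ℝ → 𝓢'(ℝ, ℂ)} (hu : SmoothInX u) (X : ℝ) :
    ∃ N : ℕ, ∃ C : ℝ, 0 ≤ C ∧ ∀ x ∈ Icc 0 X, ∀ φ,
      ‖fourierPair (u x) φ‖ ≤ C * snorm N (toS φ) ∧
      ‖dxFourierPair hu x φ‖ ≤ C * snorm N (toS φ) := by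
  obtain ⟨N₁, C₁, hC₁, h₁⟩ := exists_bound_Icc u hu X
  obtain ⟨N₂, C₂, hC₂, h₂⟩ := exists_bound_dxPair_Icc u hu X
  obtain ⟨M₁, K₁, hK₁, hM₁⟩ := exists_snorm_fourierSchwartz_le N₁
  obtain ⟨M₂, K₂, hK₂, hM₂⟩ := exists_snorm_fourierSchwartz_le N₂
  refine ⟨max M₁ M₂, C₁ * K₁ + C₂ * K₂, by positivity, fun x hx φ => ?_⟩
  have hs := snorm_nonneg (max M₁ M₂) (toS φ)
  constructor
  · rw [fourierPair_apply]
    calc _ ≤ C₁ * snorm N₁ (fourierSchwartz (toS φ)) := h₁ x hx _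
      _ ≤ C₁ * (K₁ * snorm (max M₁ M₂) (toS φ)) := by
          gcongr
          refine (hM₁ _).trans ?_
          gcongr
          exact snorm_mono (le_max_left _ _) _
      _ ≤ _ := by nlinarith [mul_nonneg (mul_nonneg hC₂ hK₂) hs]
  · rw [dxFourierPair_apply hu hx.1]
    calc _ ≤ C₂ * snorm N₂ (fourierSchwartz (toS φ)) := h₂ x hx _
      _ ≤ C₂ * (K₂ * snorm (max M₁ M₂) (toS φ)) := by
          gcongr
          refine (hM₂ _).trans ?_
          gcongr
          exact snorm_mono (le_max_right _ _) _
      _ ≤ _ := by nlinarith [mul_nonneg (mul_nonneg hC₁ hK₁) hs]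

/-- The functional `(∂_x - R) 𝓕_y u (x)` on test functions. -/
def factorPair {u : ℝ → 𝓢'(ℝ, ℂ)} (hu : SmoothInX u) (R : Smooth) (x : ℝ) : Test →ₗ[ℂ] ℂ :=
  dxFourierPair hu x - fourierPair (u x) ∘ₗ mulS R

theorem factorPair_apply {u : ℝ → 𝓢'(ℝ, ℂ)} (hu : SmoothInX u) (R : Smooth) (x : ℝ) (φ : Test) :
    factorPair hu R x φ = dxFourierPair hu x φ - fourierPair (u x) (R • φ) := rfl

theorem exists_bound_factorPair {u : ℝ → 𝓢'(ℝ, ℂ)} (hu : SmoothInX u) (R : Smooth) (X : ℝ) :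
    ∃ N : ℕ, ∃ C : ℝ, ∃ Q : Smooth, 0 ≤ C ∧ ∀ x ∈ Icc 0 X, ∀ φ,
      ‖factorPair hu R x φ‖ ≤ C * (snorm N (toS φ) + snorm N (toS (Q • φ))) := by
  obtain ⟨N, C, hC, h⟩ := exists_bound_fourierPair hu X
  refine ⟨N, C, R, hC, fun x hx φ => ?_⟩
  rw [factorPair_apply, mul_add]
  exact (norm_sub_le _ _).trans (add_le_add (h x hx φ).2 (h x hx _).1)

/-! ### Factorization of the transformed equation -/

section Solution

variable {kx ky ε ν : ℝ} {g : 𝓢'(ℝ, ℂ)} {u : ℝ → 𝓢'(ℝ, ℂ)}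

/-- The equation divided by its leading coefficient `ε ky ^ 2 / 2`, with the other coefficients
expressed through the sum and product of the roots. -/
theorem dxxPair_eq (h : Admissible kx ky ε ν) (hu : IsHalfPlaneSolution kx ky ε ν g u) (φ : Test)
    {x : ℝ} (hx : 0 < x) : dxxPair u x (fourierSchwartz (toS φ)) =
      dxFourierPair hu.smooth x ((h.Rp + h.Rm) • φ) - fourierPair (u x) ((h.Rp * h.Rm) • φ) := by
  have heq := hu.equation x hx (fourierSchwartz (toS φ))
  have e1 : dxPair (fun t => dy (u t)) x (fourierSchwartz (toS φ)) =
      dxFourierPair hu.smooth x (etaS • φ) := by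
    rw [dxFourierPair_apply _ hx.le, dxPair, dxPair]
    simp only [dy_fourierSchwartz]
  rw [e1, dy_fourierSchwartz, dy_fourierSchwartz, dy_fourierSchwartz,
    ← dxFourierPair_apply hu.smooth hx.le,
    ← fourierPair_apply, ← fourierPair_apply, ← fourierPair_apply] at heq
  have hc : (ε / 2 * ky ^ 2 : ℂ) ≠ 0 := by
    have h1 : (ky : ℂ) ≠ 0 := Complex.ofReal_ne_zero.2 h.ky_ne
    have h2 : (ε : ℂ) ≠ 0 := Complex.ofReal_ne_zero.2 h.ε_pos.ne'
    exact mul_ne_zero (div_ne_zero h2 two_ne_zero) (pow_ne_zero 2 h1)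
  have s1 : (ε / 2 * ky ^ 2 : ℂ) • ((h.Rp + h.Rm) • φ) =
      (-(Complex.I * kx) : ℂ) • φ + (ε * kx * ky : ℂ) • (etaS • φ) := by
    refine Test.ext fun η => ?_
    simp only [Test.add_apply, Test.smul_apply, Test.const_smul_apply, Smooth.add_apply,
      h.Rp_apply, h.Rm_apply, etaS_apply]
    linear_combination φ η * h.Rplus_add_Rminus η
  have s2 : (ε / 2 * ky ^ 2 : ℂ) • ((h.Rp * h.Rm) • φ) = (Complex.I * ky : ℂ) • (etaS • φ) +
      (ε / 2 * kx ^ 2 : ℂ) • (etaS • etaS • φ) + (Complex.I * ν : ℂ) • φ := by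
    refine Test.ext fun η => ?_
    simp only [Test.add_apply, Test.smul_apply, Test.const_smul_apply, Smooth.mul_apply,
      h.Rp_apply, h.Rm_apply, etaS_apply]
    linear_combination φ η * h.Rplus_mul_Rminus η
  have t1 := congrArg (dxFourierPair hu.smooth x) s1
  have t2 := congrArg (fourierPair (u x)) s2
  simp only [map_add, LinearMap.map_smul, smul_eq_mul] at t1 t2
  refine mul_left_cancel₀ hc ?_
  linear_combination heq - t1 + t2

theorem hasDerivWithinAt_dxFourierPair (h : Admissible kx ky ε ν)
    (hu : IsHalfPlaneSolution kx ky ε ν g u) (φ : Test) {x : ℝ} (hx : 0 ≤ x) :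
    HasDerivWithinAt (fun t => dxFourierPair hu.smooth t φ)
      (dxFourierPair hu.smooth x ((h.Rp + h.Rm) • φ) - fourierPair (u x) ((h.Rp * h.Rm) • φ))
      (Ici 0) x := by
  have hs := hu.smooth
  have hc2 : ContDiffOn ℝ ∞ (fun t => dxxPair u t (fourierSchwartz (toS φ))) (Ici 0) := by
    have e : (fun t => dxxPair u t (fourierSchwartz (toS φ))) =
        derivWithin (fun t => dxPair u t (fourierSchwartz (toS φ))) (Ici 0) := by
      funext t
      rw [dxxPair, iteratedDerivWithin_succ, iteratedDerivWithin_one]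
      rfl
    rw [e]
    exact (hs.contDiffOn_dxPair _).derivWithin (uniqueDiffOn_Ici 0) (by simp)
  have hd : HasDerivWithinAt (fun t => dxPair u t (fourierSchwartz (toS φ)))
      (dxxPair u x (fourierSchwartz (toS φ))) (Ici 0) x := by
    have := ((hs.contDiffOn_dxPair (fourierSchwartz (toS φ))).differentiableOn
      (by simp) x hx).hasDerivWithinAt
    rw [dxxPair, iteratedDerivWithin_succ, iteratedDerivWithin_one]
    exact this
  -- The equation is assumed only for `x > 0`; both sides are continuous up to the boundary, so it
  -- also holds at `x = 0`.
  have heq : EqOn (fun t => dxxPair u t (fourierSchwartz (toS φ)))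
      (fun t => dxFourierPair hs t ((h.Rp + h.Rm) • φ) - fourierPair (u t) ((h.Rp * h.Rm) • φ))
      (Ici 0) := by
    refine EqOn.of_subset_closure (s := Ioi 0) (fun t ht => dxxPair_eq h hu φ ht) hc2.continuousOn
      ?_ Ioi_subset_Ici_self (by rw [closure_Ioi])
    refine ContinuousOn.sub ?_ (hs _).continuousOn
    exact (hs.contDiffOn_dxPair _).continuousOn.congr fun t ht => dxFourierPair_apply hs ht _
  exact (hd.congr (fun t ht => dxFourierPair_apply hs ht _)
    (dxFourierPair_apply hs hx _)).congr_deriv (heq hx)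

/-- When `R` and `R'` have the sum and product of the two roots, `(∂_x - R')` annihilates `(∂_x - R)
û`. The statement is used for both orders of the factors. -/
theorem factorPair_eq (h : Admissible kx ky ε ν) (hu : IsHalfPlaneSolution kx ky ε ν g u)
    (R R' : Smooth) (hadd : R' + R = h.Rp + h.Rm) (hmul : R' * R = h.Rp * h.Rm) {x : ℝ}
    (hx : 0 ≤ x) (φ : Test) :
    factorPair hu.smooth R x φ = factorPair hu.smooth R 0 (expS R' x • φ) := by
  refine eq_expS_of_hasDerivWithinAt _ R' (fun φ x hx => ?_)
    (exists_bound_factorPair hu.smooth R) hx φ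
  have h1 := (hasDerivWithinAt_dxFourierPair h hu φ hx).fun_sub
    (hasDerivWithinAt_fourierPair hu.smooth hx (R • φ))
  refine h1.congr_deriv ?_
  rw [← hadd, ← hmul, factorPair_apply, add_smul, map_add, mul_comm R' R, mul_smul]
  ring

theorem fourierPair_sub_smul (h : Admissible kx ky ε ν) (hu : IsHalfPlaneSolution kx ky ε ν g u)
    (x : ℝ) (φ : Test) : fourierPair (u x) ((h.Rp - h.Rm) • φ) =
      factorPair hu.smooth h.Rm x φ - factorPair hu.smooth h.Rp x φ := by
  rw [factorPair_apply, factorPair_apply, sub_smul, map_sub]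
  ring

/-- Evaluation of the pairing on an exponentially decaying test function. -/
theorem fourierPair_expS (h : Admissible kx ky ε ν) (hu : IsHalfPlaneSolution kx ky ε ν g u)
    {y a : ℝ} (hy : 0 ≤ y) (ha : 0 ≤ a) (φ : Test) :
    fourierPair (u (y + a)) (expS h.Rp (-a) • (h.Rp - h.Rm) • φ) =
      factorPair hu.smooth h.Rm y φ -
        factorPair hu.smooth h.Rp y (expS (h.Rp - h.Rm) (-a) • φ) := by
  have hm : ∀ x, 0 ≤ x → ∀ φ, factorPair hu.smooth h.Rm x φ =
      factorPair hu.smooth h.Rm 0 (expS h.Rp x • φ) := fun x hx φ =>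
    factorPair_eq h hu h.Rm h.Rp rfl rfl hx φ
  have hp : ∀ x, 0 ≤ x → ∀ φ, factorPair hu.smooth h.Rp x φ =
      factorPair hu.smooth h.Rp 0 (expS h.Rm x • φ) := fun x hx φ =>
    factorPair_eq h hu h.Rp h.Rm (add_comm _ _) (mul_comm _ _) hx φ
  -- The damping `exp (-a R_+)` exactly compensates the growth of the first mode between `y` and `y
  -- + a`. On the second mode it leaves the factor `exp (-a (R_+ - R_-))`, which decays.
  have e1 : expS h.Rp (y + a) • expS h.Rp (-a) • φ = expS h.Rp y • φ := by
    rw [smul_smul, ← expS_add, add_neg_cancel_right]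
  have e2 : expS h.Rm (y + a) • expS h.Rp (-a) • φ =
      expS h.Rm y • expS (h.Rp - h.Rm) (-a) • φ := by
    refine Test.ext fun η => ?_
    simp only [Test.smul_apply, expS_apply, Smooth.sub_apply]
    rw [← mul_assoc, ← mul_assoc, ← Complex.exp_add, ← Complex.exp_add]
    congr 2
    push_cast
    ring
  rw [smul_comm, fourierPair_sub_smul h hu, hm _ (by positivity), hp _ (by positivity), e1, e2,
    ← hm y hy, ← hp y hy]

/-! ### Temperedness excludes the growing mode -/

theorem exists_pos_le_re {R : Smooth} (hR : ∀ η, 0 < (R η).re) (φ : Test) :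
    ∃ δ > 0, ∀ η ∈ tsupport φ, δ ≤ (R η).re := by
  rcases (tsupport φ).eq_empty_or_nonempty with he | hne
  · exact ⟨1, one_pos, by simp [he]⟩
  · obtain ⟨η₀, -, h⟩ := φ.hasCompactSupport.exists_isMinOn hne
      (Complex.continuous_re.comp R.continuous).continuousOn
    exact ⟨_, hR η₀, fun η hη => h hη⟩

theorem exists_tsupport_subset_Icc (θ : Test) (hθ : tsupport θ ⊆ Ioi 0) :
    ∃ X : ℝ, tsupport θ ⊆ Icc 0 X := by
  obtain ⟨X, hX⟩ := θ.hasCompactSupport.isBounded.subset_closedBall 0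
  refine ⟨X, fun x hx => ⟨le_of_lt (hθ hx), ?_⟩⟩
  have := hX hx
  rw [mem_closedBall_zero_iff, Real.norm_eq_abs] at this
  exact (le_abs_self x).trans this

theorem setIntegral_translate (θ : Test) (hθ : tsupport θ ⊆ Ioi 0) {a : ℝ} (ha : 0 ≤ a)
    (F : ℝ → ℂ) : ∫ x in Ioi (0 : ℝ), translate a θ x * F x =
      ∫ y in Ioi (0 : ℝ), θ y * F (y + a) := by
  have hz : ∀ y, y ∉ Ioi (0 : ℝ) → θ y = 0 := fun y hy =>
    image_eq_zero_of_notMem_tsupport fun h => hy (hθ h)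
  rw [setIntegral_eq_integral_of_forall_compl_eq_zero,
    setIntegral_eq_integral_of_forall_compl_eq_zero,
    ← integral_add_right_eq_self (fun x => translate a θ x * F x) a]
  · simp only [translate_apply, add_sub_cancel_right]
  · intro y hy
    rw [hz y hy, zero_mul]
  · intro x hx
    rw [translate_apply, hz _ (fun h => hx ?_), zero_mul]
    exact ha.trans_lt (sub_pos.1 h)

/-- The component of the solution which grows at infinity vanishes. -/
theorem integral_factorPair_eq_zero (h : Admissible kx ky ε ν)
    (hu : IsHalfPlaneSolution kx ky ε ν g u) (θ : Test) (hθ : tsupport θ ⊆ Ioi 0) (φ : Test) :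
    ∫ y in Ioi (0 : ℝ), θ y * factorPair hu.smooth h.Rm y φ = 0 := by
  obtain ⟨N, C, hC, hbound⟩ := exists_bound_of_tempered hu.smooth hu.tempered
  obtain ⟨M, K, hK, hfourier⟩ := exists_snorm_fourierSchwartz_le N
  obtain ⟨Cθ, hCθ, hsθ⟩ := snorm_translate_le N θ
  have hsub : ∀ η, 0 < ((h.Rp - h.Rm : Smooth) η).re := fun η => by
    rw [Smooth.sub_apply, Complex.sub_re, h.Rp_apply, h.Rm_apply]
    linarith [h.Rplus_re_pos η, h.Rminus_re_neg η]
  -- The real part of `R_+` tends to zero at one end of the line, so the rates of decay depend on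
  -- the compact supports of the test functions.
  obtain ⟨δ₁, hδ₁, hle₁⟩ := exists_pos_le_re (R := h.Rp) h.Rplus_re_pos ((h.Rp - h.Rm) • φ)
  obtain ⟨C₁, hC₁, hs₁⟩ := snorm_expS_le h.Rp δ₁ M ((h.Rp - h.Rm) • φ) hle₁
  obtain ⟨X, hX⟩ := exists_tsupport_subset_Icc θ hθ
  obtain ⟨N₂, K₂, Q, hK₂, hb₂⟩ := exists_bound_factorPair hu.smooth h.Rp X
  obtain ⟨δ₂, hδ₂, hle₂⟩ := exists_pos_le_re hsub φ
  obtain ⟨C₂, hC₂, hs₂⟩ := snorm_expS_le (h.Rp - h.Rm) δ₂ N₂ φ hle₂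
  obtain ⟨δ₃, hδ₃, hle₃⟩ := exists_pos_le_re hsub (Q • φ)
  obtain ⟨C₃, hC₃, hs₃⟩ := snorm_expS_le (h.Rp - h.Rm) δ₃ N₂ (Q • φ) hle₃
  have hθi : Integrable (θ : ℝ → ℂ) :=
    θ.contDiff.continuous.integrable_of_hasCompactSupport θ.hasCompactSupport
  have hcont : ∀ R : Smooth, ∀ ψ, ContinuousOn (fun y => factorPair hu.smooth R y ψ) (Ici 0) :=
    fun R ψ y hy => ((hasDerivWithinAt_dxFourierPair h hu ψ hy).continuousWithinAt).sub
      (hasDerivWithinAt_fourierPair hu.smooth hy (R • ψ)).continuousWithinAt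
  have hint : ∀ R : Smooth, ∀ ψ,
      IntegrableOn (fun y => θ y * factorPair hu.smooth R y ψ) (Ioi 0) := by
    intro R ψ
    have h1 : IntegrableOn (fun y => θ y * factorPair hu.smooth R y ψ) (Icc 0 X) :=
      (θ.contDiff.continuous.continuousOn.mul
        ((hcont R ψ).mono Icc_subset_Ici_self)).integrableOn_compact isCompact_Icc
    have h2 : Integrable (fun y => θ y * factorPair hu.smooth R y ψ) := by
      refine (integrableOn_iff_integrable_of_support_subset fun y hy => hX ?_).1 h1
      exact subset_tsupport _ (left_ne_zero_of_mul hy)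
    exact h2.integrableOn
  set W : ℝ → ℝ := fun a => C₂ * ((1 + a) ^ N₂ * Real.exp (-(δ₂ * a))) +
    C₃ * ((1 + a) ^ N₂ * Real.exp (-(δ₃ * a))) with hW
  -- The solution is tested against `θ` translated by `a` and the transform of the damped test
  -- function. The pairing is at most a polynomial in `a` times an exponentially small seminorm, and
  -- it equals the quantity of interest, independent of `a`, up to a decaying term. Letting `a → ∞`
  -- gives zero.
  have hle : ∀ a : ℝ, 0 ≤ a → ‖∫ y in Ioi (0 : ℝ), θ y * factorPair hu.smooth h.Rm y φ‖ ≤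
      C * (Cθ * (1 + a) ^ N * (K * (C₁ * ((1 + a) ^ M * Real.exp (-(δ₁ * a)))))) +
        (∫ y in Ioi (0 : ℝ), ‖θ y‖) * (K₂ * W a) := by
    intro a ha
    have hb := hbound (translate a θ) (fun x hx => by
      have h1 : tsupport (translate a θ) ⊆ (fun x => x - a) ⁻¹' tsupport θ :=
        closure_minimal (fun y hy => subset_tsupport _ hy)
          ((isClosed_tsupport _).preimage (continuous_id.sub continuous_const))
      exact ha.trans_lt (sub_pos.1 (hθ (h1 hx))))
      (fourierSchwartz (toS (expS h.Rp (-a) • (h.Rp - h.Rm) • φ)))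
    simp only [← fourierPair_apply] at hb
    rw [setIntegral_translate θ hθ ha] at hb
    have e : ∫ y in Ioi (0 : ℝ), θ y *
        fourierPair (u (y + a)) (expS h.Rp (-a) • (h.Rp - h.Rm) • φ) =
        (∫ y in Ioi (0 : ℝ), θ y * factorPair hu.smooth h.Rm y φ) -
        ∫ y in Ioi (0 : ℝ), θ y *
          factorPair hu.smooth h.Rp y (expS (h.Rp - h.Rm) (-a) • φ) := by
      rw [← integral_sub (hint _ _) (hint _ _)]
      refine setIntegral_congr_fun measurableSet_Ioi fun y hy => ?_
      rw [fourierPair_expS h hu (le_of_lt hy) ha, mul_sub]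
    rw [e] at hb
    have hb' : C * (snorm N (toS (translate a θ)) * snorm N (fourierSchwartz (toS
        (expS h.Rp (-a) • (h.Rp - h.Rm) • φ)))) ≤
        C * (Cθ * (1 + a) ^ N * (K * (C₁ * ((1 + a) ^ M * Real.exp (-(δ₁ * a)))))) := by
      refine mul_le_mul_of_nonneg_left (mul_le_mul (hsθ a ha) ?_ (snorm_nonneg _ _)
        (by positivity)) hC
      exact (hfourier _).trans (mul_le_mul_of_nonneg_left (hs₁ a ha) hK)
    have hc : ‖∫ y in Ioi (0 : ℝ), θ y *
        factorPair hu.smooth h.Rp y (expS (h.Rp - h.Rm) (-a) • φ)‖ ≤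
        (∫ y in Ioi (0 : ℝ), ‖θ y‖) * (K₂ * W a) := by
      rw [← integral_mul_const]
      refine norm_integral_le_of_norm_le (hθi.norm.mul_const _).integrableOn
        (Eventually.of_forall fun y => ?_)
      rw [norm_mul]
      by_cases hy : y ∈ tsupport θ
      · refine mul_le_mul_of_nonneg_left ?_ (norm_nonneg _)
        refine (hb₂ y (hX hy) _).trans (mul_le_mul_of_nonneg_left ?_ hK₂)
        rw [smul_comm Q]
        exact add_le_add (hs₂ a ha) (hs₃ a ha)
      · rw [image_eq_zero_of_notMem_tsupport hy, norm_zero, zero_mul, zero_mul]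
    have htri := norm_sub_norm_le (∫ y in Ioi (0 : ℝ), θ y * factorPair hu.smooth h.Rm y φ)
      (∫ y in Ioi (0 : ℝ), θ y * factorPair hu.smooth h.Rp y (expS (h.Rp - h.Rm) (-a) • φ))
    linarith
  have hlim : Tendsto (fun a : ℝ =>
      C * (Cθ * (1 + a) ^ N * (K * (C₁ * ((1 + a) ^ M * Real.exp (-(δ₁ * a)))))) +
        (∫ y in Ioi (0 : ℝ), ‖θ y‖) * (K₂ * W a)) atTop (𝓝 0) := by
    have l1 := (tendsto_pow_mul_exp_neg (N + M) hδ₁).const_mul (C * Cθ * K * C₁)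
    have l2 := (((tendsto_pow_mul_exp_neg N₂ hδ₂).const_mul C₂).add
      ((tendsto_pow_mul_exp_neg N₂ hδ₃).const_mul C₃)).const_mul
        ((∫ y in Ioi (0 : ℝ), ‖θ y‖) * K₂)
    have l3 := l1.add l2
    simp only [mul_zero, add_zero] at l3
    refine l3.congr fun a => ?_
    simp only [hW]
    ring
  have := ge_of_tendsto hlim ((eventually_ge_atTop 0).mono hle)
  exact norm_le_zero_iff.1 this

/-- The fundamental lemma of the calculus of variations gives vanishing almost everywhere on
`(0,∞)`. Continuity upgrades this to every `x ≥ 0`, including the boundary point needed for the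
entrance condition. -/
theorem factorPair_Rm_eq_zero (h : Admissible kx ky ε ν)
    (hu : IsHalfPlaneSolution kx ky ε ν g u) (φ : Test) {x : ℝ} (hx : 0 ≤ x) :
    factorPair hu.smooth h.Rm x φ = 0 := by
  have hcont : ContinuousOn (fun y => factorPair hu.smooth h.Rm y φ) (Ici 0) :=
    fun y hy => ((hasDerivWithinAt_dxFourierPair h hu φ hy).continuousWithinAt).sub
      (hasDerivWithinAt_fourierPair hu.smooth hy (h.Rm • φ)).continuousWithinAt
  have hae : ∀ᵐ y : ℝ, y ∈ Ioi (0 : ℝ) → factorPair hu.smooth h.Rm y φ = 0 := by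
    refine isOpen_Ioi.ae_eq_zero_of_integral_contDiff_smul_eq_zero
      ((hcont.mono Ioi_subset_Ici_self).locallyIntegrableOn measurableSet_Ioi) fun θ hθ hc hs => ?_
    let θ' : Test := ⟨fun y => (θ y : ℂ), Complex.ofRealCLM.contDiff.comp hθ,
      hc.comp_left Complex.ofReal_zero⟩
    have hs' : tsupport θ' ⊆ Ioi 0 :=
      (closure_mono (Function.support_comp_subset Complex.ofReal_zero θ)).trans hs
    have := integral_factorPair_eq_zero h hu θ' hs' φ
    rw [setIntegral_eq_integral_of_forall_compl_eq_zero] at this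
    · simpa only [Complex.real_smul] using this
    · intro y hy
      rw [image_eq_zero_of_notMem_tsupport fun hy' => hy (hs' hy'), zero_mul]
  have hopen : EqOn (fun y => factorPair hu.smooth h.Rm y φ) (fun _ => 0) (Ioi 0) :=
    Measure.eqOn_open_of_ae_eq (μ := volume)
      ((ae_restrict_iff' measurableSet_Ioi).2 hae) isOpen_Ioi
      (hcont.mono Ioi_subset_Ici_self) continuousOn_const
  exact hopen.of_subset_closure hcont continuousOn_const Ioi_subset_Ici_self
    (by rw [closure_Ioi]) hx

theorem fourierPair_eq (h : Admissible kx ky ε ν) (hu : IsHalfPlaneSolution kx ky ε ν g u)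
    (φ : Test) {x : ℝ} (hx : 0 ≤ x) :
    fourierPair (u x) φ = fourierPair (u 0) (expS h.Rm x • φ) := by
  refine eq_expS_of_hasDerivWithinAt (fun t => fourierPair (u t)) h.Rm (fun φ x hx => ?_)
    (fun X => ?_) hx φ
  · refine (hasDerivWithinAt_fourierPair hu.smooth hx φ).congr_deriv ?_
    exact sub_eq_zero.1 (factorPair_Rm_eq_zero h hu φ hx)
  · obtain ⟨N, C, hC, hb⟩ := exists_bound_fourierPair hu.smooth X
    refine ⟨N, C, 1, hC, fun x hx φ => (hb x hx φ).1.trans ?_⟩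
    gcongr
    exact le_add_of_nonneg_right (snorm_nonneg _ _)

/-- Since `∂_x û = R_- û` also at `x = 0`, the entrance condition becomes multiplication by
`boundary_symbol`. -/
theorem fourierPair_zero_eq (h : Admissible kx ky ε ν) (hu : IsHalfPlaneSolution kx ky ε ν g u)
    (φ : Test) : fourierPair (u 0) ((1 + h.sqrtS) • φ) = 2 * fourierPair g φ := by
  have hb := hu.boundary (fourierSchwartz (toS φ))
  have hd : dxPair u 0 (fourierSchwartz (toS φ)) = fourierPair (u 0) (h.Rm • φ) := by
    rw [← dxFourierPair_apply hu.smooth le_rfl]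
    exact sub_eq_zero.1 (factorPair_Rm_eq_zero h hu φ le_rfl)
  rw [hd, dy_fourierSchwartz, ← fourierPair_apply, ← fourierPair_apply, ← fourierPair_apply] at hb
  have hk : (kx : ℂ) ≠ 0 := Complex.ofReal_ne_zero.2 h.kx_pos.ne'
  have s : (kx : ℂ) • ((1 + h.sqrtS) • φ) = (Complex.I * ε * ky * kx : ℂ) • (etaS • φ) -
      (Complex.I * ε * ky * ky : ℂ) • (h.Rm • φ) + (2 * kx : ℂ) • φ := by
    refine Test.ext fun η => ?_
    simp only [Test.add_apply, Test.sub_apply, Test.smul_apply, Test.const_smul_apply,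
      Smooth.add_apply, Smooth.one_apply, h.sqrtS_apply, h.Rm_apply, etaS_apply]
    linear_combination -φ η * h.boundary_symbol η
  have t := congrArg (fourierPair (u 0)) s
  simp only [map_add, map_sub, LinearMap.map_smul, smul_eq_mul] at t
  refine mul_left_cancel₀ hk ?_
  linear_combination t + hb

/-! ### The explicit solution -/

/-- The Fourier transform of the solution, given the one of the entrance data. -/
def solutionHat (kx ky ε ν : ℝ) (f : ℝ → ℂ) (x η : ℝ) : ℂ :=
  2 * f η * (1 + Complex.sqrt (discr kx ky ε ν η))⁻¹ * Complex.exp (x * Rminus kx ky ε ν η)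

theorem fourierPair_eq_integral (h : Admissible kx ky ε ν)
    (hu : IsHalfPlaneSolution kx ky ε ν g u) {f : ℝ → ℂ} (hf : IsGivenBy (fourierY g) f)
    (φ : Test) {x : ℝ} (hx : 0 ≤ x) :
    u x (fourierSchwartz (toS φ)) = ∫ η, solutionHat kx ky ε ν f x η * φ η := by
  let J : Smooth := ⟨_, h.contDiff_inv_one_add_sqrt⟩
  have hJ : (1 + h.sqrtS) * J = 1 := Smooth.ext fun η => by
    change (1 + Complex.sqrt (discr kx ky ε ν η)) * (1 + Complex.sqrt (discr kx ky ε ν η))⁻¹ = 1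
    exact mul_inv_cancel₀ (h.one_add_sqrt_ne_zero η)
  rw [← fourierPair_apply, fourierPair_eq h hu φ hx]
  have e : expS h.Rm x • φ = (1 + h.sqrtS) • (J • expS h.Rm x • φ) := by
    rw [smul_smul, hJ, one_smul]
  have hg : ∀ ψ : Test, fourierPair g ψ = ∫ η, f η * ψ η := fun ψ => (hf (toS ψ)).2
  rw [e, fourierPair_zero_eq h hu, hg, ← integral_const_mul]
  refine integral_congr_ae (Eventually.of_forall fun η => ?_)
  change 2 * (f η * ((1 + Complex.sqrt (discr kx ky ε ν η))⁻¹ *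
    (Complex.exp (x * Rminus kx ky ε ν η) * φ η))) = _
  simp only [solutionHat]
  ring

theorem Admissible.norm_multiplier_le (h : Admissible kx ky ε ν) {x : ℝ} (hx : 0 ≤ x) (η : ℝ) :
    ‖(1 + Complex.sqrt (discr kx ky ε ν η))⁻¹ * Complex.exp (x * Rminus kx ky ε ν η)‖ ≤ 1 := by
  rw [norm_mul, norm_inv, Complex.norm_exp, Complex.re_ofReal_mul]
  have h1 : 1 ≤ ‖1 + Complex.sqrt (discr kx ky ε ν η)‖ := by
    refine le_trans ?_ (Complex.re_le_norm _)
    rw [Complex.add_re, Complex.one_re]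
    linarith [complexSqrt_re_nonneg (discr kx ky ε ν η)]
  refine mul_le_one₀ (inv_le_one_of_one_le₀ h1) (Real.exp_pos _).le (Real.exp_le_one_iff.2 ?_)
  exact mul_nonpos_of_nonneg_of_nonpos hx (h.Rminus_re_neg η).le

/-- Passage from test functions to Schwartz functions. Only `R_-` remains, so the multiplier is
bounded, and approximants dominated by `φ` allow dominated convergence. -/
theorem solution_eq_integral (h : Admissible kx ky ε ν)
    (hu : IsHalfPlaneSolution kx ky ε ν g u) {f : ℝ → ℂ} (hf : IsGivenBy (fourierY g) f)
    (φ : 𝓢(ℝ, ℂ)) {x : ℝ} (hx : 0 ≤ x) :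
    u x (fourierSchwartz φ) = ∫ η, solutionHat kx ky ε ν f x η * φ η := by
  obtain ⟨ψ, hψ, hle⟩ := exists_test_tendsto φ
  have e : ∀ χ : ℝ → ℂ, (fun η => solutionHat kx ky ε ν f x η * χ η) = fun η =>
      (2 * ((1 + Complex.sqrt (discr kx ky ε ν η))⁻¹ * Complex.exp (x * Rminus kx ky ε ν η))) *
        (f η * χ η) := by
    intro χ
    funext η
    rw [solutionHat]
    ring
  have h1 : Tendsto (fun n => u x (fourierSchwartz (toS (ψ n)))) atTop
      (𝓝 (u x (fourierSchwartz φ))) :=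
    (((u x : 𝓢(ℝ, ℂ) →L[ℂ] ℂ).continuous.comp fourierSchwartz.continuous).tendsto φ).comp hψ
  refine tendsto_nhds_unique h1 ?_
  simp only [fourierPair_eq_integral h hu hf _ hx]
  refine tendsto_integral_of_dominated_convergence (fun η => 2 * ‖f η * φ η‖) (fun n => ?_)
    ((hf φ).1.norm.const_mul 2) (fun n => Eventually.of_forall fun η => ?_)
    (Eventually.of_forall fun η => ?_)
  · rw [e]
    refine AEStronglyMeasurable.mul ?_ (hf (toS (ψ n))).1.aestronglyMeasurable
    refine Continuous.aestronglyMeasurable (continuous_const.mul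
      (h.contDiff_inv_one_add_sqrt.continuous.mul ?_))
    exact (continuous_const.mul h.contDiff_Rminus.continuous).cexp
  · rw [congrFun (e (ψ n)) η, norm_mul, norm_mul, norm_mul (f η), norm_mul (f η)]
    have := h.norm_multiplier_le hx η
    have h2 : ‖(2 : ℂ)‖ = 2 := by simp
    rw [h2]
    refine mul_le_mul ?_ (mul_le_mul_of_nonneg_left (hle n η) (norm_nonneg _)) (by positivity)
      (by norm_num)
    linarith
  · refine Tendsto.const_mul _ ?_
    have hev : Continuous fun χ : 𝓢(ℝ, ℂ) => χ η :=
      (continuous_eval_const (F := BoundedContinuousFunction ℝ ℂ) η).comp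
        (SchwartzMap.toBoundedContinuousFunctionCLM ℂ ℝ ℂ).continuous
    exact (hev.tendsto φ).comp hψ

end Solution

/-! ### Fourier inversion -/

/-- The inverse Fourier integral `(2π)⁻¹ ∫ exp (iηy) g(η) dη`. -/
def invFourier (g : ℝ → ℂ) (y : ℝ) : ℂ :=
  ((2 * Real.pi)⁻¹ : ℝ) * ∫ η : ℝ, Complex.exp (Complex.I * η * y) * g η

theorem norm_exp_I_mul_mul (η y : ℝ) : ‖Complex.exp (Complex.I * η * y)‖ = 1 := by
  have : Complex.I * η * y = ((η * y : ℝ) : ℂ) * Complex.I := by push_cast; ring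
  rw [this, Complex.norm_exp_ofReal_mul_I]

theorem invFourier_eq_fourierInv (g : ℝ → ℂ) (y : ℝ) :
    invFourier g y = ((2 * Real.pi)⁻¹ : ℝ) *
      FourierTransformInv.fourierInv g (y * (2 * Real.pi)⁻¹) := by
  rw [invFourier, Real.fourierInv_eq']
  congr 2
  funext η
  rw [smul_eq_mul]
  congr 2
  have hpi : (Real.pi : ℂ) ≠ 0 := Complex.ofReal_ne_zero.2 Real.pi_ne_zero
  simp only [RCLike.inner_apply, conj_trivial]
  push_cast
  field_simp

theorem exists_fourierSchwartz_eq (φ : 𝓢(ℝ, ℂ)) :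
    ∃ ψ : 𝓢(ℝ, ℂ), fourierSchwartz ψ = φ ∧ ∀ η, ψ η = invFourier φ η := by
  let s : 𝓢(ℝ, ℂ) →L[ℂ] 𝓢(ℝ, ℂ) := SchwartzMap.compCLMOfContinuousLinearEquiv ℂ
    (ContinuousLinearEquiv.unitsEquivAut ℝ (Units.mk0 (2 * Real.pi) Real.two_pi_pos.ne'))
  have hs : ∀ χ x, s χ x = χ (x * (2 * Real.pi)) := fun χ x => rfl
  refine ⟨FourierTransformInv.fourierInv (s φ), ?_, fun η => ?_⟩
  · ext y
    have h1 : fourierSchwartz (FourierTransformInv.fourierInv (s φ)) y =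
        FourierTransform.fourier (FourierTransformInv.fourierInv (s φ)) (y * (2 * Real.pi)⁻¹) := rfl
    rw [h1, FourierTransform.fourier_fourierInv_eq, hs]
    congr 1
    have := Real.pi_ne_zero
    field_simp
  · rw [SchwartzMap.fourierInv_coe, Real.fourierInv_eq', invFourier]
    have h2 := Measure.integral_comp_mul_right
      (fun v : ℝ => Complex.exp (Complex.I * v * η) * φ v) (2 * Real.pi)
    rw [abs_of_pos (inv_pos.2 Real.two_pi_pos), Complex.real_smul] at h2
    rw [← h2]
    congr 1
    funext v
    rw [smul_eq_mul, hs]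
    congr 2
    simp only [RCLike.inner_apply, conj_trivial]
    push_cast
    ring

theorem continuous_invFourier {g : ℝ → ℂ} (hg : Integrable g) : Continuous (invFourier g) := by
  refine continuous_const.mul (continuous_of_dominated (bound := fun η => ‖g η‖) (fun y => ?_)
    (fun y => Eventually.of_forall fun η => ?_) hg.norm (Eventually.of_forall fun η => ?_))
  · refine AEStronglyMeasurable.mul (Continuous.aestronglyMeasurable ?_) hg.aestronglyMeasurable
    fun_prop
  · rw [norm_mul, norm_exp_I_mul_mul, one_mul]
  · fun_prop

theorem norm_invFourier_le (g : ℝ → ℂ) (y : ℝ) :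
    ‖invFourier g y‖ ≤ (2 * Real.pi)⁻¹ * ∫ η, ‖g η‖ := by
  rw [invFourier, norm_mul, Complex.norm_real, Real.norm_of_nonneg (by positivity)]
  gcongr
  refine (norm_integral_le_integral_norm _).trans (le_of_eq ?_)
  congr 1
  funext η
  rw [norm_mul, norm_exp_I_mul_mul, one_mul]

theorem integrable_invFourier_mul {g φ : ℝ → ℂ} (hg : Integrable g) (hφ : Integrable φ) :
    Integrable fun y => invFourier g y * φ y :=
  hφ.bdd_mul (continuous_invFourier hg).aestronglyMeasurable
    (Eventually.of_forall (norm_invFourier_le g))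

theorem integral_invFourier_mul {g φ : ℝ → ℂ} (hg : Integrable g) (hφ : Integrable φ) :
    ∫ y, invFourier g y * φ y = ∫ η, g η * invFourier φ η := by
  have hint : Integrable (Function.uncurry fun y η : ℝ =>
      Complex.exp (Complex.I * η * y) * (φ y * g η)) (volume.prod volume) := by
    have h1 : Integrable (fun p : ℝ × ℝ => φ p.1 * g p.2) (volume.prod volume) := hφ.mul_prod hg
    refine h1.bdd_mul (c := 1) (Continuous.aestronglyMeasurable (by fun_prop))
      (Eventually.of_forall fun p => ?_)
    rw [norm_exp_I_mul_mul]
  have hswap := integral_integral_swap hint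
  calc ∫ y, invFourier g y * φ y
      = ∫ y : ℝ, (((2 * Real.pi)⁻¹ : ℝ) : ℂ) * ∫ η : ℝ,
          Complex.exp (Complex.I * η * y) * (φ y * g η) := by
        congr 1
        funext y
        rw [invFourier, mul_assoc, ← integral_mul_const]
        congr 2
        funext η
        ring
    _ = ∫ η : ℝ, (((2 * Real.pi)⁻¹ : ℝ) : ℂ) * ∫ y : ℝ,
          Complex.exp (Complex.I * η * y) * (φ y * g η) := by
        rw [integral_const_mul, integral_const_mul, hswap]
    _ = ∫ η, g η * invFourier φ η := by
        congr 1
        funext η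
        rw [invFourier, mul_left_comm, ← integral_const_mul (g η)]
        congr 2
        funext y
        rw [show Complex.I * (y : ℂ) * η = Complex.I * η * y by ring]
        ring

/-- A distribution whose Fourier transform is an integrable function is a function. -/
theorem isGivenBy_invFourier {T : 𝓢'(ℝ, ℂ)} {g : ℝ → ℂ} (hg : Integrable g)
    (hT : ∀ φ : 𝓢(ℝ, ℂ), T (fourierSchwartz φ) = ∫ η, g η * φ η) :
    IsGivenBy T (invFourier g) := by
  intro φ
  refine ⟨integrable_invFourier_mul hg φ.integrable, ?_⟩
  obtain ⟨ψ, hψ, hψ'⟩ := exists_fourierSchwartz_eq φ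
  rw [integral_invFourier_mul hg φ.integrable, ← hψ, hT, hψ]
  simp only [hψ']

/-! ### The Plancherel estimate -/

/-- For `g` in `L¹ ∩ L²`, the inverse transform defined by extension to `L²` and the one given by
the integral have equal pairings with Schwartz functions, so they agree almost everywhere. The
isometry on `L²` then applies to the integral. -/
theorem eLpNorm_fourierInv_eq {g : ℝ → ℂ} (h1 : Integrable g) (h2 : MemLp g 2) :
    eLpNorm (FourierTransformInv.fourierInv g) 2 = eLpNorm g 2 := by
  set W : Lp ℂ 2 (volume : Measure ℝ) := FourierTransformInv.fourierInv h2.toLp with hW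
  have hpair : ∀ φ : 𝓢(ℝ, ℂ), ∫ y, φ y • W y = ∫ y, φ y • FourierTransformInv.fourierInv g y := by
    intro φ
    have e1 := Lp.fourierInv_toTemperedDistribution_eq h2.toLp
    have e2 := congrArg (fun T : 𝓢'(ℝ, ℂ) => T φ) e1
    simp only [TemperedDistribution.fourierInv_apply, Lp.toTemperedDistribution_apply] at e2
    rw [hW, ← e2]
    have e3 : ∫ η, (FourierTransformInv.fourierInv φ : 𝓢(ℝ, ℂ)) η • (h2.toLp g : ℝ → ℂ) η =
        ∫ η, (FourierTransformInv.fourierInv φ : 𝓢(ℝ, ℂ)) η • g η := by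
      refine integral_congr_ae ?_
      filter_upwards [h2.coeFn_toLp] with η hη
      rw [hη]
    rw [e3]
    have e4 := VectorFourier.integral_fourierIntegral_smul_eq_flip (L := -(innerₗ ℝ))
      Real.continuous_fourierChar (by
        simp only [LinearMap.neg_apply, innerₗ_apply_apply]
        exact (continuous_inner.neg)) (φ.integrable (μ := volume)) h1
    have a1 : ∀ η, VectorFourier.fourierIntegral Real.fourierChar volume (-(innerₗ ℝ)) φ η =
        (FourierTransformInv.fourierInv φ : 𝓢(ℝ, ℂ)) η := fun η => by
      rw [SchwartzMap.fourierInv_coe]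
      rfl
    have a2 : ∀ y, VectorFourier.fourierIntegral Real.fourierChar volume (-(innerₗ ℝ)).flip g y =
        FourierTransformInv.fourierInv g y := fun y => by
      rw [show (-(innerₗ ℝ) : ℝ →ₗ[ℝ] ℝ →ₗ[ℝ] ℝ).flip = -(innerₗ ℝ) from ?_]
      · rfl
      · ext
        simp
    simp only [a1, a2] at e4
    exact e4
  have hcont : Continuous (FourierTransformInv.fourierInv g) :=
    VectorFourier.fourierIntegral_continuous Real.continuous_fourierChar (by
      simp only [LinearMap.neg_apply, innerₗ_apply_apply]
      exact (continuous_inner.neg)) h1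
  have hae : (W : ℝ → ℂ) =ᵐ[volume] FourierTransformInv.fourierInv g := by
    refine ae_eq_of_integral_contDiff_smul_eq
      ((Lp.memLp W).locallyIntegrable (by norm_num)) hcont.locallyIntegrable fun θ hθ hc => ?_
    have hθ' : ContDiff ℝ ∞ fun y => (θ y : ℂ) := Complex.ofRealCLM.contDiff.comp hθ
    have hc' : HasCompactSupport fun y => (θ y : ℂ) := hc.comp_left Complex.ofReal_zero
    have := hpair (hc'.toSchwartzMap hθ')
    simpa only [Complex.real_smul] using! this
  rw [← eLpNorm_congr_ae hae, ← eLpNorm_congr_ae h2.coeFn_toLp]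
  have hn : ‖W‖ = ‖h2.toLp g‖ :=
    (Lp.fourierTransformₗᵢ ℝ ℂ).symm.norm_map (h2.toLp g)
  rw [Lp.norm_def, Lp.norm_def, ENNReal.toReal_eq_toReal_iff' (Lp.eLpNorm_ne_top _)
    (Lp.eLpNorm_ne_top _)] at hn
  exact hn

theorem eLpNorm_two_sq {α : Type*} [MeasurableSpace α] (μ : Measure α) (f : α → ℂ) :
    eLpNorm f 2 μ ^ 2 = ∫⁻ x, ‖f x‖ₑ ^ 2 ∂μ := by
  rw [eLpNorm_eq_lintegral_rpow_enorm_toReal two_ne_zero (by norm_num), ← ENNReal.rpow_natCast,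
    ← ENNReal.rpow_mul]
  simp

/-- The squared prefactor `(2π)⁻²` and the Jacobian `2π` of the rescaling leave the constant
`(2π)⁻¹`, which is bounded by `1`. -/
theorem eLpNorm_invFourier_le {g : ℝ → ℂ} (h1 : Integrable g) (h2 : MemLp g 2) :
    eLpNorm (invFourier g) 2 ≤ eLpNorm g 2 := by
  rw [← ENNReal.pow_le_pow_left_iff two_ne_zero, ← eLpNorm_fourierInv_eq h1 h2, eLpNorm_two_sq,
    eLpNorm_two_sq]
  set G := FourierTransformInv.fourierInv g with hG
  have hp : (0 : ℝ) < (2 * Real.pi)⁻¹ := by positivity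
  have hle : (2 * Real.pi)⁻¹ ≤ 1 := inv_le_one_of_one_le₀ (by linarith [Real.pi_gt_three])
  have e : ∀ y, ‖invFourier g y‖ₑ ^ 2 = ENNReal.ofReal ((2 * Real.pi)⁻¹ ^ 2) *
      ‖G (y * (2 * Real.pi)⁻¹)‖ₑ ^ 2 := by
    intro y
    rw [invFourier_eq_fourierInv, enorm_mul, mul_pow, ENNReal.ofReal_pow hp.le]
    congr 2
    rw [← ofReal_norm, Complex.norm_real, Real.norm_of_nonneg hp.le]
  simp only [e]
  have hm : MeasurableEmbedding fun y : ℝ => y * (2 * Real.pi)⁻¹ :=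
    (Homeomorph.mulRight₀ _ hp.ne').measurableEmbedding
  have hmap := hm.lintegral_map (μ := (volume : Measure ℝ)) (fun w => ‖G w‖ₑ ^ 2)
  rw [Real.map_volume_mul_right hp.ne', lintegral_smul_measure, inv_inv,
    abs_of_pos Real.two_pi_pos, smul_eq_mul] at hmap
  rw [lintegral_const_mul' _ _ ENNReal.ofReal_ne_top, ← hmap, ← mul_assoc,
    ← ENNReal.ofReal_mul (by positivity)]
  refine mul_le_of_le_one_left (zero_le) (ENNReal.ofReal_le_one.2 ?_)
  rw [sq, mul_assoc, inv_mul_cancel₀ Real.two_pi_pos.ne', mul_one]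
  exact hle

/-! ### Superpositions of decaying exponentials -/

/-- The function with partial Fourier transform `h(η) exp (x R(η))`. -/
def superposition (h R : ℝ → ℂ) (p : ℝ × ℝ) : ℂ :=
  invFourier (fun η => h η * Complex.exp (p.1 * R η)) p.2

theorem aestronglyMeasurable_superposition {h R : ℝ → ℂ} (hh : AEStronglyMeasurable h)
    (hR : Continuous R) (μ : Measure (ℝ × ℝ)) [SFinite μ] :
    AEStronglyMeasurable (superposition h R) μ := by
  refine AEStronglyMeasurable.const_mul ?_ _
  refine AEStronglyMeasurable.integral_prod_right' (f := fun q : (ℝ × ℝ) × ℝ =>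
    Complex.exp (Complex.I * q.2 * q.1.2) * (h q.2 * Complex.exp (q.1.1 * R q.2))) ?_
  refine (Continuous.aestronglyMeasurable (by fun_prop)).mul (AEStronglyMeasurable.mul ?_
    (Continuous.aestronglyMeasurable (by fun_prop)))
  exact hh.comp_snd

theorem aestronglyMeasurable_superposition_left {h R : ℝ → ℂ} (hh : AEStronglyMeasurable h)
    (hR : Continuous R) (y : ℝ) (μ : Measure ℝ) [SFinite μ] :
    AEStronglyMeasurable (fun x => superposition h R (x, y)) μ := by
  refine AEStronglyMeasurable.const_mul ?_ _
  refine AEStronglyMeasurable.integral_prod_right' (f := fun q : ℝ × ℝ =>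
    Complex.exp (Complex.I * q.2 * y) * (h q.2 * Complex.exp (q.1 * R q.2))) ?_
  refine (Continuous.aestronglyMeasurable (by fun_prop)).mul (AEStronglyMeasurable.mul ?_
    (Continuous.aestronglyMeasurable (by fun_prop)))
  exact hh.comp_snd

theorem norm_exp_mul_of_re_neg {z : ℂ} (hz : z.re < 0) (x : ℝ) :
    ‖Complex.exp (x * z)‖ = Real.exp (-(x * |z.re|)) := by
  rw [Complex.norm_exp, Complex.re_ofReal_mul, abs_of_neg hz]
  congr 1
  ring

theorem sqrt_mul_exp_neg_le {x r : ℝ} (hx : 0 < x) (hr : 0 ≤ r) :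
    √r * Real.exp (-(x * r)) ≤ (√x)⁻¹ := by
  rw [Real.exp_neg, ← div_eq_mul_inv, div_le_iff₀ (Real.exp_pos _), ← div_eq_inv_mul,
    le_div_iff₀ (Real.sqrt_pos.2 hx), mul_comm, ← Real.sqrt_mul hx.le]
  have h0 : 0 ≤ x * r := by positivity
  have h1 := Real.sq_sqrt h0
  have h2 := Real.add_one_le_exp (x * r)
  nlinarith [sq_nonneg (√(x * r) - 1), Real.sqrt_nonneg (x * r)]

/-- For each fixed `x > 0` the exponential recovers the factor `√|Re z|`, at the price of `x ^
(-1/2)`. Control of `h / √|Re R|` thus passes to `h exp (x R)`. -/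
theorem norm_mul_exp_le {a z : ℂ} (hz : z.re < 0) {x : ℝ} (hx : 0 < x) :
    ‖a * Complex.exp (x * z)‖ ≤ ‖a‖ / √|z.re| * (√x)⁻¹ := by
  have hr : 0 < √|z.re| := Real.sqrt_pos.2 (abs_pos.2 hz.ne)
  rw [norm_mul, norm_exp_mul_of_re_neg hz]
  calc ‖a‖ * Real.exp (-(x * |z.re|)) = ‖a‖ / √|z.re| * (√|z.re| * Real.exp (-(x * |z.re|))) := by
        field_simp
    _ ≤ _ := by
        gcongr
        exact sqrt_mul_exp_neg_le hx (abs_nonneg _)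

theorem integrable_mul_exp {h R : ℝ → ℂ} (hh : AEStronglyMeasurable h) (hR : Continuous R)
    (hneg : ∀ η, (R η).re < 0) (hk : Integrable fun η => ‖h η‖ / √|(R η).re|) {x : ℝ}
    (hx : 0 < x) : Integrable fun η => h η * Complex.exp (x * R η) := by
  refine (hk.mul_const (√x)⁻¹).mono'
    (hh.mul (Continuous.aestronglyMeasurable (by fun_prop))) (Eventually.of_forall fun η => ?_)
  exact norm_mul_exp_le (hneg η) hx

/-- The Cauchy–Schwarz inequality with a weight. -/
theorem lintegral_mul_sq_le {α : Type*} [MeasurableSpace α] {μ : Measure α} {κ b : α → ℝ≥0∞}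
    (hκ : AEMeasurable κ μ) (hb : AEMeasurable b μ) :
    (∫⁻ a, κ a * b a ∂μ) ^ 2 ≤ (∫⁻ a, κ a ∂μ) * ∫⁻ a, κ a * b a ^ 2 ∂μ := by
  have hs : ∀ t : ℝ≥0∞, (t ^ (1 / 2 : ℝ)) ^ 2 = t := fun t => by
    rw [← ENNReal.rpow_natCast, ← ENNReal.rpow_mul]
    norm_num
  have h := ENNReal.lintegral_mul_le_Lp_mul_Lq μ Real.HolderConjugate.two_two
    (f := fun a => κ a ^ (1 / 2 : ℝ)) (g := fun a => κ a ^ (1 / 2 : ℝ) * b a)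
    (hκ.pow_const _) ((hκ.pow_const _).mul hb)
  have e : ∀ a, ((fun a => κ a ^ (1 / 2 : ℝ)) * fun a => κ a ^ (1 / 2 : ℝ) * b a) a =
      κ a * b a := fun a => by
    rw [Pi.mul_apply, ← mul_assoc, ← sq, hs]
  simp only [e, ENNReal.rpow_ofNat, mul_pow, hs] at h
  refine (pow_le_pow_left' h 2).trans (le_of_eq ?_)
  rw [mul_pow, hs, hs]

theorem lintegral_exp_neg_mul {c : ℝ} (hc : 0 < c) :
    ∫⁻ x in Ioi (0 : ℝ), ENNReal.ofReal (Real.exp (-(c * x))) = ENNReal.ofReal c⁻¹ := by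
  have hi : IntegrableOn (fun x : ℝ => Real.exp (-(c * x))) (Ioi 0) := by
    simpa only [neg_mul] using exp_neg_integrableOn_Ioi 0 hc
  rw [← ofReal_integral_eq_lintegral_ofReal hi
    (Eventually.of_forall fun x => (Real.exp_pos _).le)]
  congr 1
  have := integral_exp_mul_Ioi (neg_lt_zero.2 hc) 0
  simpa using this

/-- Each horizontal slice of a superposition is square integrable. -/
theorem eLpNorm_superposition_sq_le {h R : ℝ → ℂ} (hh : AEStronglyMeasurable h)
    (hR : Continuous R) (hneg : ∀ η, (R η).re < 0) (y : ℝ) :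
    eLpNorm (fun x => superposition h R (x, y)) 2 halfLine ^ 2 ≤
      (∫⁻ η, ENNReal.ofReal (‖h η‖ / √|(R η).re|)) ^ 2 := by
  set κ : ℝ → ℝ≥0∞ := fun η => ENNReal.ofReal (‖h η‖ / √|(R η).re|) with hκ
  have hRe : Continuous fun η => |(R η).re| := (Complex.continuous_re.comp hR).abs
  have hκm : AEMeasurable κ := by
    refine AEMeasurable.ennreal_ofReal (hh.norm.aemeasurable.div ?_)
    exact (Real.continuous_sqrt.comp hRe).aemeasurable
  set b : ℝ → ℝ → ℝ≥0∞ := fun x η =>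
    ENNReal.ofReal (√|(R η).re| * Real.exp (-(x * |(R η).re|))) with hb
  have hr : ∀ η, 0 < |(R η).re| := fun η => abs_pos.2 (hneg η).ne
  have h1 : ∀ x : ℝ, ‖superposition h R (x, y)‖ₑ ≤ ∫⁻ η, κ η * b x η := by
    intro x
    have hp : ‖(((2 * Real.pi)⁻¹ : ℝ) : ℂ)‖ₑ ≤ 1 := by
      rw [← ofReal_norm, Complex.norm_real, Real.norm_of_nonneg (by positivity)]
      exact ENNReal.ofReal_le_one.2 (inv_le_one_of_one_le₀ (by linarith [Real.pi_gt_three]))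
    rw [superposition, invFourier, enorm_mul]
    refine (mul_le_of_le_one_left zero_le hp).trans ?_
    refine (enorm_integral_le_lintegral_enorm _).trans (lintegral_mono fun η => le_of_eq ?_)
    rw [hκ, hb, ← ofReal_norm, norm_mul, norm_exp_I_mul_mul, one_mul, norm_mul,
      norm_exp_mul_of_re_neg (hneg η), ← ENNReal.ofReal_mul (by positivity)]
    have := (Real.sqrt_pos.2 (hr η)).ne'
    congr 1
    field_simp
  have h2 : ∀ x : ℝ, ‖superposition h R (x, y)‖ₑ ^ 2 ≤ (∫⁻ η, κ η) * ∫⁻ η, κ η * b x η ^ 2 := by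
    intro x
    refine (pow_le_pow_left' (h1 x) 2).trans (lintegral_mul_sq_le hκm ?_)
    exact (Continuous.aemeasurable (by fun_prop)).ennreal_ofReal
  -- The factor `b` is normalized so that the integral of its square over `x > 0` is `1/2` for every
  -- `η`.
  have h3 : ∀ η, ∫⁻ x in Ioi (0 : ℝ), κ η * b x η ^ 2 ≤ κ η := by
    intro η
    have e : ∀ x, κ η * b x η ^ 2 = κ η * ENNReal.ofReal |(R η).re| *
        ENNReal.ofReal (Real.exp (-(2 * |(R η).re| * x))) := by
      intro x
      rw [hb, ← ENNReal.ofReal_pow (by positivity), mul_pow, Real.sq_sqrt (hr η).le,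
        ← Real.exp_nat_mul, ENNReal.ofReal_mul (hr η).le, mul_assoc]
      congr 4
      push_cast
      ring
    simp only [e]
    rw [lintegral_const_mul _ (by fun_prop), lintegral_exp_neg_mul (by linarith [hr η]), mul_assoc,
      ← ENNReal.ofReal_mul (hr η).le]
    refine mul_le_of_le_one_right zero_le (ENNReal.ofReal_le_one.2 ?_)
    have := (hr η).ne'
    rw [mul_inv]
    field_simp
    norm_num
  rw [eLpNorm_two_sq]
  calc ∫⁻ x in Ioi (0 : ℝ), ‖superposition h R (x, y)‖ₑ ^ 2
      ≤ ∫⁻ x in Ioi (0 : ℝ), (∫⁻ η, κ η) * ∫⁻ η, κ η * b x η ^ 2 := lintegral_mono h2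
    _ ≤ (∫⁻ η, κ η) * ∫⁻ x in Ioi (0 : ℝ), ∫⁻ η, κ η * b x η ^ 2 := by
        refine le_of_eq (lintegral_const_mul'' _ ?_)
        refine AEMeasurable.lintegral_prod_right' (f := fun q : ℝ × ℝ => κ q.2 * b q.1 q.2 ^ 2) ?_
        refine hκm.comp_snd.mul (AEMeasurable.pow_const ?_ _)
        exact (Continuous.aemeasurable (by fun_prop)).ennreal_ofReal
    _ = (∫⁻ η, κ η) * ∫⁻ η, ∫⁻ x in Ioi (0 : ℝ), κ η * b x η ^ 2 := by
        congr 1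
        refine lintegral_lintegral_swap (f := fun x η => κ η * b x η ^ 2) ?_
        refine hκm.comp_snd.mul (AEMeasurable.pow_const ?_ _)
        exact (Continuous.aemeasurable (by fun_prop)).ennreal_ofReal
    _ ≤ (∫⁻ η, κ η) * ∫⁻ η, κ η := by
        gcongr with η
        exact h3 η
    _ = _ := (sq _).symm

/-! ### Weak derivatives of horizontal slices -/

theorem hasCompactSupport_iteratedDeriv {χ : ℝ → ℂ} (hc : HasCompactSupport χ) (j : ℕ) :
    HasCompactSupport (iteratedDeriv j χ) ∧ tsupport (iteratedDeriv j χ) ⊆ tsupport χ := by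
  induction j with
  | zero => simpa only [iteratedDeriv_zero] using! ⟨hc, subset_rfl⟩
  | succ j ih =>
    rw [iteratedDeriv_succ]
    exact ⟨ih.1.deriv, (closure_minimal support_deriv_subset (isClosed_tsupport _)).trans ih.2⟩

theorem integral_exp_mul_iteratedDeriv (z : ℂ) {χ : ℝ → ℂ} (hχ : ContDiff ℝ ∞ χ)
    (hc : HasCompactSupport χ) (j : ℕ) :
    ∫ x : ℝ, Complex.exp (x * z) * iteratedDeriv j χ x =
      (-1) ^ j * (z ^ j * ∫ x : ℝ, Complex.exp (x * z) * χ x) := by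
  induction j with
  | zero => simp
  | succ j ih =>
    have hd : ContDiff ℝ ∞ (iteratedDeriv j χ) := by
      rw [iteratedDeriv_eq_iterate]
      exact hχ.iterate_deriv j
    have hcj := (hasCompactSupport_iteratedDeriv hc j).1
    have hE : ∀ x : ℝ, HasDerivAt (fun x : ℝ => Complex.exp (x * z)) (Complex.exp (x * z) * z) x :=
      fun x => by
        have := (((hasDerivAt_id (x : ℂ)).mul_const z).cexp).comp_ofReal
        simpa using this
    have hEc : Continuous fun x : ℝ => Complex.exp (x * z) := by fun_prop
    have key := integral_mul_deriv_eq_deriv_mul_of_integrable (u := fun x : ℝ => Complex.exp (x * z))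
      (v := iteratedDeriv j χ) (u' := fun x : ℝ => Complex.exp (x * z) * z)
      (v' := deriv (iteratedDeriv j χ)) (fun x _ => hE x)
      (fun x _ => (hd.differentiable (by simp) x).hasDerivAt)
      ((hEc.mul (hd.continuous_deriv (by simp))).integrable_of_hasCompactSupport hcj.deriv.mul_left)
      (((hEc.mul continuous_const).mul hd.continuous).integrable_of_hasCompactSupport hcj.mul_left)
      ((hEc.mul hd.continuous).integrable_of_hasCompactSupport hcj.mul_left)
    rw [iteratedDeriv_succ, key]
    have e : ∀ x : ℝ, Complex.exp (x * z) * z * iteratedDeriv j χ x =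
        z * (Complex.exp (x * z) * iteratedDeriv j χ x) := fun x => by ring
    simp only [e]
    rw [integral_const_mul, ih, pow_succ, pow_succ]
    ring

/-- Pairing a horizontal slice of a superposition with a test function. -/
theorem setIntegral_superposition_mul {h R : ℝ → ℂ} (hh : AEStronglyMeasurable h)
    (hR : Continuous R) (hneg : ∀ η, (R η).re < 0)
    (hk : Integrable fun η => ‖h η‖ / √|(R η).re|) {χ : ℝ → ℂ} (hχ : Continuous χ)
    (hc : HasCompactSupport χ) (hs : tsupport χ ⊆ Ioi 0) (y : ℝ) :
    ∫ x in Ioi (0 : ℝ), superposition h R (x, y) * χ x =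
      invFourier (fun η => h η * ∫ x : ℝ, Complex.exp (x * R η) * χ x) y := by
  -- The support of `χ` is a compact subset of `(0,∞)`, so the singularity at `x = 0` is not met.
  have hw : Integrable (fun x : ℝ => (√x)⁻¹ * ‖χ x‖) := by
    rw [← integrableOn_iff_integrable_of_support_subset (s := tsupport χ) fun x hx =>
      subset_tsupport _ (norm_ne_zero_iff.1 (right_ne_zero_of_mul hx))]
    refine ContinuousOn.integrableOn_compact hc ?_
    refine ContinuousOn.mul (Real.continuous_sqrt.continuousOn.inv₀ fun x hx => ?_)
      hχ.norm.continuousOn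
    exact (Real.sqrt_pos.2 (hs hx)).ne'
  have hint : Integrable (Function.uncurry fun x η : ℝ => Complex.exp (Complex.I * η * y) *
      (h η * Complex.exp (x * R η)) * χ x) (halfLine.prod volume) := by
    refine (hw.integrableOn.mul_prod hk).mono' ?_ ?_
    · refine ((Continuous.aestronglyMeasurable (by fun_prop)).mul (hh.comp_snd.mul
        (Continuous.aestronglyMeasurable (by fun_prop)))).mul
          (hχ.comp continuous_fst).aestronglyMeasurable
    · have hpos : ∀ᵐ p ∂(halfLine.prod (volume : Measure ℝ)), p.1 ∈ Ioi (0 : ℝ) :=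
        Measure.quasiMeasurePreserving_fst.ae (ae_restrict_mem measurableSet_Ioi)
      filter_upwards [hpos] with p hp
      simp only [Function.uncurry]
      rw [norm_mul, norm_mul, norm_exp_I_mul_mul, one_mul]
      have := norm_mul_exp_le (a := h p.2) (hneg p.2) hp
      calc _ ≤ ‖h p.2‖ / √|(R p.2).re| * (√p.1)⁻¹ * ‖χ p.1‖ := by gcongr
        _ = _ := by ring
  have hz : ∀ z : ℂ, ∫ x in Ioi (0 : ℝ), Complex.exp (x * z) * χ x =
      ∫ x : ℝ, Complex.exp (x * z) * χ x := fun z =>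
    setIntegral_eq_integral_of_forall_compl_eq_zero fun x hx => by
      rw [image_eq_zero_of_notMem_tsupport fun h => hx (hs h), mul_zero]
  calc ∫ x in Ioi (0 : ℝ), superposition h R (x, y) * χ x
      = ∫ x in Ioi (0 : ℝ), (((2 * Real.pi)⁻¹ : ℝ) : ℂ) *
          ∫ η : ℝ, Complex.exp (Complex.I * η * y) * (h η * Complex.exp (x * R η)) * χ x := by
        congr 1
        funext x
        rw [superposition, invFourier, mul_assoc, ← integral_mul_const]
    _ = (((2 * Real.pi)⁻¹ : ℝ) : ℂ) * ∫ η : ℝ, ∫ x in Ioi (0 : ℝ),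
          Complex.exp (Complex.I * η * y) * (h η * Complex.exp (x * R η)) * χ x := by
        rw [integral_const_mul, integral_integral_swap hint]
    _ = _ := by
        rw [invFourier]
        congr 2
        funext η
        rw [← hz, ← mul_assoc, ← integral_const_mul]
        congr 1
        funext x
        ring

theorem isWeakDeriv_superposition {h R : ℝ → ℂ} (hh : AEStronglyMeasurable h)
    (hR : Continuous R) (hneg : ∀ η, (R η).re < 0)
    (hk : Integrable fun η => ‖h η‖ / √|(R η).re|) {j : ℕ}
    (hj : Integrable fun η => ‖h η * R η ^ j‖ / √|(R η).re|) (y : ℝ) :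
    IsWeakDeriv j (fun x => superposition h R (x, y))
      (fun x => superposition (fun η => h η * R η ^ j) R (x, y)) := by
  intro χ hχ hc hs
  obtain ⟨hcj, hsj⟩ := hasCompactSupport_iteratedDeriv hc j
  rw [setIntegral_superposition_mul hh hR hneg hk
      (hχ.continuous_iteratedDeriv j (by exact_mod_cast le_top)) hcj (hsj.trans hs),
    setIntegral_superposition_mul (h := fun η => h η * R η ^ j)
      (hh.mul (hR.pow j).aestronglyMeasurable) hR hneg hj
      hχ.continuous hc hs, invFourier, invFourier, mul_left_comm ((-1 : ℂ) ^ j),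
    ← integral_const_mul ((-1 : ℂ) ^ j)]
  congr 2
  funext η
  rw [integral_exp_mul_iteratedDeriv _ hχ hc]
  ring

/-- A family of distributions with Fourier transform `h(η) exp (x R(η))` belongs to
`L^∞_y(ℝ, H^m_x(0,∞))` as soon as the weighted integrals of `h R^j`, `j ≤ m`, are finite. -/
theorem memLinftyHm_of_integrable {u : ℝ → 𝓢'(ℝ, ℂ)} {h R : ℝ → ℂ} {m : ℕ}
    (hh : AEStronglyMeasurable h) (hR : Continuous R) (hneg : ∀ η, (R η).re < 0)
    (hk : ∀ j ≤ m, Integrable fun η => ‖h η * R η ^ j‖ / √|(R η).re|)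
    (hu : ∀ x : ℝ, 0 < x → ∀ φ : 𝓢(ℝ, ℂ),
      u x (fourierSchwartz φ) = ∫ η, h η * Complex.exp (x * R η) * φ η) :
    MemLinftyHm m u := by
  have h0 : Integrable fun η => ‖h η‖ / √|(R η).re| := by simpa using hk 0 (Nat.zero_le m)
  have hm : ∀ j : ℕ, AEStronglyMeasurable (fun η => h η * R η ^ j) := fun j =>
    hh.mul (hR.pow j).aestronglyMeasurable
  have hfin : ∀ j ≤ m, ∫⁻ η, ENNReal.ofReal (‖h η * R η ^ j‖ / √|(R η).re|) ≠ (⊤ : ℝ≥0∞) :=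
    fun j hj => (hk j hj).lintegral_lt_top.ne
  have hmem : ∀ j ≤ m, ∀ y, MemLp
      (fun x => superposition (fun η => h η * R η ^ j) R (x, y)) 2 halfLine := fun j hj y => by
    refine ⟨aestronglyMeasurable_superposition_left (hm j) hR y _, ?_⟩
    have := (eLpNorm_superposition_sq_le (hm j) hR hneg y).trans_lt
      (ENNReal.pow_lt_top (hfin j hj).lt_top)
    exact (ENNReal.pow_lt_top_iff.1 this).resolve_right two_ne_zero
  refine ⟨superposition h R, ⟨?_, ?_⟩, NNReal.sqrt (∑ j ∈ Finset.range (m + 1),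
    (∫⁻ η, ENNReal.ofReal (‖h η * R η ^ j‖ / √|(R η).re|)).toNNReal ^ 2),
    Eventually.of_forall fun y => ?_⟩
  · exact aestronglyMeasurable_superposition hh hR _
  · filter_upwards [ae_restrict_mem measurableSet_Ioi] with x hx
    exact isGivenBy_invFourier (T := u x) (g := fun η => h η * Complex.exp (x * R η))
      (integrable_mul_exp hh hR hneg h0 hx) (hu x hx)
  · refine ⟨fun j x => superposition (fun η => h η * R η ^ j) R (x, y), by simp, fun j hj =>
      ⟨hmem j hj y, isWeakDeriv_superposition hh hR hneg h0 (hk j hj) y⟩, ?_⟩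
    rw [← ENNReal.coe_pow, NNReal.sq_sqrt, ENNReal.ofNNReal_finsetSum]
    refine Finset.sum_le_sum fun j hj => ?_
    rw [ENNReal.coe_pow, ENNReal.coe_toNNReal (hfin j (Nat.lt_succ_iff.1 (Finset.mem_range.1 hj)))]
    exact eLpNorm_superposition_sq_le (hm j) hR hneg y

theorem MemLinftyHm.memLinftyL2 {u : ℝ → 𝓢'(ℝ, ℂ)} (hu : MemLinftyHm 0 u) : MemLinftyL2 u := by
  obtain ⟨U, hU, C, hC⟩ := hu
  refine ⟨U, hU, C, hC.mono fun y hy => ?_⟩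
  obtain ⟨F, hF, hF', hle⟩ := hy
  rw [zero_add, Finset.sum_range_one, hF] at hle
  exact ⟨hF ▸ (hF' 0 le_rfl).1, (ENNReal.pow_le_pow_left_iff two_ne_zero).1 hle⟩

/-! ### Superpositions which are square integrable on the half-plane -/

theorem halfPlane_eq_prod : halfPlane = halfLine.prod (volume : Measure ℝ) := by
  rw [halfPlane, halfLine, Measure.volume_eq_prod, ← Measure.prod_restrict, Measure.restrict_univ]

/-- The density whose `L²` norm controls the `L²` norm of a superposition. -/
def density (h R : ℝ → ℂ) (η : ℝ) : ℂ := h η * ((√|(R η).re|)⁻¹ : ℝ)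

theorem norm_density (h R : ℝ → ℂ) (η : ℝ) : ‖density h R η‖ = ‖h η‖ / √|(R η).re| := by
  rw [density, norm_mul, Complex.norm_real, Real.norm_of_nonneg (by positivity), div_eq_mul_inv]

theorem memLp_mul_exp {h R : ℝ → ℂ} (hh : AEStronglyMeasurable h) (hR : Continuous R)
    (hneg : ∀ η, (R η).re < 0) (hk : MemLp (density h R) 2) {x : ℝ}
    (hx : 0 < x) : MemLp (fun η => h η * Complex.exp (x * R η)) 2 := by
  refine hk.of_le_mul (c := (√x)⁻¹) (hh.mul (Continuous.aestronglyMeasurable (by fun_prop)))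
    (Eventually.of_forall fun η => ?_)
  rw [norm_density, mul_comm (√x)⁻¹]
  exact norm_mul_exp_le (hneg η) hx

/-- Plancherel in `y` at each `x`, then Tonelli and the integral of `exp (-2 x |Re R|)` over `x >
0`. The integrability assumption makes the superposition an honest integral; it is removed later by
truncation. -/
theorem eLpNorm_superposition_halfPlane_le {h R : ℝ → ℂ} (hh : AEStronglyMeasurable h)
    (hR : Continuous R) (hneg : ∀ η, (R η).re < 0) (hk : MemLp (density h R) 2)
    (hi : ∀ x : ℝ, 0 < x → Integrable fun η => h η * Complex.exp (x * R η)) :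
    eLpNorm (superposition h R) 2 halfPlane ≤ eLpNorm (density h R) 2 := by
  have hr : ∀ η, 0 < |(R η).re| := fun η => abs_pos.2 (hneg η).ne
  rw [← ENNReal.pow_le_pow_left_iff two_ne_zero, eLpNorm_two_sq, eLpNorm_two_sq, halfPlane_eq_prod,
    lintegral_prod _ ((aestronglyMeasurable_superposition hh hR _).enorm.pow_const 2)]
  have hexp : AEStronglyMeasurable (fun q : ℝ × ℝ => h q.2 * Complex.exp (q.1 * R q.2))
      (halfLine.prod volume) := hh.comp_snd.mul (Continuous.aestronglyMeasurable (by fun_prop))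
  calc ∫⁻ x in Ioi (0 : ℝ), ∫⁻ y, ‖superposition h R (x, y)‖ₑ ^ 2
      ≤ ∫⁻ x in Ioi (0 : ℝ), ∫⁻ η, ‖h η * Complex.exp (x * R η)‖ₑ ^ 2 := by
        refine setLIntegral_mono' measurableSet_Ioi fun x hx => ?_
        rw [← eLpNorm_two_sq, ← eLpNorm_two_sq]
        exact pow_le_pow_left'
          (eLpNorm_invFourier_le (hi x hx) (memLp_mul_exp hh hR hneg hk hx)) 2
    _ = ∫⁻ η, ∫⁻ x in Ioi (0 : ℝ), ‖h η * Complex.exp (x * R η)‖ₑ ^ 2 :=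
        lintegral_lintegral_swap (f := fun x η : ℝ => ‖h η * Complex.exp (x * R η)‖ₑ ^ 2)
          (hexp.enorm.pow_const 2)
    _ ≤ ∫⁻ η, ‖density h R η‖ₑ ^ 2 := by
        refine lintegral_mono fun η => ?_
        have e : ∀ x : ℝ, ‖h η * Complex.exp (x * R η)‖ₑ ^ 2 = ENNReal.ofReal (‖h η‖ ^ 2) *
            ENNReal.ofReal (Real.exp (-(2 * |(R η).re| * x))) := by
          intro x
          rw [← ofReal_norm, norm_mul, norm_exp_mul_of_re_neg (hneg η),
            ← ENNReal.ofReal_pow (by positivity), mul_pow, ← Real.exp_nat_mul,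
            ENNReal.ofReal_mul (by positivity)]
          congr 3
          push_cast
          ring
        simp only [e]
        rw [lintegral_const_mul _ (by fun_prop), lintegral_exp_neg_mul (by linarith [hr η]),
          ← ofReal_norm, norm_density, ← ENNReal.ofReal_pow (by positivity), div_pow,
          Real.sq_sqrt (hr η).le, ← ENNReal.ofReal_mul (by positivity), div_eq_mul_inv]
        refine ENNReal.ofReal_le_ofReal (mul_le_mul_of_nonneg_left ?_ (by positivity))
        exact inv_anti₀ (hr η) (by linarith [hr η])

/-- Fatou's lemma. A vanishing lower limit on almost every vertical slice replaces the extraction of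
a subsequence. -/
theorem ae_liminf_eq_zero {α : Type*} [MeasurableSpace α] {μ : Measure α} {a : ℕ → α → ℝ≥0∞}
    (ha : ∀ n, AEMeasurable (a n) μ) (hlim : Tendsto (fun n => ∫⁻ x, a n x ∂μ) atTop (𝓝 0)) :
    ∀ᵐ x ∂μ, liminf (fun n => a n x) atTop = 0 := by
  have h0 : ∫⁻ x, liminf (fun n => (ha n).mk (a n) x) atTop ∂μ = 0 := by
    refine le_antisymm ((lintegral_liminf_le fun n => (ha n).measurable_mk).trans ?_) zero_le
    simp only [← fun n => lintegral_congr_ae (ha n).ae_eq_mk]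
    exact hlim.liminf_eq.le
  rw [lintegral_eq_zero_iff (Measurable.liminf fun n => (ha n).measurable_mk)] at h0
  have hall := ae_all_iff.2 fun n => (ha n).ae_eq_mk
  filter_upwards [h0, hall] with x hx hx'
  simpa only [hx'] using! hx

/-! ### Approximation by truncation in frequency -/

/-- Truncation to a bounded interval. -/
def truncate (n : ℕ) (h : ℝ → ℂ) : ℝ → ℂ := (Icc (-(n : ℝ)) n).indicator h

theorem truncate_mul (n : ℕ) (h f : ℝ → ℂ) :
    (fun η => truncate n h η * f η) = truncate n fun η => h η * f η :=
  funext fun η => (indicator_mul_left _ h f).symm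

theorem density_truncate (n : ℕ) (h R : ℝ → ℂ) :
    density (truncate n h) R = truncate n (density h R) :=
  truncate_mul n h _

theorem eventually_truncate_eq (h : ℝ → ℂ) (η : ℝ) : ∀ᶠ n in atTop, truncate n h η = h η := by
  filter_upwards [eventually_ge_atTop ⌈|η|⌉₊] with n hn
  have hmem : η ∈ Icc (-(n : ℝ)) n := abs_le.1 ((Nat.le_ceil _).trans (Nat.cast_le.2 hn))
  exact indicator_of_mem hmem h

theorem norm_truncate_le (n : ℕ) (h : ℝ → ℂ) (η : ℝ) : ‖truncate n h η‖ ≤ ‖h η‖ :=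
  norm_indicator_le_norm_self _ _

theorem memLp_truncate {h : ℝ → ℂ} (hh : MemLp h 2) (n : ℕ) : MemLp (truncate n h) 2 :=
  hh.indicator measurableSet_Icc

theorem integrable_truncate {h : ℝ → ℂ} (hh : MemLp h 2) (n : ℕ) : Integrable (truncate n h) := by
  rw [truncate, integrable_indicator_iff measurableSet_Icc]
  have : IsFiniteMeasure (volume.restrict (Icc (-(n : ℝ)) n)) :=
    ⟨by rw [Measure.restrict_apply_univ]; exact measure_Icc_lt_top⟩
  exact (hh.restrict _).integrable one_le_two

theorem tendsto_toLp_truncate {k : ℝ → ℂ} (hk : MemLp k 2) :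
    Tendsto (fun n => (memLp_truncate hk n).toLp) atTop (𝓝 hk.toLp) := by
  rw [Lp.tendsto_Lp_iff_tendsto_eLpNorm'']
  have hlim : Tendsto (fun n => ∫⁻ η, ‖truncate n k η - k η‖ₑ ^ 2) atTop (𝓝 (∫⁻ _ : ℝ, 0)) := by
    refine tendsto_lintegral_of_dominated_convergence' (fun η => (2 * ‖k η‖ₑ) ^ 2) (fun n => ?_)
      (fun n => Eventually.of_forall fun η => ?_) ?_ (Eventually.of_forall fun η => ?_)
    · exact ((memLp_truncate hk n).aestronglyMeasurable.sub hk.aestronglyMeasurable).enorm.pow_const 2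
    · refine pow_le_pow_left' (enorm_sub_le.trans ?_) 2
      rw [two_mul]
      gcongr
      exact enorm_le_iff_norm_le.2 (norm_truncate_le n k η)
    · simp only [mul_pow]
      rw [lintegral_const_mul'' _ (hk.aestronglyMeasurable.enorm.pow_const 2), ← eLpNorm_two_sq]
      exact ENNReal.mul_ne_top (by norm_num) (ENNReal.pow_ne_top hk.eLpNorm_ne_top)
    · refine tendsto_const_nhds.congr' ?_
      filter_upwards [eventually_truncate_eq k η] with n hn
      rw [hn, sub_self, enorm_zero, zero_pow two_ne_zero]
  have h2 := (ENNReal.continuous_rpow_const (y := 1 / 2)).tendsto _ |>.comp hlim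
  simp only [lintegral_zero] at h2
  rw [ENNReal.zero_rpow_of_pos (by norm_num)] at h2
  refine h2.congr fun n => ?_
  change (∫⁻ η, ‖(truncate n k - k) η‖ₑ ^ 2) ^ (1 / 2 : ℝ) = _
  rw [← eLpNorm_two_sq, ← ENNReal.rpow_natCast, ← ENNReal.rpow_mul]
  norm_num

theorem superposition_sub {h₁ h₂ R : ℝ → ℂ} {p : ℝ × ℝ}
    (h1 : Integrable fun η => h₁ η * Complex.exp (p.1 * R η))
    (h2 : Integrable fun η => h₂ η * Complex.exp (p.1 * R η)) :
    superposition (h₁ - h₂) R p = superposition h₁ R p - superposition h₂ R p := by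
  have hm : ∀ {g : ℝ → ℂ}, Integrable g →
      Integrable fun η : ℝ => Complex.exp (Complex.I * η * p.2) * g η := fun hg =>
    hg.bdd_mul (c := 1) (Continuous.aestronglyMeasurable (by fun_prop))
      (Eventually.of_forall fun η => (norm_exp_I_mul_mul η p.2).le)
  rw [superposition, superposition, superposition, invFourier, invFourier, invFourier, ← mul_sub,
    ← integral_sub (hm h1) (hm h2)]
  simp only [Pi.sub_apply, sub_mul, mul_sub]

section

variable {h R : ℝ → ℂ}

theorem integrable_truncate_mul_exp (hh : AEStronglyMeasurable h) (hR : Continuous R)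
    (hneg : ∀ η, (R η).re < 0) (hk : MemLp (density h R) 2) (n : ℕ) {x : ℝ} (hx : 0 < x) :
    Integrable fun η => truncate n h η * Complex.exp (x * R η) := by
  rw [truncate_mul n h fun η => Complex.exp (x * R η)]
  exact integrable_truncate (memLp_mul_exp hh hR hneg hk hx) n

theorem aestronglyMeasurable_truncate (hh : AEStronglyMeasurable h) (n : ℕ) :
    AEStronglyMeasurable (truncate n h) := hh.indicator measurableSet_Icc

theorem memLp_superposition_truncate (hh : AEStronglyMeasurable h) (hR : Continuous R)
    (hneg : ∀ η, (R η).re < 0) (hk : MemLp (density h R) 2) (n : ℕ) :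
    MemLp (superposition (truncate n h) R) 2 halfPlane := by
  have hkn : MemLp (density (truncate n h) R) 2 := density_truncate n h R ▸ memLp_truncate hk n
  exact ⟨aestronglyMeasurable_superposition (aestronglyMeasurable_truncate hh n) hR _,
    (eLpNorm_superposition_halfPlane_le (aestronglyMeasurable_truncate hh n) hR hneg hkn
      fun x hx => integrable_truncate_mul_exp hh hR hneg hk n hx).trans_lt hkn.eLpNorm_lt_top⟩

/-- The half-plane estimate applied to a difference of truncations, which is again a superposition.
Convergence of the truncated densities thus makes the superpositions a Cauchy sequence. -/
theorem edist_superposition_truncate_le (hh : AEStronglyMeasurable h) (hR : Continuous R)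
    (hneg : ∀ η, (R η).re < 0) (hk : MemLp (density h R) 2) (n m : ℕ) :
    edist (memLp_superposition_truncate hh hR hneg hk n).toLp
        (memLp_superposition_truncate hh hR hneg hk m).toLp ≤
      edist (memLp_truncate hk n).toLp (memLp_truncate hk m).toLp := by
  rw [Lp.edist_toLp_toLp, Lp.edist_toLp_toLp]
  have hi := fun n (x : ℝ) (hx : 0 < x) => integrable_truncate_mul_exp hh hR hneg hk n hx
  have hd : density (truncate n h - truncate m h) R =
      truncate n (density h R) - truncate m (density h R) := by
    rw [← density_truncate, ← density_truncate]
    funext η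
    simp only [density, Pi.sub_apply, sub_mul]
  have hae : superposition (truncate n h) R - superposition (truncate m h) R =ᵐ[halfPlane]
      superposition (truncate n h - truncate m h) R := by
    have hpos : ∀ᵐ p ∂halfPlane, p ∈ Ioi (0 : ℝ) ×ˢ (univ : Set ℝ) :=
      ae_restrict_mem (measurableSet_Ioi.prod MeasurableSet.univ)
    filter_upwards [hpos] with p hp
    rw [superposition_sub (hi n p.1 hp.1) (hi m p.1 hp.1), Pi.sub_apply]
  rw [eLpNorm_congr_ae hae, ← hd]
  refine eLpNorm_superposition_halfPlane_le
    ((aestronglyMeasurable_truncate hh n).sub (aestronglyMeasurable_truncate hh m)) hR hneg ?_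
    fun x hx => ?_
  · rw [hd]
    exact (memLp_truncate hk n).sub (memLp_truncate hk m)
  · refine ((hi n x hx).sub (hi m x hx)).congr (Eventually.of_forall fun η => ?_)
    simp only [Pi.sub_apply, sub_mul]

theorem exists_tendsto_superposition_truncate (hh : AEStronglyMeasurable h) (hR : Continuous R)
    (hneg : ∀ η, (R η).re < 0) (hk : MemLp (density h R) 2) :
    ∃ U : ℝ × ℝ → ℂ, StronglyMeasurable U ∧ MemLp U 2 halfPlane ∧
      Tendsto (fun n => ∫⁻ p, ‖superposition (truncate n h) R p - U p‖ₑ ^ 2 ∂halfPlane)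
        atTop (𝓝 0) := by
  have hc : CauchySeq fun n => (memLp_superposition_truncate hh hR hneg hk n).toLp := by
    have := (tendsto_toLp_truncate hk).cauchySeq
    rw [EMetric.cauchySeq_iff] at this ⊢
    intro ε hε
    obtain ⟨N, hN⟩ := this ε hε
    exact ⟨N, fun m hm n hn =>
      (edist_superposition_truncate_le hh hR hneg hk m n).trans_lt (hN m hm n hn)⟩
  obtain ⟨U, hU⟩ := cauchySeq_tendsto_of_complete hc
  refine ⟨U, Lp.stronglyMeasurable U, Lp.memLp U, ?_⟩
  rw [Lp.tendsto_Lp_iff_tendsto_eLpNorm'] at hU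
  have h2 := ((ENNReal.continuous_pow 2).tendsto _).comp hU
  rw [zero_pow two_ne_zero] at h2
  refine h2.congr fun n => ?_
  rw [Function.comp_apply, eLpNorm_congr_ae
    ((memLp_superposition_truncate hh hR hneg hk n).coeFn_toLp.sub
    (EventuallyEq.refl _ (U : ℝ × ℝ → ℂ))), eLpNorm_two_sq]
  rfl

/-- Passing to the limit in the pairing with a Schwartz function. -/
theorem integral_mul_eq_of_liminf_eq_zero {V : ℝ → ℂ} {G : ℕ → ℝ → ℂ} {φ : 𝓢(ℝ, ℂ)} {T : ℂ}
    (hV : Integrable fun y => V y * φ y) (hG : ∀ n, Integrable fun y => G n y * φ y)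
    (hVm : AEStronglyMeasurable V) (hGm : ∀ n, AEStronglyMeasurable (G n))
    (hT : Tendsto (fun n => ∫ y, G n y * φ y) atTop (𝓝 T))
    (hlim : liminf (fun n => ∫⁻ y, ‖G n y - V y‖ₑ ^ 2) atTop = 0) :
    T = ∫ y, V y * φ y := by
  obtain ⟨M, hM⟩ : ∃ M : ℝ≥0∞, M ≠ ⊤ ∧ ∀ y, ‖φ y‖ₑ ≤ M := by
    refine ⟨ENNReal.ofReal (SchwartzMap.seminorm ℂ 0 0 φ), ENNReal.ofReal_ne_top, fun y => ?_⟩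
    rw [← ofReal_norm]
    exact ENNReal.ofReal_le_ofReal (SchwartzMap.norm_le_seminorm ℂ φ y)
  set K := (∫⁻ y, ‖φ y‖ₑ) * M with hK
  have hKtop : K ≠ ⊤ := ENNReal.mul_ne_top φ.integrable.2.ne hM.1
  -- Weighted Cauchy–Schwarz with weight `|φ|`, then the sup bound on `φ`. The constant does not
  -- depend on `n`, so the lower limit may be taken.
  have hle : ∀ n, ‖(∫ y, G n y * φ y) - ∫ y, V y * φ y‖ₑ ^ 2 ≤
      K * ∫⁻ y, ‖G n y - V y‖ₑ ^ 2 := by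
    intro n
    rw [← integral_sub (hG n) hV]
    have hm : AEMeasurable (fun y => ‖G n y - V y‖ₑ) := ((hGm n).sub hVm).enorm
    calc ‖∫ y, (G n y * φ y - V y * φ y)‖ₑ ^ 2
        ≤ (∫⁻ y, ‖φ y‖ₑ * ‖G n y - V y‖ₑ) ^ 2 := by
          refine pow_le_pow_left' ((enorm_integral_le_lintegral_enorm _).trans (le_of_eq ?_)) 2
          congr 1
          funext y
          rw [← sub_mul, enorm_mul, mul_comm]
      _ ≤ (∫⁻ y, ‖φ y‖ₑ) * ∫⁻ y, ‖φ y‖ₑ * ‖G n y - V y‖ₑ ^ 2 :=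
          lintegral_mul_sq_le φ.continuous.enorm.aemeasurable hm
      _ ≤ (∫⁻ y, ‖φ y‖ₑ) * ∫⁻ y, M * ‖G n y - V y‖ₑ ^ 2 := by
          gcongr with y
          exact hM.2 y
      _ = _ := by rw [lintegral_const_mul'' _ (hm.pow_const 2), hK, mul_assoc]
  have h1 : Tendsto (fun n => ‖(∫ y, G n y * φ y) - ∫ y, V y * φ y‖ₑ ^ 2) atTop
      (𝓝 (‖T - ∫ y, V y * φ y‖ₑ ^ 2)) :=
    (((ENNReal.continuous_pow 2).comp continuous_enorm).tendsto _).comp (hT.sub_const _)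
  have h2 : ‖T - ∫ y, V y * φ y‖ₑ ^ 2 ≤ 0 := by
    rw [← h1.liminf_eq]
    refine (liminf_le_liminf (Eventually.of_forall hle)).trans ?_
    rw [ENNReal.liminf_const_mul_of_ne_top hKtop, hlim, mul_zero]
  rw [nonpos_iff_eq_zero, pow_eq_zero_iff two_ne_zero, enorm_eq_zero, sub_eq_zero] at h2
  exact h2

theorem tendsto_integral_superposition_truncate (hh : AEStronglyMeasurable h) (hR : Continuous R)
    (hneg : ∀ η, (R η).re < 0) (hk : MemLp (density h R) 2) {T : 𝓢'(ℝ, ℂ)} {x : ℝ} (hx : 0 < x)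
    (hT : ∀ φ : 𝓢(ℝ, ℂ), T (fourierSchwartz φ) = ∫ η, h η * Complex.exp (x * R η) * φ η)
    (φ : 𝓢(ℝ, ℂ)) :
    Tendsto (fun n => ∫ y, superposition (truncate n h) R (x, y) * φ y) atTop (𝓝 (T φ)) := by
  have hi := fun n => integrable_truncate_mul_exp hh hR hneg hk n hx
  obtain ⟨ψ, hψ, hψ'⟩ := exists_fourierSchwartz_eq φ
  have e : ∀ n, ∫ y, superposition (truncate n h) R (x, y) * φ y =
      ∫ η, truncate n h η * Complex.exp (x * R η) * ψ η := fun n => by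
    refine (integral_invFourier_mul (hi n) φ.integrable).trans ?_
    simp only [hψ']
  simp only [e]
  rw [← hψ, hT]
  refine tendsto_integral_of_dominated_convergence
    (fun η => ‖h η * Complex.exp (x * R η) * ψ η‖) (fun n => ?_) ?_
    (fun n => Eventually.of_forall fun η => ?_) (Eventually.of_forall fun η => ?_)
  · exact (hi n).aestronglyMeasurable.mul ψ.continuous.aestronglyMeasurable
  · exact ((memLp_mul_exp hh hR hneg hk hx).integrable_mul (ψ.memLp 2)).norm
  · simp only [norm_mul]
    gcongr
    exact norm_truncate_le n h η
  · refine tendsto_const_nhds.congr' ?_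
    filter_upwards [eventually_truncate_eq h η] with n hn
    rw [hn]

/-- A family of distributions with Fourier transform `h(η) exp (x R(η))` belongs to
`L²((0,∞) × ℝ)` as soon as `h / √|Re R|` is square integrable. -/
theorem memL2HalfPlane_of_memLp {u : ℝ → 𝓢'(ℝ, ℂ)} (hh : AEStronglyMeasurable h)
    (hR : Continuous R) (hneg : ∀ η, (R η).re < 0) (hk : MemLp (density h R) 2)
    (hu : ∀ x : ℝ, 0 < x → ∀ φ : 𝓢(ℝ, ℂ),
      u x (fourierSchwartz φ) = ∫ η, h η * Complex.exp (x * R η) * φ η) :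
    MemL2HalfPlane u := by
  obtain ⟨U, hUm, hU, hlim⟩ := exists_tendsto_superposition_truncate hh hR hneg hk
  refine ⟨U, ⟨hU.aestronglyMeasurable, ?_⟩, hU⟩
  have hGm : ∀ n, AEStronglyMeasurable (superposition (truncate n h) R)
      (halfLine.prod (volume : Measure ℝ)) := fun n =>
    aestronglyMeasurable_superposition (aestronglyMeasurable_truncate hh n) hR _
  have hdm : ∀ n, AEMeasurable (fun p => ‖superposition (truncate n h) R p - U p‖ₑ ^ 2)
      (halfLine.prod (volume : Measure ℝ)) := fun n =>
    ((hGm n).sub hUm.aestronglyMeasurable).enorm.pow_const 2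
  have hae1 : ∀ᵐ x ∂halfLine, liminf (fun n =>
      ∫⁻ y, ‖superposition (truncate n h) R (x, y) - U (x, y)‖ₑ ^ 2) atTop = 0 := by
    rw [halfPlane_eq_prod] at hlim
    refine ae_liminf_eq_zero (a := fun n x =>
      ∫⁻ y, ‖superposition (truncate n h) R (x, y) - U (x, y)‖ₑ ^ 2)
      (fun n => (hdm n).lintegral_prod_right') (hlim.congr fun n => ?_)
    exact lintegral_prod _ (hdm n)
  -- Almost every vertical slice of the limit is in `L²`, hence integrable against Schwartz
  -- functions.
  have hae2 : ∀ᵐ x ∂halfLine, ∫⁻ y, ‖U (x, y)‖ₑ ^ 2 < ⊤ := by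
    have hUe : AEMeasurable (fun p => ‖U p‖ₑ ^ 2) (halfLine.prod (volume : Measure ℝ)) :=
      hUm.aestronglyMeasurable.enorm.pow_const 2
    refine ae_lt_top' hUe.lintegral_prod_right' ?_
    rw [← lintegral_prod _ hUe, ← halfPlane_eq_prod, ← eLpNorm_two_sq]
    exact ENNReal.pow_ne_top hU.eLpNorm_ne_top
  filter_upwards [hae1, hae2, ae_restrict_mem measurableSet_Ioi] with x hx1 hx2 hx
  have hi := fun n => integrable_truncate_mul_exp hh hR hneg hk n hx
  have hVm : AEStronglyMeasurable fun y => U (x, y) :=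
    (hUm.comp_measurable measurable_prodMk_left).aestronglyMeasurable
  have hV : MemLp (fun y => U (x, y)) 2 := by
    refine ⟨hVm, ?_⟩
    rw [← eLpNorm_two_sq] at hx2
    exact (ENNReal.pow_lt_top_iff.1 hx2).resolve_right two_ne_zero
  intro φ
  have hVi : Integrable fun y => U (x, y) * φ y := hV.integrable_mul (φ.memLp 2)
  have hT := tendsto_integral_superposition_truncate hh hR hneg hk hx (hu x hx) φ
  have hGi : ∀ n, Integrable fun y => superposition (truncate n h) R (x, y) * φ y := fun n => by
    have := integrable_invFourier_mul (hi n) (φ.integrable (μ := volume))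
    exact this
  have hGs : ∀ n, AEStronglyMeasurable fun y => superposition (truncate n h) R (x, y) := fun n => by
    have := (continuous_invFourier (hi n)).aestronglyMeasurable (μ := volume)
    exact this
  exact ⟨hVi, integral_mul_eq_of_liminf_eq_zero hVi hGi hVm hGs hT hx1⟩

end

/-! ### Bounds for the symbols -/

theorem norm_complexSqrt_sq (z : ℂ) : ‖Complex.sqrt z‖ ^ 2 = ‖z‖ := by
  rw [← norm_pow, complexSqrt_sq]

/-- In the expanded square the cross term `2 Re √z` is nonnegative for the principal root. -/
theorem one_add_norm_le_norm_one_add_sqrt_sq (z : ℂ) : 1 + ‖z‖ ≤ ‖1 + Complex.sqrt z‖ ^ 2 := by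
  rw [← norm_complexSqrt_sq, Complex.sq_norm, Complex.sq_norm, Complex.normSq_apply,
    Complex.normSq_apply, Complex.add_re, Complex.add_im, Complex.one_re, Complex.one_im]
  nlinarith [complexSqrt_re_nonneg z]

/-- The squared weight decays like `|η| ^ (-(1 + 2 s))`, which is integrable exactly because `s >
0`. Cauchy–Schwarz then applies. -/
theorem integrable_one_add_sq_rpow {f : ℝ → ℂ} (hf : MemLp f 2) {s : ℝ} (hs : 0 < s) :
    Integrable fun η : ℝ => (1 + |η| ^ 2) ^ (-(1 / 4 : ℝ) - s / 2) * ‖f η‖ := by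
  have hpos : ∀ η : ℝ, 0 < 1 + |η| ^ 2 := fun η => by positivity
  have hc : Continuous fun η : ℝ => (1 + |η| ^ 2) ^ (-(1 / 4 : ℝ) - s / 2) :=
    (continuous_const.add (continuous_abs.pow 2)).rpow_const fun η => Or.inl (hpos η).ne'
  have hp : MemLp (fun η : ℝ => (1 + |η| ^ 2) ^ (-(1 / 4 : ℝ) - s / 2)) 2 := by
    rw [memLp_two_iff_integrable_sq hc.aestronglyMeasurable]
    have := integrable_rpow_neg_one_add_norm_sq (E := ℝ) (μ := volume) (r := 1 + 2 * s)
      (by rw [Module.finrank_self]; push_cast; linarith)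
    refine this.congr (Eventually.of_forall fun η => ?_)
    beta_reduce
    rw [← Real.rpow_mul_natCast (hpos η).le, Real.norm_eq_abs]
    congr 1
    push_cast
    ring
  exact hp.integrable_mul hf.norm

theorem aestronglyMeasurable_of_weight {w : ℝ → ℝ} (hw : Continuous w) (hpos : ∀ η, 0 < w η)
    {f : ℝ → ℂ} (hf : MemLp (fun η => (w η : ℂ) * f η) 2) : AEStronglyMeasurable f := by
  have hc : Continuous fun η => ((w η : ℂ))⁻¹ :=
    (Complex.continuous_ofReal.comp hw).inv₀ fun η => Complex.ofReal_ne_zero.2 (hpos η).ne'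
  refine (hc.aestronglyMeasurable.mul hf.aestronglyMeasurable).congr
    (Eventually.of_forall fun η => ?_)
  exact inv_mul_cancel_left₀ (Complex.ofReal_ne_zero.2 (hpos η).ne') _

namespace Admissible

variable {kx ky ε ν : ℝ}

theorem exists_norm_discr_le (kx ky ε ν : ℝ) :
    ∃ D > 0, ∀ η, ‖discr kx ky ε ν η‖ ≤ D * (1 + |η|) := by
  refine ⟨1 + |2 * ε * ky / kx ^ 2| + |2 * ν * (ε * ky ^ 2 / kx ^ 2)|, by positivity, fun η => ?_⟩
  have h1 := Complex.norm_le_abs_re_add_abs_im (discr kx ky ε ν η)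
  rw [discr_re, discr_im] at h1
  have h2 := abs_sub (1 : ℝ) (2 * ε * ky / kx ^ 2 * η)
  rw [abs_one, abs_mul (2 * ε * ky / kx ^ 2) η] at h2
  have h3 := abs_nonneg (2 * ε * ky / kx ^ 2)
  have h4 := abs_nonneg (2 * ν * (ε * ky ^ 2 / kx ^ 2))
  nlinarith [abs_nonneg η, mul_nonneg h4 (abs_nonneg η)]

theorem exists_one_add_abs_le (h : Admissible kx ky ε ν) :
    ∃ C > 0, ∀ η, 1 + |η| ≤ C * (1 + ‖discr kx ky ε ν η‖) := by
  have ha : 0 < |2 * ε * ky / kx ^ 2| := by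
    have := h.kx_pos.ne'
    have := h.ε_pos.ne'
    have := h.ky_ne
    positivity
  set a := 2 * ε * ky / kx ^ 2
  refine ⟨1 + |a|⁻¹, by positivity, fun η => ?_⟩
  have h1 := Complex.abs_re_le_norm (discr kx ky ε ν η)
  rw [discr_re] at h1
  have h2 : |a| * |η| ≤ 1 + ‖discr kx ky ε ν η‖ := by
    rw [← abs_mul]
    have := abs_sub_abs_le_abs_sub (a * η) 1
    rw [abs_one, abs_sub_comm] at this
    linarith
  have h3 : |η| ≤ |a|⁻¹ * (1 + ‖discr kx ky ε ν η‖) := by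
    rw [← div_eq_inv_mul, le_div_iff₀ ha]
    linarith
  nlinarith [norm_nonneg (discr kx ky ε ν η)]

theorem exists_norm_inv_one_add_sqrt_le (h : Admissible kx ky ε ν) :
    ∃ C > 0, ∀ η, ‖(1 + Complex.sqrt (discr kx ky ε ν η))⁻¹‖ ≤
      C * (1 + |η| ^ 2) ^ (-(1 / 4 : ℝ)) := by
  obtain ⟨C, hC, hle⟩ := h.exists_one_add_abs_le
  refine ⟨√C, Real.sqrt_pos.2 hC, fun η => ?_⟩
  have hpos : 0 < 1 + |η| ^ 2 := by positivity
  have hn : 0 < ‖1 + Complex.sqrt (discr kx ky ε ν η)‖ := norm_pos_iff.2 (h.one_add_sqrt_ne_zero η)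
  have h1 : (1 + |η| ^ 2) ^ (1 / 4 : ℝ) ≤ √C * ‖1 + Complex.sqrt (discr kx ky ε ν η)‖ := by
    have e : (1 + |η| ^ 2) ^ (1 / 4 : ℝ) = √√(1 + |η| ^ 2) := by
      rw [Real.sqrt_eq_rpow, Real.sqrt_eq_rpow, ← Real.rpow_mul hpos.le]
      norm_num
    have e2 : √C * ‖1 + Complex.sqrt (discr kx ky ε ν η)‖ =
        √(C * ‖1 + Complex.sqrt (discr kx ky ε ν η)‖ ^ 2) := by
      rw [Real.sqrt_mul hC.le, Real.sqrt_sq (norm_nonneg _)]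
    rw [e, e2]
    refine Real.sqrt_le_sqrt ?_
    calc √(1 + |η| ^ 2) ≤ 1 + |η| := by
          rw [Real.sqrt_le_left (by positivity)]
          nlinarith [abs_nonneg η]
      _ ≤ _ := hle η
      _ ≤ _ := by
          gcongr
          exact one_add_norm_le_norm_one_add_sqrt_sq _
  rw [norm_inv, Real.rpow_neg hpos.le, ← div_eq_mul_inv, le_div_iff₀ (by positivity),
    inv_mul_le_iff₀ hn, mul_comm _ (√C)]
  exact h1

/-- The symbol never vanishes, its real part being negative. It tends to infinity in modulus because
its linear term dominates the square root, so the continuous modulus attains a positive minimum. -/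
theorem exists_le_norm_Rminus (h : Admissible kx ky ε ν) :
    ∃ c > 0, ∀ η, c ≤ ‖Rminus kx ky ε ν η‖ := by
  obtain ⟨D, hD, hle⟩ := exists_norm_discr_le kx ky ε ν
  set A := kx / |ky| with hA
  set B := kx / (ε * ky ^ 2) with hB
  have hA0 : 0 < A := div_pos h.kx_pos (abs_pos.2 h.ky_ne)
  have hB0 : 0 < B := h.coef_pos
  -- Parameter of the inequality `E ≤ δ E² + 1 / (4 δ)`, chosen so that the square-root term absorbs
  -- only half of the linear growth `A |η|`.
  set δ := A / (2 * B * D) with hδ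
  have hδ0 : 0 < δ := by positivity
  have hBδ : B * δ * D = A / 2 := by
    rw [hδ]
    field_simp
  have hlow : ∀ η, A / 2 * |η| + (-(A / 2) - B - B / (4 * δ)) ≤ ‖Rminus kx ky ε ν η‖ := by
    intro η
    set E := ‖Complex.sqrt (discr kx ky ε ν η)‖ with hE
    have h1 : E ≤ δ * (D * (1 + |η|)) + 1 / (4 * δ) := by
      have h2 : E ^ 2 ≤ D * (1 + |η|) := (norm_complexSqrt_sq _).trans_le (hle η)
      have h3 : E ≤ δ * E ^ 2 + 1 / (4 * δ) := by
        have : δ * E ^ 2 + 1 / (4 * δ) - E = (2 * δ * E - 1) ^ 2 / (4 * δ) := by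
          field_simp
          ring
        have h4 : 0 ≤ (2 * δ * E - 1) ^ 2 / (4 * δ) := by positivity
        linarith
      have := mul_le_mul_of_nonneg_left h2 hδ0.le
      linarith
    have e1 : ‖Complex.I * (kx * η / ky : ℂ)‖ = A * |η| := by
      rw [norm_mul, Complex.norm_I, one_mul, norm_div, norm_mul, Complex.norm_real,
        Complex.norm_real, Complex.norm_real, Real.norm_of_nonneg h.kx_pos.le, Real.norm_eq_abs,
        Real.norm_eq_abs, hA]
      ring
    have e2 : ‖Complex.I * (kx / (ε * ky ^ 2) : ℂ) *
        (1 - Complex.sqrt (discr kx ky ε ν η))‖ ≤ B * (1 + E) := by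
      have : (kx / (ε * ky ^ 2) : ℂ) = (B : ℂ) := by
        rw [hB]
        push_cast
        rfl
      rw [this, norm_mul, norm_mul, Complex.norm_I, one_mul, Complex.norm_real,
        Real.norm_of_nonneg hB0.le]
      refine mul_le_mul_of_nonneg_left ((norm_sub_le _ _).trans ?_) hB0.le
      rw [norm_one]
    have h5 := norm_sub_norm_le (Complex.I * (kx * η / ky : ℂ))
      (Complex.I * (kx / (ε * ky ^ 2) : ℂ) * (1 - Complex.sqrt (discr kx ky ε ν η)))
    rw [← Rminus_eq, e1] at h5
    have h6 := mul_le_mul_of_nonneg_left h1 hB0.le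
    have h7 : B * (δ * (D * (1 + |η|)) + 1 / (4 * δ)) = A / 2 * (1 + |η|) + B / (4 * δ) := by
      rw [← hBδ]
      ring
    linarith
  have hlim : Tendsto (fun η => ‖Rminus kx ky ε ν η‖) (cocompact ℝ) atTop := by
    refine tendsto_atTop_mono hlow (tendsto_atTop_add_const_right _ _ ?_)
    exact (tendsto_norm_cocompact_atTop (E := ℝ)).const_mul_atTop (by positivity)
  obtain ⟨η₀, hη₀⟩ := h.contDiff_Rminus.continuous.norm.exists_forall_le hlim
  refine ⟨_, norm_pos_iff.2 fun h0 => ?_, hη₀⟩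
  have := h.Rminus_re_neg η₀
  rw [h0, Complex.zero_re] at this
  exact lt_irrefl _ this

end Admissible

/-! ### The regularity of the solution -/

section Solution

variable {kx ky ε ν : ℝ} {g : 𝓢'(ℝ, ℂ)} {u : ℝ → 𝓢'(ℝ, ℂ)}

/-- The amplitude of the decaying exponentials in the solution. -/
def amplitude (kx ky ε ν : ℝ) (f : ℝ → ℂ) (η : ℝ) : ℂ :=
  2 * f η * (1 + Complex.sqrt (discr kx ky ε ν η))⁻¹

theorem aestronglyMeasurable_amplitude (h : Admissible kx ky ε ν) {f : ℝ → ℂ}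
    (hf : AEStronglyMeasurable f) : AEStronglyMeasurable (amplitude kx ky ε ν f) :=
  (hf.const_mul 2).mul h.contDiff_inv_one_add_sqrt.continuous.aestronglyMeasurable

theorem exists_norm_amplitude_le (h : Admissible kx ky ε ν) :
    ∃ C > 0, ∀ (f : ℝ → ℂ) (η : ℝ), ‖amplitude kx ky ε ν f η‖ ≤
      C * (1 + |η| ^ 2) ^ (-(1 / 4 : ℝ)) * ‖f η‖ := by
  obtain ⟨C, hC, hle⟩ := h.exists_norm_inv_one_add_sqrt_le
  refine ⟨2 * C, by positivity, fun f η => ?_⟩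
  rw [amplitude, norm_mul, norm_mul, Complex.norm_ofNat]
  nlinarith [mul_le_mul_of_nonneg_left (hle η) (norm_nonneg (f η))]

theorem continuous_sqrt_abs_re_Rminus (h : Admissible kx ky ε ν) :
    Continuous fun η => √|(Rminus kx ky ε ν η).re| :=
  (Complex.continuous_re.comp h.contDiff_Rminus.continuous).abs.sqrt

theorem sqrt_abs_re_Rminus_pos (h : Admissible kx ky ε ν) (η : ℝ) :
    0 < √|(Rminus kx ky ε ν η).re| :=
  Real.sqrt_pos.2 (abs_pos.2 (h.Rminus_re_neg η).ne)

theorem continuous_one_add_sq_rpow (p : ℝ) : Continuous fun η : ℝ => (1 + |η| ^ 2) ^ p :=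
  (continuous_const.add (continuous_abs.pow 2)).rpow_const fun η =>
    Or.inl (by positivity : (0 : ℝ) < 1 + |η| ^ 2).ne'

theorem memL2HalfPlane_of_weightedFourierL2 (h : Admissible kx ky ε ν)
    (hu : IsHalfPlaneSolution kx ky ε ν g u)
    (hg : WeightedFourierL2 (fun η => 1 / ((1 + |η| ^ 2) ^ (1 / 4 : ℝ) *
      √|(Rminus kx ky ε ν η).re|)) g) : MemL2HalfPlane u := by
  obtain ⟨f, hf, hf2⟩ := hg
  have hr := sqrt_abs_re_Rminus_pos h
  have hfm : AEStronglyMeasurable f := by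
    refine aestronglyMeasurable_of_weight (continuous_const.div₀
      ((continuous_one_add_sq_rpow _).mul (continuous_sqrt_abs_re_Rminus h)) fun η => ?_)
      (fun η => ?_) hf2
    · exact (mul_pos (Real.rpow_pos_of_pos (by positivity) _) (hr η)).ne'
    · exact one_div_pos.2 (mul_pos (Real.rpow_pos_of_pos (by positivity) _) (hr η))
  have hR := h.contDiff_Rminus.continuous
  have ham := aestronglyMeasurable_amplitude h hfm
  obtain ⟨C, hC, hle⟩ := exists_norm_amplitude_le h
  refine memL2HalfPlane_of_memLp ham hR h.Rminus_re_neg (hf2.of_le_mul (c := C)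
    (ham.mul ?_) (Eventually.of_forall fun η => ?_))
    fun x hx φ => solution_eq_integral h hu hf φ hx.le
  · exact (Complex.continuous_ofReal.comp ((continuous_sqrt_abs_re_Rminus h).inv₀
      fun η => (hr η).ne')).aestronglyMeasurable
  · have h1 := hr η
    have h2 : (0 : ℝ) < 1 + |η| ^ 2 := by positivity
    rw [norm_density, norm_mul, Complex.norm_real, Real.norm_of_nonneg (by positivity),
      div_le_iff₀ h1]
    refine (hle f η).trans (le_of_eq ?_)
    rw [Real.rpow_neg h2.le]
    field_simp

theorem memLinftyHm_of_weightedFourierL2 (h : Admissible kx ky ε ν)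
    (hu : IsHalfPlaneSolution kx ky ε ν g u) {s : ℝ} (hs : 0 < s) (m : ℕ)
    (hg : WeightedFourierL2 (fun η => (1 + |η| ^ 2) ^ (s / 2) * ‖Rminus kx ky ε ν η‖ ^ m /
      √|(Rminus kx ky ε ν η).re|) g) : MemLinftyHm m u := by
  obtain ⟨f, hf, hf2⟩ := hg
  have hr := sqrt_abs_re_Rminus_pos h
  have hR := h.contDiff_Rminus.continuous
  obtain ⟨c, hc, hcle⟩ := h.exists_le_norm_Rminus
  have hfm : AEStronglyMeasurable f := by
    refine aestronglyMeasurable_of_weight (((continuous_one_add_sq_rpow _).mul (hR.norm.pow m)).div₀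
      (continuous_sqrt_abs_re_Rminus h) fun η => (hr η).ne') (fun η => ?_) hf2
    exact div_pos (mul_pos (Real.rpow_pos_of_pos (by positivity) _)
      (pow_pos (hc.trans_le (hcle η)) m)) (hr η)
  have ham := aestronglyMeasurable_amplitude h hfm
  obtain ⟨C, hC, hle⟩ := exists_norm_amplitude_le h
  refine memLinftyHm_of_integrable ham hR h.Rminus_re_neg (fun j hj => ?_)
    fun x hx φ => solution_eq_integral h hu hf φ hx.le
  refine ((integrable_one_add_sq_rpow hf2 hs).const_mul (C * (c ^ (m - j))⁻¹)).mono' ?_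
    (Eventually.of_forall fun η => ?_)
  · have := (ham.mul (hR.pow j).aestronglyMeasurable).norm.mul
      ((continuous_sqrt_abs_re_Rminus h).inv₀ fun η => (hr η).ne').aestronglyMeasurable
    simpa only [div_eq_mul_inv] using! this
  · have h1 := hr η
    have h2 : (0 : ℝ) < 1 + |η| ^ 2 := by positivity
    -- The lower bound on `|R_-|` lets the single weight of order `m` control every derivative of
    -- order `j ≤ m`.
    have h3 : ‖Rminus kx ky ε ν η‖ ^ j ≤ (c ^ (m - j))⁻¹ * ‖Rminus kx ky ε ν η‖ ^ m := by
      rw [← div_eq_inv_mul, le_div_iff₀ (by positivity)]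
      calc _ ≤ ‖Rminus kx ky ε ν η‖ ^ j * ‖Rminus kx ky ε ν η‖ ^ (m - j) := by
            gcongr
            exact hcle η
        _ = _ := by rw [← pow_add, Nat.add_sub_cancel' hj]
    rw [Real.norm_of_nonneg (by positivity), norm_mul, norm_pow, norm_mul, Complex.norm_real,
      Real.norm_of_nonneg (by positivity), div_le_iff₀ h1]
    refine (mul_le_mul (hle f η) h3 (by positivity) (by positivity)).trans (le_of_eq ?_)
    rw [Real.rpow_sub h2]
    field_simp

end Solution

end ObliqueParaxial

end

theorem corollary2 (kx ky ε ν : ℝ) (hkx : 0 < kx) (hky : ky ≠ 0) (hk : kx ^ 2 + ky ^ 2 = 1)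
    (hε : 0 < ε) (hν : 0 < ν) (g : 𝓢'(ℝ, ℂ)) (u : ℝ → 𝓢'(ℝ, ℂ))
    (hu : ObliqueParaxial.IsHalfPlaneSolution kx ky ε ν g u) :
    (ObliqueParaxial.WeightedFourierL2
        (fun η => 1 / ((1 + |η| ^ 2) ^ (1 / 4 : ℝ) *
          Real.sqrt |(ObliqueParaxial.Rminus kx ky ε ν η).re|)) g →
      ObliqueParaxial.MemL2HalfPlane u) ∧
    (∀ s : ℝ, 0 < s →
      ObliqueParaxial.WeightedFourierL2
        (fun η => (1 + |η| ^ 2) ^ (s / 2) /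
          Real.sqrt |(ObliqueParaxial.Rminus kx ky ε ν η).re|) g →
      ObliqueParaxial.MemLinftyL2 u) ∧
    (∀ s : ℝ, 0 < s → ∀ m : ℕ,
      ObliqueParaxial.WeightedFourierL2
        (fun η => (1 + |η| ^ 2) ^ (s / 2) * ‖ObliqueParaxial.Rminus kx ky ε ν η‖ ^ m /
          Real.sqrt |(ObliqueParaxial.Rminus kx ky ε ν η).re|) g →
      ObliqueParaxial.MemLinftyHm m u) := by
  have h : ObliqueParaxial.Admissible kx ky ε ν := ⟨hkx, hky, hk, hε, hν⟩
  refine ⟨ObliqueParaxial.memL2HalfPlane_of_weightedFourierL2 h hu, fun s hs hg => ?_,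
    fun s hs m => ObliqueParaxial.memLinftyHm_of_weightedFourierL2 h hu hs m⟩
  refine (ObliqueParaxial.memLinftyHm_of_weightedFourierL2 h hu hs 0 ?_).memLinftyL2
  simpa only [pow_zero, mul_one] using hg
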